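/- Let $n\ge 1$. Let $\mathcal X$ be a complex manifold of dimension $n+1$ with a Kähler metric $\omega = i\,g_{j\bar k}\,dz^j\wedge d\bar z^k$, write $\langle\cdot,\cdot\rangle$ for the complex bilinear extension of the metric with $\langle\partial_j,\partial_{\bar k}\rangle=g_{j\bar k}$, and put $|V|^2=\langle V,\overline V\rangle$. Let $M$ be a smooth manifold of real dimension $2n+1$, $\iota\colon M\to\mathcal X$ a smooth immersion, $T^{1,0}M=\mathbb CTM\cap T^{1,0}\mathcal X$, $H(M)=\operatorname{Re}T^{1,0}M$, and let $\theta$ be a smooth real $1$-form on $M$ with $\ker\theta=H(M)$ and $d\theta=\iota^*\omega$ (that is, $(M,\theta)$ is a semi-isometrically immersed pseudohermitian real hypersurface). Let $T$ be the Reeb field ($\theta(T)=1$, $T\rfloor d\theta=0$), let $\nabla$ be the Tanaka–Webster connection of $(M,\theta)$, with curvature $R(X,Y)=[\nabla_X,\nabla_Y]-\nabla_{[X,Y]}$ and pseudohermitian torsion $\tau Z=\nabla_TZ-\nabla_ZT-[T,Z]$, and let $\widetilde\nabla$, $\widetilde R$ be the Chern connection of $\omega$ and its curvature. For $0\ne Z\in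 T^{1,0}M$ put $$K(Z)=\frac{\langle R(Z,\overline Z)Z,\overline Z\rangle}{2|Z|^4},\qquad \tilde K(Z)=\frac{\langle \widetilde R(Z,\overline Z)Z,\overline Z\rangle}{|Z|^4},\qquad A(Z)=\frac{i\,\langle\tau Z,Z\rangle}{|Z|^2}.$$ Let $\mathrm{II}(X,Y)=\widetilde\nabla_XY-\nabla_XY$, let $H=\frac1n\sum_{\alpha=1}^n \mathrm{II}(\overline{Z_\alpha},Z_\alpha)$ for a unitary basis $(Z_\alpha)$ of $T^{1,0}M$, $\mu=\frac12(H+\overline H)$, and $h(X,Y)=\langle \mathrm{II}(X,Y),\mu\rangle/|\mu|$ for $X,Y\in H(M)$. Call $(M,\theta)$ pseudohermitian $\mathbb C$-convex (strictly, respectively) if $h$ is positive semi-definite (positive definite, respectively) on $H(M)$ at every point. 1. $(M,\theta)$ is pseudohermitian $\mathbb C$-convex if and only if $|A(Z)|\le|H|^2$ for all nonzero $Z\in T^{1,0}M$. 2. $(M,\theta)$ is strictly pseudohermitian $\mathbb C$-convex if and only if $|A(Z)|<|H|^2$ for all nonzero $Z\in T^{1,0}M$. 3. If $(M,\theta)$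 is pseudohermitian $\mathbb C$-convex, then $K(Z)\ge\frac12\tilde K(Z)+\frac12|H|^2$ for all nonzero $Z\in T^{1,0}M$. 4. Both inequalities are sharp for every $n\ge1$: let $E=\{z\in\mathbb C^{n+1}:\varrho(z)=0\}$, $\varrho(z)=\sum_{j=1}^{n+1}|z_j|^2+\operatorname{Re}\sum_{j=1}^{n+1}z_j^2-1$, with $\theta$ the pullback of $i\bar\partial\varrho$ to $E$, and let $\mathbb C^{n+1}$ carry $\omega=i\sum_j dz_j\wedge d\bar z_j$. Then $(E,\theta)$ is a semi-isometrically immersed pseudohermitian real hypersurface, it is pseudohermitian $\mathbb C$-convex, and at every point of $E$ there is a nonzero $(1,0)$-vector $Z$ with $|A(Z)|=|H|^2$ and $K(Z)=\frac12\tilde K(Z)+\frac12|H|^2$. -/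

import Mathlib

open scoped Manifold ContDiff

noncomputable section

namespace PseudoHermitian

/-- Real coordinate space `ℝ^m`, the model of the hypersurface. -/
abbrev RVec (m : ℕ) := Fin m → ℝ

/-- Complex coordinate space `ℂ^m`.  It is used as the model of an `m`-dimensional complex
manifold, and also as the complexification of `ℝ^m` (with `star` the complex conjugation). -/
abbrev CVec (m : ℕ) := Fin m → ℂ

/-! ### Complexification of `ℝ^m` -/

def rePart {m : ℕ} (Z : CVec m) : RVec m := fun k => (Z k).re

def imPart {m : ℕ} (Z : CVec m) : RVec m := fun k => (Z k).im

/-- The inclusion of `ℝ^m` into its complexification. -/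
def toC {m : ℕ} (v : RVec m) : CVec m := fun k => (v k : ℂ)

/-- Derivative of a function on `ℝ^m` along a complex tangent vector:
`Z f = (Re Z) f + i (Im Z) f`. -/
def dC {m : ℕ} {V : Type*} [NormedAddCommGroup V] [NormedSpace ℝ V] [NormedSpace ℂ V]
    (f : RVec m → V) (y : RVec m) (Z : CVec m) : V :=
  fderiv ℝ f y (rePart Z) + Complex.I • fderiv ℝ f y (imPart Z)

/-- Complex bilinear extension of a real bilinear form. -/
def bilC {m : ℕ} (b : RVec m → RVec m → ℝ) (Z W : CVec m) : ℂ :=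
  ((b (rePart Z) (rePart W) - b (imPart Z) (imPart W) : ℝ) : ℂ) +
    Complex.I * ((b (rePart Z) (imPart W) + b (imPart Z) (rePart W) : ℝ) : ℂ)

/-! ### Kähler metrics in holomorphic coordinates

A Hermitian metric on an open subset of `ℂ^N` is given by its matrix `g j k = g_{j k̄}`. -/

/-- Wirtinger derivative `∑ a^j ∂f/∂z^j`. -/
def wirt {N : ℕ} {V : Type*} [NormedAddCommGroup V] [NormedSpace ℝ V] [NormedSpace ℂ V]
    (f : CVec N → V) (x a : CVec N) : V :=
  (1 / 2 : ℂ) • (fderiv ℝ f x a - Complex.I • fderiv ℝ f x (Complex.I • a))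

/-- Wirtinger derivative `∑ conj(b^j) ∂f/∂z̄^j`. -/
def wirtBar {N : ℕ} {V : Type*} [NormedAddCommGroup V] [NormedSpace ℝ V] [NormedSpace ℂ V]
    (f : CVec N → V) (x b : CVec N) : V :=
  (1 / 2 : ℂ) • (fderiv ℝ f x b + Complex.I • fderiv ℝ f x (Complex.I • b))

/-- `∑ g_{j k̄} a^j conj(b^k)`, that is `⟨a, b̄⟩` for `(1,0)`-vectors `a`, `b`. -/
def herm {N : ℕ} (g : Matrix (Fin N) (Fin N) ℂ) (a b : CVec N) : ℂ :=
  ∑ j, ∑ k, g j k * a j * star (b k)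

/-- The form `ω = i g_{j k̄} dz^j ∧ dz̄^k`, evaluated on two real tangent vectors `u`, `v`
(a real tangent vector is given by its values under `dz^1, …, dz^N`). -/
def kahlerForm {N : ℕ} (g : Matrix (Fin N) (Fin N) ℂ) (u v : CVec N) : ℂ :=
  Complex.I * ∑ j, ∑ k, g j k * (u j * star (v k) - v j * star (u k))

/-- The Christoffel symbols `Γ^l_{jk} = g^{l s̄} ∂_j g_{k s̄}` of the Chern connection, contracted
with `a^j c^k`: if `c` is a constant `(1,0)`-field and `a` a `(1,0)`-vector, this is `∇̃_a c`. -/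
def chernGamma {N : ℕ} (g : CVec N → Matrix (Fin N) (Fin N) ℂ) (x a c : CVec N) : CVec N :=
  fun l => ∑ k, ∑ s, c k * wirt (fun x' => g x' k s) x a * (g x)⁻¹ s l

/-- The curvature `R̃(a, b̄) c` of the Chern connection for `(1,0)`-vectors `a`, `b`, `c`; since
the connection form is of type `(1,0)` it is `-∂̄_{b̄} (Γ(a) c)`. -/
def chernCurv {N : ℕ} (g : CVec N → Matrix (Fin N) (Fin N) ℂ) (x a b c : CVec N) : CVec N :=
  -wirtBar (fun x' => chernGamma g x' a c) x b

/-- Holomorphic sectional curvature `K̃(a) = ⟨R̃(a, ā) a, ā⟩ / |a|⁴` of a Kähler metric. -/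
def kahlerHSC {N : ℕ} (g : CVec N → Matrix (Fin N) (Fin N) ℂ) (x a : CVec N) : ℝ :=
  (herm (g x) (chernCurv g x a a a) a / (herm (g x) a a) ^ 2).re

/-- Complexified tangent vectors of `ℂ^N`: the pair `(a, b)` is `a^j ∂/∂z^j + b^j ∂/∂z̄^j`. -/
abbrev CTan (N : ℕ) := CVec N × CVec N

/-- Complex conjugation of complexified tangent vectors. -/
def conjT {N : ℕ} (V : CTan N) : CTan N := (star V.2, star V.1)

/-- The complex bilinear extension of the Riemannian metric, normalized by
`⟨∂_j, ∂_k̄⟩ = g_{j k̄}`. -/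
def pairT {N : ℕ} (g : Matrix (Fin N) (Fin N) ℂ) (V W : CTan N) : ℂ :=
  herm g V.1 (star W.2) + herm g W.1 (star V.2)

/-- `|V|² = ⟨V, V̄⟩`. -/
def normSqT {N : ℕ} (g : Matrix (Fin N) (Fin N) ℂ) (V : CTan N) : ℝ := (pairT g V (conjT V)).re

/-! ### Pseudohermitian geometry of a parametrized hypersurface `F : ℝ^m ⇀ ℂ^N`

Here `θ` is a real `1`-form on (an open subset of) `ℝ^m`. -/

section LocalGeometry

variable {m N : ℕ}

/-- `F_* Z`, with components `Z(z^j)` and `Z(z̄^j)`. -/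
def push (F : RVec m → CVec N) (y : RVec m) (Z : CVec m) : CTan N :=
  (dC F y Z, dC (fun y' => star (F y')) y Z)

/-- `T^{1,0}M = ℂTM ∩ T^{1,0}X`. -/
def T10 (F : RVec m → CVec N) (y : RVec m) : Submodule ℂ (CVec m) where
  carrier := {Z | (push F y Z).2 = 0}
  zero_mem' := by
    have h1 : rePart (0 : CVec m) = 0 := by ext; simp [rePart]
    have h2 : imPart (0 : CVec m) = 0 := by ext; simp [imPart]
    simp [push, dC, h1, h2]
  add_mem' := by
    intro a b ha hb
    have h1 : rePart (a + b) = rePart a + rePart b := by ext; simp [rePart]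
    have h2 : imPart (a + b) = imPart a + imPart b := by ext; simp [imPart]
    simp only [Set.mem_ofPred_eq, push, dC, h1, h2, map_add, smul_add] at *
    rw [add_add_add_comm, ha, hb, add_zero]
  smul_mem' := by
    intro c a ha
    have h1 : rePart (c • a) = c.re • rePart a - c.im • imPart a := by ext; simp [rePart, imPart]
    have h2 : imPart (c • a) = c.re • imPart a + c.im • rePart a := by ext; simp [rePart, imPart]
    simp only [Set.mem_ofPred_eq, push, dC, h1, h2] at *
    simp only [map_add, map_sub, map_smul]
    set p := fderiv ℝ (fun y' => star (F y')) y (rePart a)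
    set q := fderiv ℝ (fun y' => star (F y')) y (imPart a)
    have h3 : c • (p + Complex.I • q) = 0 := by rw [ha, smul_zero]
    rw [← h3]
    ext k
    apply Complex.ext <;> simp <;> ring

/-- `X ∈ H(M) = Re T^{1,0}M`, for a real vector `X` regarded as an element of `ℂTM`. -/
def IsHorizontal (F : RVec m → CVec N) (y : RVec m) (X : CVec m) : Prop :=
  ∃ Z ∈ T10 F y, X = Z + star Z

/-- `dθ(u, v)`. -/
def dForm (θ : RVec m → (RVec m →L[ℝ] ℝ)) (y u v : RVec m) : ℝ :=
  fderiv ℝ θ y u v - fderiv ℝ θ y v u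

/-- The Levi metric `⟨Z, W̄⟩ = -i dθ(Z, W̄)`, so that `dθ = i h_{αβ̄} θ^α ∧ θ^β̄`. -/
def levi (θ : RVec m → (RVec m →L[ℝ] ℝ)) (y : RVec m) (Z W : CVec m) : ℂ :=
  -Complex.I * bilC (dForm θ y) Z (star W)

/-- The Reeb field: the unique `T` with `θ(T) = 1` and `T ⌟ dθ = 0`. -/
def reeb (θ : RVec m → (RVec m →L[ℝ] ℝ)) (y : RVec m) : RVec m :=
  Classical.epsilon fun T => θ y T = 1 ∧ ∀ v, dForm θ y T v = 0

/-- The Reeb field as a section of `ℂTM`. -/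
def reebC (θ : RVec m → (RVec m →L[ℝ] ℝ)) (y : RVec m) : CVec m := toC (reeb θ y)

/-- Christoffel symbols in real coordinates of a linear connection on `ℂTM`. -/
abbrev Christoffel (m : ℕ) := RVec m → (CVec m →L[ℂ] CVec m →L[ℂ] CVec m)

/-- The covariant derivative `∇_X Y` of a complex vector field `Y`. -/
def cov (Γ : Christoffel m) (Y : RVec m → CVec m) (y : RVec m) (X : CVec m) : CVec m :=
  dC Y y X + Γ y X (Y y)

/-- The torsion `∇_X Y - ∇_Y X - [X, Y]` of a linear connection. -/
def torsion (Γ : Christoffel m) (y : RVec m) (X Y : CVec m) : CVec m := Γ y X Y - Γ y Y X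

/-- The curvature `R(X, Y) Z = ∇_X ∇_Y Z - ∇_Y ∇_X Z - ∇_{[X, Y]} Z` of a linear connection. -/
def curv (Γ : Christoffel m) (y : RVec m) (X Y Z : CVec m) : CVec m :=
  dC Γ y X Y Z - dC Γ y Y X Z + Γ y X (Γ y Y Z) - Γ y Y (Γ y X Z)

/-- A smooth local section of `T^{1,0}M` over `U`. -/
def IsSection10 (F : RVec m → CVec N) (U : Set (RVec m)) (W : RVec m → CVec m) : Prop :=
  ContDiffOn ℝ ∞ W U ∧ ∀ y ∈ U, W y ∈ T10 F y

/-- `Γ` is the Tanaka–Webster connection of `(T^{1,0}M, θ)` over `U`: a real connection with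
`∇ T^{1,0}M ⊆ T^{1,0}M`, `∇T = 0`, compatible with the Levi metric
(`dh_{αβ̄} = ω_{αβ̄} + ω_{β̄α}`) and with the torsion prescribed by
`dθ^β = θ^α ∧ ω_α^β + A^β_ᾱ θ ∧ θ^ᾱ` and `dθ = i h_{αβ̄} θ^α ∧ θ^β̄`. -/
structure IsTanakaWebster (F : RVec m → CVec N) (θ : RVec m → (RVec m →L[ℝ] ℝ))
    (U : Set (RVec m)) (Γ : Christoffel m) : Prop where
  smooth : ContDiffOn ℝ ∞ Γ U
  real : ∀ y ∈ U, ∀ X Y, star (Γ y X Y) = Γ y (star X) (star Y)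
  preserves : ∀ W, IsSection10 F U W → ∀ y ∈ U, ∀ X, cov Γ W y X ∈ T10 F y
  reeb_parallel : ∀ y ∈ U, ∀ X, cov Γ (reebC θ) y X = 0
  metric : ∀ Z W, IsSection10 F U Z → IsSection10 F U W → ∀ y ∈ U, ∀ X,
    dC (fun y' => levi θ y' (Z y') (W y')) y X =
      levi θ y (cov Γ Z y X) (W y) + levi θ y (Z y) (cov Γ W y (star X))
  torsion_20 : ∀ y ∈ U, ∀ Z ∈ T10 F y, ∀ W ∈ T10 F y, torsion Γ y Z W = 0
  torsion_11 : ∀ y ∈ U, ∀ Z ∈ T10 F y, ∀ W ∈ T10 F y,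
    torsion Γ y Z (star W) = (Complex.I * levi θ y Z W) • reebC θ y
  torsion_reeb : ∀ y ∈ U, ∀ Z ∈ T10 F y, star (torsion Γ y (reebC θ y) Z) ∈ T10 F y

/-- The Tanaka–Webster connection near `y`; it exists, and its germ at `y` is unique, when `θ` is
a pseudohermitian structure. -/
def twConn (F : RVec m → CVec N) (θ : RVec m → (RVec m →L[ℝ] ℝ)) (y : RVec m) : Christoffel m :=
  Classical.epsilon fun Γ => ∃ U, IsOpen U ∧ y ∈ U ∧ IsTanakaWebster F θ U Γ

/-- Tanaka–Webster holomorphic sectional curvature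
`K(Z) = ½ ⟨R(Z, Z̄) Z, Z̄⟩ / |Z|⁴ = ½ R_{αβ̄γσ̄} ζ^α ζ^β̄ ζ^γ ζ^σ̄ / |Z|⁴`. -/
def twHSC (F : RVec m → CVec N) (θ : RVec m → (RVec m →L[ℝ] ℝ)) (y : RVec m) (Z : CVec m) : ℝ :=
  ((1 / 2 : ℂ) * levi θ y (curv (twConn F θ y) y Z (star Z) Z) Z / (levi θ y Z Z) ^ 2).re

/-- Pseudohermitian torsion `τ Z`, the torsion of the Tanaka–Webster connection on `(T, Z)`. -/
def tau (F : RVec m → CVec N) (θ : RVec m → (RVec m →L[ℝ] ℝ)) (y : RVec m) (Z : CVec m) :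
    CVec m :=
  torsion (twConn F θ y) y (reebC θ y) Z

/-- Holomorphic sectional torsion
`A(Z) = i ⟨τ Z, Z⟩ / |Z|² = i A_{αβ} ζ^α ζ^β / |Z|²` (here `τ Z` is of type `(0,1)`). -/
def secTorsion (F : RVec m → CVec N) (θ : RVec m → (RVec m →L[ℝ] ℝ)) (y : RVec m)
    (Z : CVec m) : ℂ :=
  Complex.I * levi θ y Z (star (tau F θ y Z)) / levi θ y Z Z

/-- The Chern connection on `ℂTX` along `F`: the derivative `∇̃_X V` of a field `V` along `F`. -/
def chernAlong (g : CVec N → Matrix (Fin N) (Fin N) ℂ) (F : RVec m → CVec N)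
    (V : RVec m → CTan N) (y : RVec m) (X : CVec m) : CTan N :=
  (dC (fun y' => (V y').1) y X + chernGamma g (F y) (push F y X).1 (V y).1,
   dC (fun y' => (V y').2) y X +
    star (chernGamma g (F y) (star (push F y X).2) (star (V y).2)))

/-- The second fundamental form `II(X, Y) = ∇̃_X Y - ∇_X Y`.  It is tensorial, and `Y` is extended
with constant coordinates. -/
def secondFF (g : CVec N → Matrix (Fin N) (Fin N) ℂ) (F : RVec m → CVec N)
    (θ : RVec m → (RVec m →L[ℝ] ℝ)) (y : RVec m) (X Y : CVec m) : CTan N :=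
  chernAlong g F (fun y' => push F y' Y) y X - push F y (twConn F θ y y X Y)

/-- `e` is a unitary basis of `T^{1,0}M` at `y`. -/
def IsUnitaryBasis {n : ℕ} (F : RVec m → CVec N) (θ : RVec m → (RVec m →L[ℝ] ℝ)) (y : RVec m)
    (e : Fin n → CVec m) : Prop :=
  Submodule.span ℂ (Set.range e) = T10 F y ∧
    ∀ α β, levi θ y (e α) (e β) = if α = β then 1 else 0

/-- A unitary basis of `T^{1,0}M` at `y`, where `n` is the CR dimension. -/
def unitaryBasis (n : ℕ) (F : RVec m → CVec N) (θ : RVec m → (RVec m →L[ℝ] ℝ)) (y : RVec m) :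
    Fin n → CVec m :=
  Classical.epsilon fun e => IsUnitaryBasis F θ y e

/-- The `(1,0)`-mean curvature vector `H = (1/n) ∑ II(Z_ᾱ, Z_α)`. -/
def meanCurv (n : ℕ) (g : CVec N → Matrix (Fin N) (Fin N) ℂ) (F : RVec m → CVec N)
    (θ : RVec m → (RVec m →L[ℝ] ℝ)) (y : RVec m) : CTan N :=
  (1 / n : ℂ) • ∑ α, secondFF g F θ y (star (unitaryBasis n F θ y α)) (unitaryBasis n F θ y α)

/-- `μ = ½ (H + H̄)`. -/
def muVec (n : ℕ) (g : CVec N → Matrix (Fin N) (Fin N) ℂ) (F : RVec m → CVec N)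
    (θ : RVec m → (RVec m →L[ℝ] ℝ)) (y : RVec m) : CTan N :=
  (1 / 2 : ℂ) • (meanCurv n g F θ y + conjT (meanCurv n g F θ y))

/-- The scalar second fundamental form `h(X, Y) = ⟨II(X, Y), μ⟩ / |μ|` for real `X`, `Y`. -/
def scalarFF (n : ℕ) (g : CVec N → Matrix (Fin N) (Fin N) ℂ) (F : RVec m → CVec N)
    (θ : RVec m → (RVec m →L[ℝ] ℝ)) (y : RVec m) (X Y : CVec m) : ℝ :=
  (pairT (g (F y)) (secondFF g F θ y X Y) (muVec n g F θ y)).re /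
    Real.sqrt (normSqT (g (F y)) (muVec n g F θ y))

end LocalGeometry

/-! ### Kähler manifolds -/

section Kahler

variable {n : ℕ} {X : Type*} [TopologicalSpace X] [ChartedSpace (CVec (n + 1)) X]

/-- The matrix `g_{j k̄}` of a family of forms on the tangent spaces, in the preferred chart
at `x₀`. -/
def coordMatrix (G : ∀ x : X, TangentSpace 𝓘(ℂ, CVec (n + 1)) x →
      TangentSpace 𝓘(ℂ, CVec (n + 1)) x → ℂ)
    (x₀ : X) (z : CVec (n + 1)) : Matrix (Fin (n + 1)) (Fin (n + 1)) ℂ :=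
  fun j k => G ((extChartAt 𝓘(ℂ, CVec (n + 1)) x₀).symm z)
    (mfderiv 𝓘(ℂ, CVec (n + 1)) 𝓘(ℂ, CVec (n + 1))
      (extChartAt 𝓘(ℂ, CVec (n + 1)) x₀).symm z (Pi.single j 1 : CVec (n + 1)))
    (mfderiv 𝓘(ℂ, CVec (n + 1)) 𝓘(ℂ, CVec (n + 1))
      (extChartAt 𝓘(ℂ, CVec (n + 1)) x₀).symm z (Pi.single k 1 : CVec (n + 1)))

end Kahler

/-- A Kähler metric on a complex manifold of dimension `n + 1`: a smooth Hermitian metric on the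
holomorphic tangent bundle (linear in the first variable) with closed fundamental form `ω`. -/
structure KahlerMetric (n : ℕ) (X : Type*) [TopologicalSpace X] [ChartedSpace (CVec (n + 1)) X]
    where
  form : ∀ x : X, TangentSpace 𝓘(ℂ, CVec (n + 1)) x → TangentSpace 𝓘(ℂ, CVec (n + 1)) x → ℂ
  add_left : ∀ x u v w, form x (u + v) w = form x u w + form x v w
  smul_left : ∀ x (c : ℂ) u w, form x (c • u) w = c * form x u w
  conj_symm : ∀ x u w, star (form x u w) = form x w u
  pos : ∀ x u, u ≠ 0 → 0 < (form x u u).re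
  smooth : ∀ x₀ j k, ContDiffOn ℝ ∞ (fun z => coordMatrix form x₀ z j k)
    (extChartAt 𝓘(ℂ, CVec (n + 1)) x₀).target
  /-- `dω = 0`, evaluated on constant vectors. -/
  closed : ∀ x₀, ∀ z ∈ (extChartAt 𝓘(ℂ, CVec (n + 1)) x₀).target, ∀ u v w : CVec (n + 1),
    fderiv ℝ (fun z' => kahlerForm (coordMatrix form x₀ z') v w) z u +
    fderiv ℝ (fun z' => kahlerForm (coordMatrix form x₀ z') w u) z v +
    fderiv ℝ (fun z' => kahlerForm (coordMatrix form x₀ z') u v) z w = 0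

/-! ### Hypersurfaces in Kähler manifolds

`M` is a manifold of dimension `2 n + 1` with a map `ι : M → X` and a `1`-form `θ`.  All invariants
at `p` are computed in the preferred charts at `p` and `ι p`; a vector of `ℂ ⊗ T_p M` is given by
its coordinates `Z : CVec (2 * n + 1)` in the preferred chart at `p`. -/

section Hypersurface

variable {n : ℕ} {X : Type*} [TopologicalSpace X] [ChartedSpace (CVec (n + 1)) X]
  {M : Type*} [TopologicalSpace M] [ChartedSpace (RVec (2 * n + 1)) M]

/-- The domain, in the chart at `p`, on which `ι` takes values in the chart at `ι p`. -/
def chartDom (ι : M → X) (p : M) : Set (RVec (2 * n + 1)) :=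
  (extChartAt 𝓘(ℝ, RVec (2 * n + 1)) p).target ∩
    {y | ι ((extChartAt 𝓘(ℝ, RVec (2 * n + 1)) p).symm y) ∈
      (extChartAt 𝓘(ℂ, CVec (n + 1)) (ι p)).source}

/-- `ι` in the charts at `p` and `ι p`. -/
def chartMap (ι : M → X) (p : M) : RVec (2 * n + 1) → CVec (n + 1) :=
  fun y => extChartAt 𝓘(ℂ, CVec (n + 1)) (ι p) (ι ((extChartAt 𝓘(ℝ, RVec (2 * n + 1)) p).symm y))

/-- `θ` in the chart at `p`. -/
def chartForm (θ : ∀ p : M, TangentSpace 𝓘(ℝ, RVec (2 * n + 1)) p →L[ℝ] ℝ) (p : M) :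
    RVec (2 * n + 1) → (RVec (2 * n + 1) →L[ℝ] ℝ) :=
  fun y => (θ ((extChartAt 𝓘(ℝ, RVec (2 * n + 1)) p).symm y)).comp
    (mfderiv 𝓘(ℝ, RVec (2 * n + 1)) 𝓘(ℝ, RVec (2 * n + 1))
      (extChartAt 𝓘(ℝ, RVec (2 * n + 1)) p).symm y)

/-- The coordinates of `p` in its preferred chart. -/
def chartPt (p : M) : RVec (2 * n + 1) := extChartAt 𝓘(ℝ, RVec (2 * n + 1)) p p

/-- `(M, θ)` is a pseudohermitian real hypersurface, immersed in `X` by `ι` and semi-isometric: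
`ι` is a smooth immersion, `θ` is a smooth real `1`-form with kernel `H(M)`, and `dθ = ι^* ω`.
(As `ω` is positive, `dθ` is then positive definite on `H(M)`.) -/
structure IsSemiIsometric (g : KahlerMetric n X) (ι : M → X)
    (θ : ∀ p : M, TangentSpace 𝓘(ℝ, RVec (2 * n + 1)) p →L[ℝ] ℝ) : Prop where
  smooth_map : ContMDiff 𝓘(ℝ, RVec (2 * n + 1)) 𝓘(ℝ, CVec (n + 1)) ∞ ι
  immersion : ∀ p, Function.Injective
    (mfderiv 𝓘(ℝ, RVec (2 * n + 1)) 𝓘(ℝ, CVec (n + 1)) ι p)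
  smooth_form : ∀ p, ContDiffOn ℝ ∞ (chartForm θ p) (extChartAt 𝓘(ℝ, RVec (2 * n + 1)) p).target
  ker_eq : ∀ p, ∀ y ∈ chartDom ι p, ∀ v : RVec (2 * n + 1),
    chartForm θ p y v = 0 ↔ IsHorizontal (chartMap ι p) y (toC v)
  dForm_eq : ∀ p, ∀ y ∈ chartDom ι p, ∀ u v : RVec (2 * n + 1),
    (dForm (chartForm θ p) y u v : ℂ) =
      kahlerForm (coordMatrix g.form (ι p) (chartMap ι p y))
        (fderiv ℝ (chartMap ι p) y u) (fderiv ℝ (chartMap ι p) y v)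

/-- The holomorphic tangent space `T^{1,0}_p M`. -/
def holTangent (ι : M → X) (p : M) : Submodule ℂ (CVec (2 * n + 1)) :=
  T10 (chartMap ι p) (chartPt p)

/-- The squared length `|H|²` of the `(1,0)`-mean curvature vector at `p`. -/
def meanCurvSq (g : KahlerMetric n X) (ι : M → X)
    (θ : ∀ p : M, TangentSpace 𝓘(ℝ, RVec (2 * n + 1)) p →L[ℝ] ℝ) (p : M) : ℝ :=
  normSqT (coordMatrix g.form (ι p) (chartMap ι p (chartPt p)))
    (meanCurv n (coordMatrix g.form (ι p)) (chartMap ι p) (chartForm θ p) (chartPt p))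

/-- The scalar second fundamental form at `p`. -/
def scalarForm (g : KahlerMetric n X) (ι : M → X)
    (θ : ∀ p : M, TangentSpace 𝓘(ℝ, RVec (2 * n + 1)) p →L[ℝ] ℝ) (p : M)
    (U V : CVec (2 * n + 1)) : ℝ :=
  scalarFF n (coordMatrix g.form (ι p)) (chartMap ι p) (chartForm θ p) (chartPt p) U V

/-- The holomorphic sectional torsion `A(Z)` at `p`. -/
def holTorsion (ι : M → X) (θ : ∀ p : M, TangentSpace 𝓘(ℝ, RVec (2 * n + 1)) p →L[ℝ] ℝ) (p : M)
    (Z : CVec (2 * n + 1)) : ℂ :=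
  secTorsion (chartMap ι p) (chartForm θ p) (chartPt p) Z

/-- The Tanaka–Webster holomorphic sectional curvature `K(Z)` at `p`. -/
def holCurv (ι : M → X) (θ : ∀ p : M, TangentSpace 𝓘(ℝ, RVec (2 * n + 1)) p →L[ℝ] ℝ) (p : M)
    (Z : CVec (2 * n + 1)) : ℝ :=
  twHSC (chartMap ι p) (chartForm θ p) (chartPt p) Z

/-- The holomorphic sectional curvature `K̃(Z)` of the ambient Kähler metric, for
`Z ∈ T^{1,0}_p M`. -/
def ambientCurv (g : KahlerMetric n X) (ι : M → X) (p : M) (Z : CVec (2 * n + 1)) : ℝ :=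
  kahlerHSC (coordMatrix g.form (ι p)) (chartMap ι p (chartPt p))
    (push (chartMap ι p) (chartPt p) Z).1

/-- Pseudohermitian `ℂ`-convexity: the scalar second fundamental form is positive semi-definite
on `H(M)`. -/
def IsCConvex (g : KahlerMetric n X) (ι : M → X)
    (θ : ∀ p : M, TangentSpace 𝓘(ℝ, RVec (2 * n + 1)) p →L[ℝ] ℝ) : Prop :=
  ∀ p : M, ∀ U, IsHorizontal (chartMap ι p) (chartPt p) U → 0 ≤ scalarForm g ι θ p U U

/-- Strict pseudohermitian `ℂ`-convexity: the scalar second fundamental form is positive definite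
on `H(M)`. -/
def IsStrictlyCConvex (g : KahlerMetric n X) (ι : M → X)
    (θ : ∀ p : M, TangentSpace 𝓘(ℝ, RVec (2 * n + 1)) p →L[ℝ] ℝ) : Prop :=
  ∀ p : M, ∀ U, IsHorizontal (chartMap ι p) (chartPt p) U → U ≠ 0 → 0 < scalarForm g ι θ p U U

end Hypersurface

/-! ### The example -/

/-- The hypersurface `∑ |z_j|² + Re ∑ z_j² = 1` of `ℂ^{n+1}`. -/
def quadric (n : ℕ) : Set (CVec (n + 1)) :=
  {z | ∑ j, ‖z j‖ ^ 2 + (∑ j, z j ^ 2).re = 1}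

/-- The form `∑ u_j conj(v_j)` on the tangent spaces of `ℂ^{n+1}`. -/
def flatForm (n : ℕ) (x : CVec (n + 1)) (u v : TangentSpace 𝓘(ℂ, CVec (n + 1)) x) : ℂ :=
  ∑ j, (show CVec (n + 1) from u) j * star ((show CVec (n + 1) from v) j)

theorem coordMatrix_flatForm {n : ℕ} (x₀ z : CVec (n + 1)) :
    coordMatrix (flatForm n) x₀ z = 1 := by
  have h : ∀ w : CVec (n + 1), (mfderiv 𝓘(ℂ, CVec (n + 1)) 𝓘(ℂ, CVec (n + 1))
      (extChartAt 𝓘(ℂ, CVec (n + 1)) x₀).symm z w : CVec (n + 1)) = w := by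
    intro w
    have h' : (extChartAt 𝓘(ℂ, CVec (n + 1)) x₀).symm = PartialEquiv.refl (CVec (n + 1)) := by
      simp only [extChartAt_model_space_eq_id, PartialEquiv.refl_symm]
    rw [h']
    exact congrArg (fun L : CVec (n + 1) →L[ℂ] CVec (n + 1) => L w) mfderiv_id
  funext j k
  have e : coordMatrix (flatForm n) x₀ z j k =
      ∑ l, (Pi.single j 1 : CVec (n + 1)) l * star ((Pi.single k 1 : CVec (n + 1)) l) := by
    unfold coordMatrix flatForm
    refine Finset.sum_congr rfl fun l _ => ?_
    exact congrArg₂ (fun a b : CVec (n + 1) => a l * star (b l)) (h _) (h _)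
  rw [e]
  by_cases hjk : j = k
  · subst hjk
    simp [Pi.single_apply]
  · simp [Pi.single_apply, hjk, Ne.symm hjk]

/-- The flat Kähler metric on `ℂ^{n+1}`, with `ω = i ∑ dz_j ∧ dz̄_j`. -/
def flatMetric (n : ℕ) : KahlerMetric n (CVec (n + 1)) where
  form := flatForm n
  add_left := by
    intro x u v w
    unfold flatForm
    rw [← Finset.sum_add_distrib]
    exact Finset.sum_congr rfl fun j _ => add_mul _ _ _
  smul_left := by
    intro x c u w
    unfold flatForm
    rw [Finset.mul_sum]
    exact Finset.sum_congr rfl fun j _ => mul_assoc _ _ _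
  conj_symm := by
    intro x u w
    unfold flatForm
    rw [star_sum]
    refine Finset.sum_congr rfl fun j _ => ?_
    rw [star_mul, star_star]
  pos := by
    intro x u hu
    have key : ∀ v : CVec (n + 1), v ≠ 0 → 0 < (∑ j, v j * star (v j)).re := by
      intro v hv
      obtain ⟨j, hj⟩ := Function.ne_iff.mp hv
      rw [Complex.re_sum]
      refine Finset.sum_pos' (fun i _ => ?_) ⟨j, Finset.mem_univ j, ?_⟩
      · simpa [Complex.mul_re] using add_nonneg (mul_self_nonneg (v i).re) (mul_self_nonneg _)
      · have : 0 < Complex.normSq (v j) := Complex.normSq_pos.mpr hj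
        simpa [Complex.mul_re, Complex.normSq_apply] using this
    exact key u hu
  smooth := by
    intro x₀ j k
    simp only [coordMatrix_flatForm]
    exact contDiffOn_const
  closed := by
    intro x₀ z _ u v w
    simp only [coordMatrix_flatForm]
    simp

end PseudoHermitian

end

open PseudoHermitian

/-!
The proof is an extrinsic computation in charts, followed by pointwise algebra.  In the preferred
charts at `p` and `ι p` the hypersurface becomes a parametrization `F` with a contact form `θ` and
a Kähler metric `g` (`IsLocalHypersurface`).  Write `ξ` for the `(1,0)`-part of the pushed forward
Reeb field (`normalVec`) and `κ = |ξ|²` (`normalSq`).  Since `T ⌟ dθ = 0` and `dθ = F^* ω`, the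
vector `ξ` spans the orthogonal complement of `T^{1,0}M` in `T^{1,0}X`.

The Tanaka–Webster connection is only characterized by its properties, so it is first constructed:
on sections `W` of `T^{1,0}M` it is `∇_X W = (∇̃_X W)^⊤ - i κ θ(X) W`, the tangential part of the
Chern connection corrected in the Reeb direction, and `T` is parallel (`twForm`).  The Kähler
condition makes the Chern connection torsion free, which gives the required torsion
(`isTanakaWebster`).  The defining properties determine the connection (`tanakaWebster_unique`), so
it can be replaced by this explicit one everywhere.

For `Z`, `W` of type `(1,0)` this yields `II(W̄, Z) = i ⟨Z, W̄⟩ ξ` and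
`II(W, Z) = -(⟨τ W, Z⟩ / κ) ξ`.  Hence `H = i ξ` and `|H|² = κ`, and for the real horizontal vector
`Z + Z̄` the scalar second fundamental form is a positive multiple of `Re A(Z) + |H|²`
(`scalarFF_eq`).  Replacing `Z` by `e^{it} Z` multiplies `A(Z)` by `e^{2it}`, so that (strict)
positivity for all `Z` means `|A| ≤ |H|²` (`|A| < |H|²`).  The Gauss equation (`levi_curvForm`)
becomes `K = ½ K̃ + |H|² - |A|² / (2 |H|²)` (`twHSC_eq`), from which the lower bound for `K`, and
equality when `|A| = |H|²`, are immediate.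

The quadric is `{∑ (Re z_j)² = ½}`.  It is given an atlas by writing it near each of its points `p`
as a graph over the tangent space at `p` (`TangentSplitting.param`).  There `ξ = i Re z`, so
`|H|² = ½`, and `A(Z) = ½ ∑ a_j² / ∑ |a_j|²` for `a = F_* Z`; this is bounded by `½` in absolute
value, with equality when `a` is a real vector orthogonal to `Re z`, and such a vector exists since
`n ≥ 1`.
-/

namespace PseudoHermitian

open Filter Topology ContinuousLinearMap

/-! ### Derivatives along complex tangent vectors -/

/-- A complex bilinear map on finite-dimensional spaces as a continuous bilinear map. -/
noncomputable def toCLM₂ {V W E : Type*} [NormedAddCommGroup V] [NormedSpace ℂ V]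
    [NormedAddCommGroup W] [NormedSpace ℂ W] [NormedAddCommGroup E] [NormedSpace ℂ E]
    [FiniteDimensional ℂ V] [FiniteDimensional ℂ W]
    (B : V →ₗ[ℂ] W →ₗ[ℂ] E) : V →L[ℂ] W →L[ℂ] E :=
  LinearMap.toContinuousLinearMap
    ((LinearMap.toContinuousLinearMap : (W →ₗ[ℂ] E) ≃ₗ[ℂ] (W →L[ℂ] E)).toLinearMap ∘ₗ B)

section ComplexDerivative

variable {m : ℕ} {V W E : Type*} [NormedAddCommGroup V] [NormedSpace ℝ V] [NormedSpace ℂ V]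
  [NormedAddCommGroup W] [NormedSpace ℝ W] [NormedSpace ℂ W]
  [NormedAddCommGroup E] [NormedSpace ℝ E] [NormedSpace ℂ E]

@[simp] lemma rePart_add (Z Z' : CVec m) : rePart (Z + Z') = rePart Z + rePart Z' := by
  ext; simp [rePart]

@[simp] lemma imPart_add (Z Z' : CVec m) : imPart (Z + Z') = imPart Z + imPart Z' := by
  ext; simp [imPart]

@[simp] lemma rePart_star (Z : CVec m) : rePart (star Z) = rePart Z := by
  ext; simp [rePart]

@[simp] lemma imPart_star (Z : CVec m) : imPart (star Z) = -imPart Z := by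
  ext; simp [imPart]

@[simp] lemma rePart_toC (v : RVec m) : rePart (toC v) = v := by ext; simp [rePart, toC]

@[simp] lemma imPart_toC (v : RVec m) : imPart (toC v) = 0 := by ext; simp [imPart, toC]

@[simp] lemma star_toC (v : RVec m) : star (toC v) = toC v := by
  ext; simp [toC]

lemma eq_toC_add (Z : CVec m) : Z = toC (rePart Z) + Complex.I • toC (imPart Z) := by
  ext k
  simp only [toC, rePart, imPart, Pi.add_apply, Pi.smul_apply, smul_eq_mul]
  rw [mul_comm]
  exact (Complex.re_add_im (Z k)).symm

lemma rePart_smul (c : ℂ) (Z : CVec m) :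
    rePart (c • Z) = c.re • rePart Z - c.im • imPart Z := by ext; simp [rePart, imPart]

lemma imPart_smul (c : ℂ) (Z : CVec m) :
    imPart (c • Z) = c.re • imPart Z + c.im • rePart Z := by ext; simp [rePart, imPart]

lemma dC_add_dir (f : RVec m → V) (y : RVec m) (Z Z' : CVec m) :
    dC f y (Z + Z') = dC f y Z + dC f y Z' := by
  simp only [dC, rePart_add, imPart_add, map_add, smul_add]
  abel

lemma dC_smul_dir [IsScalarTower ℝ ℂ V] (f : RVec m → V) (y : RVec m) (c : ℂ) (Z : CVec m) :
    dC f y (c • Z) = c • dC f y Z := by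
  simp only [dC, rePart_smul, imPart_smul, map_add, map_sub, map_smul]
  have h : ∀ (r : ℝ) (v : V), r • v = (r : ℂ) • v := fun r v => by
    rw [← smul_one_smul ℂ r v, Complex.real_smul, mul_one]
  simp only [h]
  generalize fderiv ℝ f y (rePart Z) = a
  generalize fderiv ℝ f y (imPart Z) = b
  conv_rhs => rw [← Complex.re_add_im c]
  have hI : Complex.I * Complex.I = -1 := Complex.I_mul_I
  match_scalars
  · ring
  · linear_combination (-(c.im : ℂ)) * hI

/-- The complex linear extension of the real differential of `f` at `y`. -/
noncomputable def dCL [IsScalarTower ℝ ℂ V] (f : RVec m → V) (y : RVec m) : CVec m →L[ℂ] V :=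
  LinearMap.toContinuousLinearMap
    { toFun := dC f y
      map_add' := dC_add_dir f y
      map_smul' := dC_smul_dir f y }

@[simp] lemma dCL_apply [IsScalarTower ℝ ℂ V] (f : RVec m → V) (y : RVec m) (Z : CVec m) :
    dCL f y Z = dC f y Z := rfl

lemma dC_congr {f f' : RVec m → V} {y : RVec m} (h : f =ᶠ[𝓝 y] f') (Z : CVec m) :
    dC f y Z = dC f' y Z := by
  simp only [dC, h.fderiv_eq]

lemma dC_toC (f : RVec m → V) (y v : RVec m) : dC f y (toC v) = fderiv ℝ f y v := by
  simp [dC]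

@[simp] lemma dC_const (c : V) (y : RVec m) (Z : CVec m) : dC (fun _ => c) y Z = 0 := by
  simp [dC]

lemma dC_add {f f' : RVec m → V} {y : RVec m} (hf : DifferentiableAt ℝ f y)
    (hf' : DifferentiableAt ℝ f' y) (Z : CVec m) :
    dC (fun x => f x + f' x) y Z = dC f y Z + dC f' y Z := by
  simp only [dC, fderiv_fun_add hf hf', add_apply, smul_add]
  abel

lemma dC_sub {f f' : RVec m → V} {y : RVec m} (hf : DifferentiableAt ℝ f y)
    (hf' : DifferentiableAt ℝ f' y) (Z : CVec m) :
    dC (fun x => f x - f' x) y Z = dC f y Z - dC f' y Z := by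
  simp only [dC, fderiv_fun_sub hf hf', sub_apply, smul_sub]
  abel

lemma dC_sum {ι : Type*} (s : Finset ι) {f : ι → RVec m → V} {y : RVec m}
    (hf : ∀ i ∈ s, DifferentiableAt ℝ (f i) y) (Z : CVec m) :
    dC (fun x => ∑ i ∈ s, f i x) y Z = ∑ i ∈ s, dC (f i) y Z := by
  simp only [dC, fderiv_fun_sum hf, sum_apply, Finset.smul_sum,
    Finset.sum_add_distrib]

/-- The Leibniz rule for a real bilinear map which is complex bilinear. -/
lemma dC_bilinear (B : V →L[ℝ] W →L[ℝ] E)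
    (hB₁ : ∀ a b, B (Complex.I • a) b = Complex.I • B a b)
    (hB₂ : ∀ a b, B a (Complex.I • b) = Complex.I • B a b)
    {f : RVec m → V} {f' : RVec m → W} {y : RVec m} (hf : DifferentiableAt ℝ f y)
    (hf' : DifferentiableAt ℝ f' y) (Z : CVec m) :
    dC (fun x => B (f x) (f' x)) y Z = B (dC f y Z) (f' y) + B (f y) (dC f' y Z) := by
  have h := (B.hasFDerivAt_of_bilinear hf.hasFDerivAt hf'.hasFDerivAt).fderiv
  simp only [dC, h, map_add, add_apply, hB₁, hB₂, smul_add,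
    ContinuousLinearMap.precompR_apply, ContinuousLinearMap.precompL_apply,
    ContinuousLinearMap.compL_apply, ContinuousLinearMap.comp_apply]
  abel

lemma dC_clm_apply [IsScalarTower ℝ ℂ V] [IsScalarTower ℝ ℂ W]
    {A : RVec m → V →L[ℂ] W} {f : RVec m → V} {y : RVec m}
    (hA : DifferentiableAt ℝ A y) (hf : DifferentiableAt ℝ f y) (Z : CVec m) :
    dC (fun x => A x (f x)) y Z = dC A y Z (f y) + A y (dC f y Z) :=
  dC_bilinear (ContinuousLinearMap.restrictScalarsL ℂ V W ℝ ℝ) (fun _ _ => rfl)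
    (fun a b => a.map_smul Complex.I b) hA hf Z

lemma dC_clm_const [IsScalarTower ℝ ℂ V] [IsScalarTower ℝ ℂ W]
    {A : RVec m → V →L[ℂ] W} {y : RVec m}
    (hA : DifferentiableAt ℝ A y) (v : V) (Z : CVec m) :
    dC (fun x => A x v) y Z = dC A y Z v := by
  rw [dC_clm_apply hA (differentiableAt_const v), dC_const, map_zero, add_zero]

lemma dC_smul [IsScalarTower ℝ ℂ V] {c : RVec m → ℂ} {f : RVec m → V} {y : RVec m}
    (hc : DifferentiableAt ℝ c y) (hf : DifferentiableAt ℝ f y) (Z : CVec m) :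
    dC (fun x => c x • f x) y Z = dC c y Z • f y + c y • dC f y Z := by
  have h := (hc.hasFDerivAt.smul hf.hasFDerivAt).fderiv
  have h' : fderiv ℝ (fun x => c x • f x) y =
    c y • fderiv ℝ f y + (fderiv ℝ c y).smulRight (f y) := h
  simp only [dC, h', add_apply, smul_apply,
    ContinuousLinearMap.smulRight_apply, smul_add, add_smul, smul_smul, smul_eq_mul,
    mul_comm (c y)]
  abel

lemma dC_mul {c d : RVec m → ℂ} {y : RVec m}
    (hc : DifferentiableAt ℝ c y) (hd : DifferentiableAt ℝ d y) (Z : CVec m) :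
    dC (fun x => c x * d x) y Z = dC c y Z * d y + c y * dC d y Z :=
  dC_smul hc hd Z

lemma dC_apply {N : ℕ} {f : RVec m → CVec N} {y : RVec m} (hf : DifferentiableAt ℝ f y)
    (j : Fin N) (Z : CVec m) : dC f y Z j = dC (fun x => f x j) y Z := by
  simp only [dC, fderiv_apply hf, Pi.add_apply, Pi.smul_apply]
  rfl

lemma fderiv_star_apply {N : ℕ} (f : RVec m → CVec N) (y v : RVec m) :
    fderiv ℝ (fun x => star (f x)) y v = star (fderiv ℝ f y v) := by
  have := (starL' ℝ : CVec N ≃L[ℝ] CVec N).comp_fderiv (f := f) (x := y)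
  exact congrArg (fun L : RVec m →L[ℝ] CVec N => L v) this

lemma dC_star {N : ℕ} (f : RVec m → CVec N) (y : RVec m) (Z : CVec m) :
    dC (fun x => star (f x)) y Z = star (dC f y (star Z)) := by
  simp only [dC, fderiv_star_apply, rePart_star, imPart_star, map_neg, smul_neg, star_add,
    star_neg, star_smul, Complex.star_def, Complex.conj_I, neg_smul, neg_neg]

lemma dC_conj (f : RVec m → ℂ) (y : RVec m) (Z : CVec m) :
    dC (fun x => star (f x)) y Z = star (dC f y (star Z)) := by
  have h : ∀ v, fderiv ℝ (fun x => star (f x)) y v = star (fderiv ℝ f y v) := by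
    intro v
    have := (starL' ℝ : ℂ ≃L[ℝ] ℂ).comp_fderiv (f := f) (x := y)
    exact congrArg (fun L : RVec m →L[ℝ] ℂ => L v) this
  simp only [dC, h, rePart_star, imPart_star, map_neg, smul_neg, star_add,
    star_neg, star_smul]
  simp only [Complex.star_def, Complex.conj_I, neg_smul, neg_neg]

lemma contDiffAt_dC {f : RVec m → V} {y : RVec m} [IsScalarTower ℝ ℂ V]
    (hf : ContDiffAt ℝ ∞ f y) (Z : CVec m) :
    ContDiffAt ℝ ∞ (fun x => dC f x Z) y := by
  have h : ContDiffAt ℝ ∞ (fderiv ℝ f) y := hf.fderiv_right (by simp)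
  have hI : IsBoundedLinearMap ℝ (fun v : V => Complex.I • v) :=
    ((Complex.I • ContinuousLinearMap.id ℂ V).restrictScalars ℝ).isBoundedLinearMap
  exact (h.clm_apply contDiffAt_const).add
    (hI.contDiff.contDiffAt.comp y (h.clm_apply contDiffAt_const))

lemma contDiffAt_clm_of_apply {D : Type*} [NormedAddCommGroup D] [NormedSpace ℝ D]
    [FiniteDimensional ℂ V] [IsScalarTower ℝ ℂ V] [IsScalarTower ℝ ℂ W]
    {A : D → V →L[ℂ] W} {y : D} (h : ∀ v, ContDiffAt ℝ ∞ (fun x => A x v) y) :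
    ContDiffAt ℝ ∞ A y := by
  classical
  -- `A` is the sum of its values on a basis of `V` against the coordinate forms.
  let b := Module.finBasis ℂ V
  have hA : A = fun x => ∑ i, (ContinuousLinearMap.smulRightL ℂ V W
      (LinearMap.toContinuousLinearMap (b.coord i))) (A x (b i)) := by
    funext x
    ext v
    conv_lhs => rw [← b.sum_repr v, map_sum]
    simp
  rw [hA]
  refine ContDiffAt.sum fun i _ => ?_
  exact (((ContinuousLinearMap.smulRightL ℂ V W (LinearMap.toContinuousLinearMap
    (b.coord i))).restrictScalars ℝ).contDiff.contDiffAt).comp y (h (b i))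

lemma contDiffAt_clm_apply {D : Type*} [NormedAddCommGroup D] [NormedSpace ℝ D]
    [IsScalarTower ℝ ℂ V] [IsScalarTower ℝ ℂ W] {A : D → V →L[ℂ] W} {f : D → V} {y : D}
    (hA : ContDiffAt ℝ ∞ A y) (hf : ContDiffAt ℝ ∞ f y) :
    ContDiffAt ℝ ∞ (fun x => A x (f x)) y := by
  have h : ContDiffAt ℝ ∞ (fun x => ContinuousLinearMap.restrictScalarsL ℂ V W ℝ ℝ (A x)) y :=
    (ContinuousLinearMap.restrictScalarsL ℂ V W ℝ ℝ).contDiff.contDiffAt.comp y hA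
  exact h.clm_apply hf

lemma contDiffAt_dCL [IsScalarTower ℝ ℂ V] {f : RVec m → V} {y : RVec m}
    (hf : ContDiffAt ℝ ∞ f y) : ContDiffAt ℝ ∞ (dCL f) y :=
  contDiffAt_clm_of_apply fun v => contDiffAt_dC hf v

lemma contDiffAt_star {N : ℕ} {f : RVec m → CVec N} {y : RVec m} (hf : ContDiffAt ℝ ∞ f y) :
    ContDiffAt ℝ ∞ (fun x => star (f x)) y :=
  (starL' ℝ : CVec N ≃L[ℝ] CVec N).contDiff.contDiffAt.comp y hf

lemma contDiffAt_conj {f : RVec m → ℂ} {y : RVec m} (hf : ContDiffAt ℝ ∞ f y) :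
    ContDiffAt ℝ ∞ (fun x => star (f x)) y :=
  (starL' ℝ : ℂ ≃L[ℝ] ℂ).contDiff.contDiffAt.comp y hf

lemma contDiffAt_smul [IsScalarTower ℝ ℂ V] {c : RVec m → ℂ} {f : RVec m → V} {y : RVec m}
    (hc : ContDiffAt ℝ ∞ c y) (hf : ContDiffAt ℝ ∞ f y) :
    ContDiffAt ℝ ∞ (fun x => c x • f x) y :=
  hc.smul hf

lemma fderiv_fderiv_apply {V : Type*} [NormedAddCommGroup V] [NormedSpace ℝ V] {f : RVec m → V}
    {y : RVec m} (hf : ContDiffAt ℝ ∞ f y) (u v : RVec m) :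
    fderiv ℝ (fun x => fderiv ℝ f x v) y u = fderiv ℝ (fderiv ℝ f) y u v := by
  have h : DifferentiableAt ℝ (fderiv ℝ f) y :=
    (hf.fderiv_right (m := ∞) (by simp)).differentiableAt (by simp)
  have := fderiv_clm_apply h (differentiableAt_const v)
  rw [this]
  simp

/-- Derivatives along constant complex vectors commute. -/
lemma dC_comm [IsScalarTower ℝ ℂ V] {f : RVec m → V} {y : RVec m} (hf : ContDiffAt ℝ ∞ f y)
    (X Y : CVec m) : dC (fun x => dC f x Y) y X = dC (fun x => dC f x X) y Y := by
  have hs : ∀ u v, fderiv ℝ (fderiv ℝ f) y u v = fderiv ℝ (fderiv ℝ f) y v u :=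
    fun u v => (hf.isSymmSndFDerivAt (by simp; exact WithTop.coe_le_coe.2 le_top)).eq u v
  have h : DifferentiableAt ℝ (fderiv ℝ f) y :=
    (hf.fderiv_right (m := ∞) (by simp)).differentiableAt (by simp)
  have hd : ∀ v, DifferentiableAt ℝ (fun x => fderiv ℝ f x v) y :=
    fun v => h.clm_apply (differentiableAt_const v)
  have key : ∀ X Y : CVec m, dC (fun x => dC f x Y) y X =
      fderiv ℝ (fderiv ℝ f) y (rePart X) (rePart Y) +
      Complex.I • fderiv ℝ (fderiv ℝ f) y (rePart X) (imPart Y) +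
      Complex.I • (fderiv ℝ (fderiv ℝ f) y (imPart X) (rePart Y) +
      Complex.I • fderiv ℝ (fderiv ℝ f) y (imPart X) (imPart Y)) := by
    intro X Y
    have e : ∀ u, fderiv ℝ (fun x => dC f x Y) y u =
        fderiv ℝ (fderiv ℝ f) y u (rePart Y) +
          Complex.I • fderiv ℝ (fderiv ℝ f) y u (imPart Y) := by
      intro u
      have h₁ := ((Complex.I • ContinuousLinearMap.id ℂ V).restrictScalars ℝ).hasFDerivAt.comp y
        (hd (imPart Y)).hasFDerivAt
      have h₂ := congrArg (fun L : RVec m →L[ℝ] V => L u)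
        ((hd (rePart Y)).hasFDerivAt.add h₁).fderiv
      rw [← fderiv_fderiv_apply hf, ← fderiv_fderiv_apply hf]
      exact h₂
    rw [dC, e, e]
  rw [key, key]
  simp only [hs (rePart Y), hs (imPart Y), smul_add]
  abel

/-! ### Linear connections on trivial bundles -/

/-- The covariant derivative `ds + 𝒢 s` of a section `s` of the trivial bundle with fibre `V`, for
a connection form `𝒢`. -/
noncomputable def covDeriv (𝒢 : RVec m → (CVec m →L[ℂ] V →L[ℂ] V)) (s : RVec m → V) (y : RVec m)
    (X : CVec m) : V :=
  dC s y X + 𝒢 y X (s y)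

/-- The curvature of the connection form `𝒢` on constant vectors `X`, `Y`. -/
noncomputable def curvForm (𝒢 : RVec m → (CVec m →L[ℂ] V →L[ℂ] V)) (y : RVec m)
    (X Y : CVec m) (v : V) : V :=
  dC 𝒢 y X Y v - dC 𝒢 y Y X v + 𝒢 y X (𝒢 y Y v) - 𝒢 y Y (𝒢 y X v)

lemma contDiffAt_covDeriv [IsScalarTower ℝ ℂ V] {𝒢 : RVec m → (CVec m →L[ℂ] V →L[ℂ] V)}
    {s : RVec m → V} {y : RVec m} (h𝒢 : ContDiffAt ℝ ∞ 𝒢 y) (hs : ContDiffAt ℝ ∞ s y)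
    (X : CVec m) : ContDiffAt ℝ ∞ (fun x => covDeriv 𝒢 s x X) y :=
  (contDiffAt_dC hs X).add (contDiffAt_clm_apply (contDiffAt_clm_apply h𝒢 contDiffAt_const) hs)

/-- The Ricci identity: as constant vectors commute, the curvature is the commutator of the
covariant derivatives. -/
lemma covDeriv_covDeriv_sub [IsScalarTower ℝ ℂ V] {𝒢 : RVec m → (CVec m →L[ℂ] V →L[ℂ] V)}
    {s : RVec m → V} {y : RVec m} (h𝒢 : ContDiffAt ℝ ∞ 𝒢 y) (hs : ContDiffAt ℝ ∞ s y)
    (X Y : CVec m) :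
    covDeriv 𝒢 (fun x => covDeriv 𝒢 s x Y) y X - covDeriv 𝒢 (fun x => covDeriv 𝒢 s x X) y Y =
      curvForm 𝒢 y X Y (s y) := by
  have h𝒢' : DifferentiableAt ℝ 𝒢 y := h𝒢.differentiableAt (by simp)
  have hs' : DifferentiableAt ℝ s y := hs.differentiableAt (by simp)
  have key : ∀ X Y : CVec m, dC (fun x => covDeriv 𝒢 s x Y) y X =
      dC (fun x => dC s x Y) y X + (dC 𝒢 y X Y (s y) + 𝒢 y Y (dC s y X)) := by
    intro X Y
    have h₁ : ContDiffAt ℝ ∞ (fun x => 𝒢 x Y) y := contDiffAt_clm_apply h𝒢 contDiffAt_const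
    have h₁' : DifferentiableAt ℝ (fun x => 𝒢 x Y) y := h₁.differentiableAt (by simp)
    have h₂ : ContDiffAt ℝ ∞ (fun x => 𝒢 x Y (s x)) y := contDiffAt_clm_apply h₁ hs
    simp only [covDeriv]
    rw [dC_add ((contDiffAt_dC hs Y).differentiableAt (by simp)) (h₂.differentiableAt (by simp)),
      dC_clm_apply h₁' hs', dC_clm_const h𝒢']
  have e : ∀ X Y : CVec m, covDeriv 𝒢 (fun x => covDeriv 𝒢 s x Y) y X =
      dC (fun x => dC s x Y) y X + (dC 𝒢 y X Y (s y) + 𝒢 y Y (dC s y X)) +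
        𝒢 y X (dC s y Y + 𝒢 y Y (s y)) := fun X Y => by
    rw [← key X Y]
    rfl
  rw [e X Y, e Y X, dC_comm hs X Y]
  simp only [map_add, curvForm]
  abel

lemma covDeriv_congr {𝒢 : RVec m → (CVec m →L[ℂ] V →L[ℂ] V)} {s s' : RVec m → V} {y : RVec m}
    (h : s =ᶠ[𝓝 y] s') (X : CVec m) : covDeriv 𝒢 s y X = covDeriv 𝒢 s' y X := by
  simp only [covDeriv, dC_congr h, h.self_of_nhds]

lemma covDeriv_sub {𝒢 : RVec m → (CVec m →L[ℂ] V →L[ℂ] V)} {s s' : RVec m → V} {y : RVec m}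
    (hs : DifferentiableAt ℝ s y) (hs' : DifferentiableAt ℝ s' y) (X : CVec m) :
    covDeriv 𝒢 (fun x => s x - s' x) y X = covDeriv 𝒢 s y X - covDeriv 𝒢 s' y X := by
  simp only [covDeriv, dC_sub hs hs', map_sub]
  abel

end ComplexDerivative

/-! ### Hermitian forms and Wirtinger derivatives -/

section Hermitian

variable {N : ℕ} (g : Matrix (Fin N) (Fin N) ℂ)

lemma herm_add_left (a a' b : CVec N) : herm g (a + a') b = herm g a b + herm g a' b := by
  simp only [herm, Pi.add_apply, mul_add, add_mul, Finset.sum_add_distrib]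

lemma herm_smul_left (c : ℂ) (a b : CVec N) : herm g (c • a) b = c * herm g a b := by
  simp only [herm, Pi.smul_apply, smul_eq_mul, Finset.mul_sum]
  exact Finset.sum_congr rfl fun j _ => Finset.sum_congr rfl fun k _ => by ring

lemma herm_add_right (a b b' : CVec N) : herm g a (b + b') = herm g a b + herm g a b' := by
  simp only [herm, Pi.add_apply, star_add, mul_add, Finset.sum_add_distrib]

lemma herm_smul_right (c : ℂ) (a b : CVec N) : herm g a (c • b) = star c * herm g a b := by
  simp only [herm, Pi.smul_apply, smul_eq_mul, star_mul', Finset.mul_sum]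
  exact Finset.sum_congr rfl fun j _ => Finset.sum_congr rfl fun k _ => by ring

@[simp] lemma herm_zero_left (b : CVec N) : herm g 0 b = 0 := by simp [herm]

@[simp] lemma herm_zero_right (a : CVec N) : herm g a 0 = 0 := by simp [herm]

lemma herm_neg_left (a b : CVec N) : herm g (-a) b = -herm g a b := by
  rw [← neg_one_smul ℂ a, herm_smul_left, neg_one_mul]

lemma herm_neg_right (a b : CVec N) : herm g a (-b) = -herm g a b := by
  rw [← neg_one_smul ℂ b, herm_smul_right, star_neg, star_one, neg_one_mul]

lemma herm_sub_left (a a' b : CVec N) : herm g (a - a') b = herm g a b - herm g a' b := by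
  rw [sub_eq_add_neg, herm_add_left, herm_neg_left, sub_eq_add_neg]

lemma herm_sub_right (a b b' : CVec N) : herm g a (b - b') = herm g a b - herm g a b' := by
  rw [sub_eq_add_neg, herm_add_right, herm_neg_right, sub_eq_add_neg]

variable {g}

lemma star_herm (hg : ∀ j k, star (g j k) = g k j) (a b : CVec N) :
    star (herm g a b) = herm g b a := by
  simp only [herm, star_sum, star_mul', star_star, hg]
  rw [Finset.sum_comm]
  exact Finset.sum_congr rfl fun j _ => Finset.sum_congr rfl fun k _ => by ring

lemma kahlerForm_eq (u v : CVec N) :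
    kahlerForm g u v = Complex.I * (herm g u v - herm g v u) := by
  simp only [kahlerForm, herm, mul_sub, Finset.sum_sub_distrib, mul_assoc]

lemma isUnit_of_herm_pos (hpos : ∀ a : CVec N, a ≠ 0 → 0 < (herm g a a).re) : IsUnit g := by
  rw [← Matrix.vecMul_injective_iff_isUnit]
  intro a b hab
  by_contra hne
  have hab' : Matrix.vecMul (a - b) g = 0 := by
    rw [Matrix.sub_vecMul]; exact sub_eq_zero.2 hab
  have h0 : herm g (a - b) (a - b) = 0 := by
    have : herm g (a - b) (a - b) = ∑ k, Matrix.vecMul (a - b) g k * star ((a - b) k) := by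
      simp only [herm, Matrix.vecMul, dotProduct, Finset.sum_mul]
      rw [Finset.sum_comm]
      exact Finset.sum_congr rfl fun j _ => Finset.sum_congr rfl fun k _ => by ring
    rw [this, hab']
    simp
  have := hpos _ (sub_ne_zero.2 hne)
  rw [h0] at this
  simp at this

end Hermitian

section Wirtinger

variable {m N : ℕ} {V : Type*} [NormedAddCommGroup V] [NormedSpace ℝ V] [NormedSpace ℂ V]

lemma fderiv_eq_wirt_add_wirtBar (f : CVec N → V) (x a : CVec N) :
    fderiv ℝ f x a = wirt f x a + wirtBar f x a := by
  simp only [wirt, wirtBar]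
  module

lemma wirt_add (f : CVec N → V) (x a b : CVec N) : wirt f x (a + b) = wirt f x a + wirt f x b := by
  simp only [wirt, smul_add, map_add]
  module

lemma fderiv_complex_smul [IsScalarTower ℝ ℂ V] (f : CVec N → V) (x a : CVec N) (c : ℂ) :
    fderiv ℝ f x (c • a) =
      (c.re : ℂ) • fderiv ℝ f x a + (c.im : ℂ) • fderiv ℝ f x (Complex.I • a) := by
  have h : ∀ (r : ℝ) (v : V), r • v = (r : ℂ) • v := fun r v => by
    rw [← smul_one_smul ℂ r v, Complex.real_smul, mul_one]
  have e : c • a = c.re • a + c.im • (Complex.I • a) := by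
    conv_lhs => rw [← Complex.re_add_im c]
    rw [add_smul, mul_smul]
    rfl
  rw [e, map_add, map_smul, map_smul, h, h]

lemma wirt_smul [IsScalarTower ℝ ℂ V] (f : CVec N → V) (x a : CVec N) (c : ℂ) :
    wirt f x (c • a) = c • wirt f x a := by
  simp only [wirt, smul_smul]
  rw [fderiv_complex_smul f x a c, fderiv_complex_smul f x a (Complex.I * c)]
  have hI : Complex.I * Complex.I = -1 := Complex.I_mul_I
  have hc := Complex.re_add_im c
  simp only [Complex.mul_re, Complex.mul_im, Complex.I_re, Complex.I_im, zero_mul, zero_sub,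
    one_mul, zero_add, Complex.ofReal_neg]
  match_scalars
  · linear_combination (1 / 2 : ℂ) * hc
  · linear_combination (-(1 / 2 : ℂ) * Complex.I) * hc - (1 / 2 : ℂ) * (c.im : ℂ) * hI * (-1)

lemma wirtBar_smul [IsScalarTower ℝ ℂ V] (f : CVec N → V) (x a : CVec N) (c : ℂ) :
    wirtBar f x (c • a) = star c • wirtBar f x a := by
  simp only [wirtBar, smul_smul]
  rw [fderiv_complex_smul f x a c, fderiv_complex_smul f x a (Complex.I * c)]
  have hI : Complex.I * Complex.I = -1 := Complex.I_mul_I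
  have hc : star c = (c.re : ℂ) - c.im * Complex.I := by
    apply Complex.ext <;> simp
  rw [hc]
  simp only [Complex.mul_re, Complex.mul_im, Complex.I_re, Complex.I_im, zero_mul, zero_sub,
    one_mul, zero_add, Complex.ofReal_neg]
  match_scalars
  · ring
  · linear_combination (1 / 2 : ℂ) * (c.im : ℂ) * hI

lemma wirtBar_eq_star_wirt (f : CVec N → ℂ) (x a : CVec N) :
    wirtBar f x a = star (wirt (fun z => star (f z)) x a) := by
  have h : ∀ v, fderiv ℝ (fun z => star (f z)) x v = star (fderiv ℝ f x v) := by
    intro v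
    have := (starL' ℝ : ℂ ≃L[ℝ] ℂ).comp_fderiv (f := f) (x := x)
    exact congrArg (fun L : CVec N →L[ℝ] ℂ => L v) this
  simp only [wirt, wirtBar, h, smul_eq_mul, star_mul', star_sub, star_star]
  simp

/-- The chain rule in terms of Wirtinger derivatives. -/
lemma dC_comp {f : CVec N → V} {F : RVec m → CVec N} {y : RVec m}
    (hf : DifferentiableAt ℝ f (F y)) (hF : DifferentiableAt ℝ F y) (Z : CVec m) :
    dC (fun x => f (F x)) y Z =
      wirt f (F y) (dC F y Z) + wirtBar f (F y) (dC F y (star Z)) := by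
  have h : fderiv ℝ (fun x => f (F x)) y = (fderiv ℝ f (F y)).comp (fderiv ℝ F y) :=
    fderiv_comp y hf hF
  simp only [dC, h, wirt, wirtBar, comp_apply, rePart_star, imPart_star, map_neg, smul_neg,
    map_add, smul_add, smul_smul, Complex.I_mul_I, neg_smul, one_smul, neg_neg]
  module

lemma dC_comp_of_eq_zero {f : CVec N → V} {F : RVec m → CVec N} {y : RVec m}
    (hf : DifferentiableAt ℝ f (F y)) (hF : DifferentiableAt ℝ F y) {Z : CVec m}
    (hZ : dC F y Z = 0) :
    dC (fun x => f (F x)) y Z = wirtBar f (F y) (dC F y (star Z)) := by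
  rw [dC_comp hf hF, hZ]
  simp [wirt]

lemma wirtBar_clm_const {W : Type*} [NormedAddCommGroup W] [NormedSpace ℝ W] [NormedSpace ℂ W]
    [IsScalarTower ℝ ℂ V] [IsScalarTower ℝ ℂ W] {A : CVec N → V →L[ℂ] W} {x : CVec N}
    (hA : DifferentiableAt ℝ A x) (v : V) (b : CVec N) :
    wirtBar (fun z => A z v) x b = wirtBar A x b v := by
  let ev : (V →L[ℂ] W) →L[ℝ] W := (ContinuousLinearMap.apply ℂ W v).restrictScalars ℝ
  have h : fderiv ℝ (fun z => A z v) x = ev.comp (fderiv ℝ A x) :=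
    (ev.hasFDerivAt.comp x hA.hasFDerivAt).fderiv
  simp only [wirtBar, h]
  rfl

end Wirtinger

/-! ### Kähler metrics in coordinates -/

/-- `g` is the matrix of a Kähler metric on the open subset `V` of `ℂ^N`. -/
structure IsKahlerOn {N : ℕ} (g : CVec N → Matrix (Fin N) (Fin N) ℂ) (V : Set (CVec N)) :
    Prop where
  isOpen : IsOpen V
  smooth : ∀ j k, ContDiffOn ℝ ∞ (fun z => g z j k) V
  hermitian : ∀ x ∈ V, ∀ j k, star (g x j k) = g x k j
  pos : ∀ x ∈ V, ∀ a, a ≠ 0 → 0 < (herm (g x) a a).re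
  closed : ∀ x ∈ V, ∀ u v w : CVec N,
    fderiv ℝ (fun z => kahlerForm (g z) v w) x u + fderiv ℝ (fun z => kahlerForm (g z) w u) x v +
      fderiv ℝ (fun z => kahlerForm (g z) u v) x w = 0

namespace IsKahlerOn

variable {m N : ℕ} {g : CVec N → Matrix (Fin N) (Fin N) ℂ} {V : Set (CVec N)}
  (hg : IsKahlerOn g V)
include hg

lemma contDiffAt {x : CVec N} (hx : x ∈ V) (j k : Fin N) :
    ContDiffAt ℝ ∞ (fun z => g z j k) x :=
  (hg.smooth j k).contDiffAt (hg.isOpen.mem_nhds hx)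

lemma differentiableAt {x : CVec N} (hx : x ∈ V) (j k : Fin N) :
    DifferentiableAt ℝ (fun z => g z j k) x :=
  (hg.contDiffAt hx j k).differentiableAt (by simp)

lemma fderiv_herm {x : CVec N} (hx : x ∈ V) (u v w : CVec N) :
    fderiv ℝ (fun z => herm (g z) v w) x u =
      ∑ j, ∑ k, fderiv ℝ (fun z => g z j k) x u * v j * star (w k) := by
  have hd := hg.differentiableAt hx
  simp only [herm]
  rw [fderiv_fun_sum fun j _ => DifferentiableAt.fun_sum fun k _ =>
    ((hd j k).mul_const _).mul_const _]
  rw [sum_apply]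
  refine Finset.sum_congr rfl fun j _ => ?_
  rw [fderiv_fun_sum fun k _ => ((hd j k).mul_const _).mul_const _, sum_apply]
  refine Finset.sum_congr rfl fun k _ => ?_
  rw [fderiv_mul_const' ((hd j k).mul_const _), fderiv_mul_const' (hd j k)]
  rfl

lemma differentiableAt_herm {x : CVec N} (hx : x ∈ V) (v w : CVec N) :
    DifferentiableAt ℝ (fun z => herm (g z) v w) x := by
  have hd := hg.differentiableAt hx
  exact DifferentiableAt.fun_sum fun j _ => DifferentiableAt.fun_sum fun k _ =>
    ((hd j k).mul_const _).mul_const _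

/-- The Kähler condition `∂_j g_{k s̄} = ∂_k g_{j s̄}`. -/
lemma sum_wirt_comm {x : CVec N} (hx : x ∈ V) (u v w : CVec N) :
    ∑ j, ∑ k, wirt (fun z => g z j k) x u * v j * star (w k) =
      ∑ j, ∑ k, wirt (fun z => g z j k) x v * u j * star (w k) := by
  let A : CVec N → CVec N → CVec N → ℂ := fun u v w =>
    ∑ j, ∑ k, wirt (fun z => g z j k) x u * v j * star (w k)
  let B : CVec N → CVec N → CVec N → ℂ := fun u v w =>
    ∑ j, ∑ k, wirtBar (fun z => g z j k) x u * v j * star (w k)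
  have hS : ∀ u v w, A u v w + B u v w - (A u w v + B u w v) + (A v w u + B v w u -
      (A v u w + B v u w)) + (A w u v + B w u v - (A w v u + B w v u)) = 0 := by
    intro u v w
    have e : ∀ u v w, fderiv ℝ (fun z => kahlerForm (g z) v w) x u =
        Complex.I * (A u v w + B u v w - (A u w v + B u w v)) := by
      intro u v w
      have e₁ : ∀ u v w, fderiv ℝ (fun z => herm (g z) v w) x u = A u v w + B u v w := by
        intro u v w
        rw [hg.fderiv_herm hx]
        simp only [A, B, fderiv_eq_wirt_add_wirtBar, add_mul, Finset.sum_add_distrib]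
      simp only [kahlerForm_eq]
      have hd := (((hg.differentiableAt_herm hx v w).hasFDerivAt.sub
        (hg.differentiableAt_herm hx w v).hasFDerivAt).const_mul Complex.I).fderiv
      rw [← e₁, ← e₁]
      exact congrArg (fun L : CVec N →L[ℝ] ℂ => L u) hd
    have h := hg.closed x hx u v w
    rw [e, e, e, ← mul_add, ← mul_add] at h
    exact (mul_eq_zero.1 h).resolve_left Complex.I_ne_zero
  have hA₁ : ∀ u v w, A (Complex.I • u) v w = Complex.I * A u v w := by
    intro u v w
    simp only [A, wirt_smul, smul_eq_mul, Finset.mul_sum, mul_assoc]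
  have hA₂ : ∀ u v w, A u (Complex.I • v) w = Complex.I * A u v w := by
    intro u v w
    simp only [A, Pi.smul_apply, smul_eq_mul, Finset.mul_sum]
    exact Finset.sum_congr rfl fun j _ => Finset.sum_congr rfl fun k _ => by ring
  have hA₃ : ∀ u v w, A u v (Complex.I • w) = -Complex.I * A u v w := by
    intro u v w
    simp only [A, Pi.smul_apply, smul_eq_mul, Finset.mul_sum, Complex.star_def, map_mul,
      Complex.conj_I]
    exact Finset.sum_congr rfl fun j _ => Finset.sum_congr rfl fun k _ => by ring
  have hB₁ : ∀ u v w, B (Complex.I • u) v w = -Complex.I * B u v w := by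
    intro u v w
    simp only [B, wirtBar_smul, smul_eq_mul, Finset.mul_sum, mul_assoc, Complex.star_def,
      Complex.conj_I]
  have hB₂ : ∀ u v w, B u (Complex.I • v) w = Complex.I * B u v w := by
    intro u v w
    simp only [B, Pi.smul_apply, smul_eq_mul, Finset.mul_sum]
    exact Finset.sum_congr rfl fun j _ => Finset.sum_congr rfl fun k _ => by ring
  have hB₃ : ∀ u v w, B u v (Complex.I • w) = -Complex.I * B u v w := by
    intro u v w
    simp only [B, Pi.smul_apply, smul_eq_mul, Finset.mul_sum, Complex.star_def, map_mul,
      Complex.conj_I]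
    exact Finset.sum_congr rfl fun j _ => Finset.sum_congr rfl fun k _ => by ring
  -- Averaging over `u ↦ iu` and `v ↦ iv` isolates the part that is linear in `u` and `v`.
  have h₁ := hS u v w
  have h₂ := hS (Complex.I • u) v w
  have h₃ := hS u (Complex.I • v) w
  have h₄ := hS (Complex.I • u) (Complex.I • v) w
  simp only [hA₁, hA₂, hA₃, hB₁, hB₂, hB₃] at h₂ h₃ h₄
  have hI : Complex.I ^ 2 = -1 := Complex.I_sq
  change A u v w = A v u w
  linear_combination (1 / 4 : ℂ) * (h₁ - Complex.I * h₂ - Complex.I * h₃ - h₄) +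
    (1 / 4 : ℂ) * (3 * A u v w - B u v w + A u w v + B u w v - A v w u - B v w u - 3 * A v u w +
      B v u w - A w u v - B w u v + A w v u + B w v u) * hI

end IsKahlerOn

/-! ### The Chern connection -/

section Chern

variable {m N : ℕ} (g : CVec N → Matrix (Fin N) (Fin N) ℂ)

/-- The Christoffel symbols of the Chern connection at `x`, as a bilinear map. -/
noncomputable def chernL (x : CVec N) : CVec N →L[ℂ] CVec N →L[ℂ] CVec N :=
  toCLM₂ (LinearMap.mk₂ ℂ (chernGamma g x)
    (fun a a' c => by
      ext l
      simp only [chernGamma, wirt_add, mul_add, add_mul, Finset.sum_add_distrib, Pi.add_apply])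
    (fun r a c => by
      ext l
      simp only [chernGamma, wirt_smul, Pi.smul_apply, smul_eq_mul, Finset.mul_sum]
      exact Finset.sum_congr rfl fun j _ => Finset.sum_congr rfl fun k _ => by ring)
    (fun a c c' => by
      ext l
      simp only [chernGamma, add_mul, Finset.sum_add_distrib, Pi.add_apply])
    (fun r a c => by
      ext l
      simp only [chernGamma, Pi.smul_apply, smul_eq_mul, Finset.mul_sum]
      exact Finset.sum_congr rfl fun j _ => Finset.sum_congr rfl fun k _ => by ring))

@[simp] lemma chernL_apply (x a c : CVec N) : chernL g x a c = chernGamma g x a c := rfl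

@[simp] lemma chernGamma_zero_left (x c : CVec N) : chernGamma g x 0 c = 0 := by
  rw [← chernL_apply, map_zero, zero_apply]

@[simp] lemma chernGamma_zero_right (x a : CVec N) : chernGamma g x a 0 = 0 := by
  rw [← chernL_apply, map_zero]

/-- The connection form of the pullback of the Chern connection by `F`. -/
noncomputable def chernConn (F : RVec m → CVec N) (y : RVec m) :
    CVec m →L[ℂ] CVec N →L[ℂ] CVec N :=
  (chernL g (F y)).comp (dCL F y)

@[simp] lemma chernConn_apply (F : RVec m → CVec N) (y : RVec m) (X : CVec m) (c : CVec N) :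
    chernConn g F y X c = chernGamma g (F y) (dC F y X) c := rfl

end Chern

namespace IsKahlerOn

variable {m N : ℕ} {g : CVec N → Matrix (Fin N) (Fin N) ℂ} {V : Set (CVec N)}
  (hg : IsKahlerOn g V)
include hg

lemma inv_mul {x : CVec N} (hx : x ∈ V) : (g x)⁻¹ * g x = 1 :=
  Matrix.nonsing_inv_mul _ ((Matrix.isUnit_iff_isUnit_det _).1 (isUnit_of_herm_pos (hg.pos x hx)))

lemma herm_chernGamma {x : CVec N} (hx : x ∈ V) (a c b : CVec N) :
    herm (g x) (chernGamma g x a c) b =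
      ∑ j, ∑ k, wirt (fun z => g z j k) x a * c j * star (b k) := by
  have h : ∀ s k, ∑ l, (g x)⁻¹ s l * g x l k = if s = k then 1 else 0 := fun s k => by
    rw [← Matrix.mul_apply, hg.inv_mul hx, Matrix.one_apply]
  calc herm (g x) (chernGamma g x a c) b
      = ∑ k, (∑ j, ∑ s, c j * wirt (fun z => g z j s) x a *
          ∑ l, (g x)⁻¹ s l * g x l k) * star (b k) := by
        simp only [herm, chernGamma, Finset.mul_sum, Finset.sum_mul]
        rw [Finset.sum_comm]
        refine Finset.sum_congr rfl fun k _ => ?_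
        rw [Finset.sum_comm]
        refine Finset.sum_congr rfl fun j _ => ?_
        rw [Finset.sum_comm]
        exact Finset.sum_congr rfl fun s _ => Finset.sum_congr rfl fun l _ => by ring
    _ = _ := by
        simp only [h, mul_ite, mul_one, mul_zero, Finset.sum_ite_eq', Finset.mem_univ, if_true,
          Finset.sum_mul]
        rw [Finset.sum_comm]
        exact Finset.sum_congr rfl fun j _ => Finset.sum_congr rfl fun k _ => by ring

/-- The Chern connection of a Kähler metric is torsion free. -/
lemma chernGamma_comm {x : CVec N} (hx : x ∈ V) (a c : CVec N) :
    chernGamma g x a c = chernGamma g x c a := by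
  by_contra hne
  have := hg.pos x hx _ (sub_ne_zero.2 hne)
  rw [herm_sub_left, hg.herm_chernGamma hx, hg.herm_chernGamma hx, hg.sum_wirt_comm hx,
    sub_self] at this
  simp at this

lemma contDiffAt_chernL {x : CVec N} (hx : x ∈ V) : ContDiffAt ℝ ∞ (chernL g) x := by
  refine contDiffAt_clm_of_apply fun a => contDiffAt_clm_of_apply fun c => ?_
  have hdet : ∀ (A : CVec N → Matrix (Fin N) (Fin N) ℂ),
      (∀ j k, ContDiffAt ℝ ∞ (fun z => A z j k) x) → ContDiffAt ℝ ∞ (fun z => (A z).det) x := by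
    intro A hA
    simp only [Matrix.det_apply]
    refine ContDiffAt.sum fun σ _ => ?_
    exact (contDiffAt_prod fun i _ => hA _ _).const_smul _
  have hinv : ∀ s l, ContDiffAt ℝ ∞ (fun z => (g z)⁻¹ s l) x := by
    intro s l
    have h₁ : ContDiffAt ℝ ∞ (fun z => (g z).adjugate s l) x := by
      simp only [Matrix.adjugate_apply]
      refine hdet _ fun j k => ?_
      by_cases hj : j = l
      · subst hj
        simpa using contDiffAt_const
      · simpa [Matrix.updateRow_ne hj] using hg.contDiffAt hx j k
    have h₂ : ContDiffAt ℝ ∞ (fun z => ((g z).det)⁻¹) x :=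
      (hdet _ (hg.contDiffAt hx)).inv
        ((Matrix.isUnit_iff_isUnit_det _).1 (isUnit_of_herm_pos (hg.pos x hx))).ne_zero
    have h₃ : (fun z => (g z)⁻¹ s l) = fun z => ((g z).det)⁻¹ * (g z).adjugate s l := by
      funext z
      simp [Matrix.inv_def]
    rw [h₃]
    exact h₂.mul h₁
  have hw : ∀ k s, ContDiffAt ℝ ∞ (fun z => wirt (fun x' => g x' k s) z a) x := by
    intro k s
    have h : ContDiffAt ℝ ∞ (fderiv ℝ fun z => g z k s) x :=
      (hg.contDiffAt hx k s).fderiv_right (by simp)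
    exact contDiffAt_const.mul ((h.clm_apply contDiffAt_const).sub
      (contDiffAt_const.mul (h.clm_apply contDiffAt_const)))
  refine contDiffAt_pi.2 fun l => ?_
  have h : ContDiffAt ℝ ∞ (fun z => ∑ k, ∑ s, c k * wirt (fun x' => g x' k s) z a *
      (g z)⁻¹ s l) x := ContDiffAt.sum fun k _ => ContDiffAt.sum fun s _ =>
    (contDiffAt_const.mul (hw k s)).mul (hinv s l)
  exact h

variable {F : RVec m → CVec N} {y : RVec m}

lemma contDiffAt_chernConn (hF : ContDiffAt ℝ ∞ F y) (hx : F y ∈ V) :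
    ContDiffAt ℝ ∞ (chernConn g F) y :=
  have h : ContDiffAt ℝ ∞ (fun y' => chernL g (F y')) y := (hg.contDiffAt_chernL hx).comp y hF
  contDiffAt_clm_of_apply fun X => by
    have h' : ContDiffAt ℝ ∞ (fun y' => chernL g (F y') (dC F y' X)) y :=
      contDiffAt_clm_apply h (contDiffAt_dC hF X)
    exact h'

/-- The Chern connection is compatible with the metric. -/
lemma dC_herm (hF : ContDiffAt ℝ ∞ F y) (hx : F y ∈ V) {s t : RVec m → CVec N}
    (hs : DifferentiableAt ℝ s y) (ht : DifferentiableAt ℝ t y) (X : CVec m) :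
    dC (fun y' => herm (g (F y')) (s y') (t y')) y X =
      herm (g (F y)) (covDeriv (chernConn g F) s y X) (t y) +
        herm (g (F y)) (s y) (covDeriv (chernConn g F) t y (star X)) := by
  have hF' : DifferentiableAt ℝ F y := hF.differentiableAt (by simp)
  have hgF : ∀ j k, DifferentiableAt ℝ (fun y' => g (F y') j k) y := fun j k =>
    (hg.differentiableAt hx j k).comp y hF'
  have hsj : ∀ j, DifferentiableAt ℝ (fun y' => s y' j) y := fun j => differentiableAt_pi.1 hs j
  have htk : ∀ k, DifferentiableAt ℝ (fun y' => star (t y' k)) y := fun k =>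
    (starL' ℝ : ℂ ≃L[ℝ] ℂ).differentiableAt.comp y (differentiableAt_pi.1 ht k)
  have hbar : ∀ j k b, wirtBar (fun z => g z j k) (F y) b =
      star (wirt (fun z => g z k j) (F y) b) := by
    intro j k b
    have : (fun z => star (g z j k)) =ᶠ[𝓝 (F y)] fun z => g z k j := by
      filter_upwards [hg.isOpen.mem_nhds hx] with z hz using hg.hermitian z hz j k
    rw [wirtBar_eq_star_wirt, wirt, wirt, this.fderiv_eq]
  have e₁ : herm (g (F y)) (s y) (chernGamma g (F y) (dC F y (star X)) (t y)) =
      ∑ j, ∑ k, wirtBar (fun z => g z j k) (F y) (dC F y (star X)) * s y j * star (t y k) := by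
    rw [← star_herm (hg.hermitian _ hx), hg.herm_chernGamma hx, star_sum]
    simp only [star_sum, star_mul', star_star, hbar]
    rw [Finset.sum_comm]
    exact Finset.sum_congr rfl fun j _ => Finset.sum_congr rfl fun k _ => by ring
  simp only [covDeriv, chernConn_apply]
  rw [herm_add_left, herm_add_right, hg.herm_chernGamma hx, e₁]
  have h₁ : ∀ j k, DifferentiableAt ℝ (fun y' => g (F y') j k * s y' j) y := fun j k =>
    (hgF j k).mul (hsj j)
  have h₂ : ∀ j k, DifferentiableAt ℝ (fun y' => g (F y') j k * s y' j * star (t y' k)) y :=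
    fun j k => (h₁ j k).mul (htk k)
  simp only [herm]
  rw [dC_sum _ fun j _ => DifferentiableAt.fun_sum fun k _ => h₂ j k]
  simp only [← Finset.sum_add_distrib]
  refine Finset.sum_congr rfl fun j _ => ?_
  rw [dC_sum _ fun k _ => h₂ j k]
  refine Finset.sum_congr rfl fun k _ => ?_
  rw [dC_mul (h₁ j k) (htk k), dC_mul (hgF j k) (hsj j),
    dC_comp (hg.differentiableAt hx j k) hF', dC_conj, dC_apply hs, dC_apply ht]
  ring

/-- On a pair `(Z, Z̄)` with `Z` of type `(1,0)`, the curvature of the pulled back connection is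
the curvature `R̃` of the Chern connection. -/
lemma curvForm_chernConn (hF : ContDiffAt ℝ ∞ F y) (hx : F y ∈ V) {Z : CVec m}
    (hZ : dC F y (star Z) = 0) (c : CVec N) :
    curvForm (chernConn g F) y Z (star Z) c =
      chernCurv g (F y) (dC F y Z) (dC F y Z) c := by
  have hF' : DifferentiableAt ℝ F y := hF.differentiableAt (by simp)
  have hL := hg.contDiffAt_chernL hx
  have hL' : DifferentiableAt ℝ (chernL g) (F y) := hL.differentiableAt (by simp)
  have hLF' : ContDiffAt ℝ ∞ (fun y' => chernL g (F y')) y := hL.comp y hF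
  have hLF : DifferentiableAt ℝ (fun y' => chernL g (F y')) y := hLF'.differentiableAt (by simp)
  have hΓ : DifferentiableAt ℝ (chernConn g F) y :=
    (hg.contDiffAt_chernConn hF hx).differentiableAt (by simp)
  have key : ∀ X Y : CVec m, dC (chernConn g F) y X Y c =
      dC (fun y' => chernL g (F y')) y X (dC F y Y) c +
        chernL g (F y) (dC (fun y' => dC F y' Y) y X) c := by
    intro X Y
    have hY : DifferentiableAt ℝ (fun y' => dC F y' Y) y :=
      (contDiffAt_dC hF Y).differentiableAt (by simp)
    have h₁ : DifferentiableAt ℝ (fun y' => chernConn g F y' Y) y :=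
      (contDiffAt_clm_apply (hg.contDiffAt_chernConn hF hx) contDiffAt_const).differentiableAt
        (by simp)
    rw [← dC_clm_const hΓ Y X]
    have h₂ : dC (fun y' => chernConn g F y' Y) y X =
        dC (fun y' => chernL g (F y') (dC F y' Y)) y X := rfl
    rw [h₂, dC_clm_apply hLF hY]
    rfl
  have hw : ∀ b, wirtBar (chernL g) (F y) b (dC F y Z) c =
      wirtBar (fun x' => chernGamma g x' (dC F y Z) c) (F y) b := by
    intro b
    rw [← wirtBar_clm_const hL', ← wirtBar_clm_const
      ((contDiffAt_clm_apply hL contDiffAt_const).differentiableAt (by simp))]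
    rfl
  have hz : dC (fun y' => chernL g (F y')) y (star Z) = wirtBar (chernL g) (F y) (dC F y Z) := by
    rw [dC_comp_of_eq_zero hL' hF' hZ, star_star]
  rw [curvForm, key, key, dC_comm hF Z (star Z)]
  simp only [chernConn_apply, hZ, map_zero, zero_apply]
  rw [hz, hw]
  simp [chernCurv]

end IsKahlerOn

/-! ### The contact form and the Reeb field of a hypersurface -/

section ContactForm

variable {m N : ℕ}

lemma mem_T10_iff {F : RVec m → CVec N} {y : RVec m} {Z : CVec m} :
    Z ∈ T10 F y ↔ dC F y (star Z) = 0 := by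
  change dC (fun y' => star (F y')) y Z = 0 ↔ _
  rw [dC_star, star_eq_zero]

/-- The complex linear extension of a real `1`-form. -/
noncomputable def thetaC (θ : RVec m → (RVec m →L[ℝ] ℝ)) (y : RVec m) : CVec m →L[ℂ] ℂ :=
  LinearMap.toContinuousLinearMap
    { toFun := fun Z => (θ y (rePart Z) : ℂ) + Complex.I * θ y (imPart Z)
      map_add' := fun Z W => by
        simp only [rePart_add, imPart_add, map_add, Complex.ofReal_add]
        ring
      map_smul' := fun c Z => by
        simp only [rePart_smul, imPart_smul, map_add, map_sub, map_smul, smul_eq_mul,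
          Complex.ofReal_add, Complex.ofReal_sub, Complex.ofReal_mul, RingHom.id_apply]
        have hI : Complex.I * Complex.I = -1 := Complex.I_mul_I
        have hc := Complex.re_add_im c
        linear_combination ((θ y (rePart Z) : ℂ) + Complex.I * θ y (imPart Z)) * hc -
          (c.im : ℂ) * θ y (imPart Z) * hI }

lemma thetaC_apply (θ : RVec m → (RVec m →L[ℝ] ℝ)) (y : RVec m) (Z : CVec m) :
    thetaC θ y Z = (θ y (rePart Z) : ℂ) + Complex.I * θ y (imPart Z) := rfl

lemma thetaC_toC (θ : RVec m → (RVec m →L[ℝ] ℝ)) (y v : RVec m) :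
    thetaC θ y (toC v) = θ y v := by
  simp [thetaC_apply]

lemma thetaC_star (θ : RVec m → (RVec m →L[ℝ] ℝ)) (y : RVec m) (Z : CVec m) :
    thetaC θ y (star Z) = star (thetaC θ y Z) := by
  simp [thetaC_apply]

lemma contDiffAt_thetaC {θ : RVec m → (RVec m →L[ℝ] ℝ)} {y : RVec m} (hθ : ContDiffAt ℝ ∞ θ y) :
    ContDiffAt ℝ ∞ (thetaC θ) y := by
  refine contDiffAt_clm_of_apply fun Z => ?_
  have h : ∀ v, ContDiffAt ℝ ∞ (fun x => ((θ x v : ℝ) : ℂ)) y := fun v =>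
    Complex.ofRealCLM.contDiff.contDiffAt.comp y (hθ.clm_apply contDiffAt_const)
  exact (h _).add (contDiffAt_const.mul (h _))

/-- The complex bilinear extension of `dθ`, computed from the complexified form. -/
lemma bilC_dForm {θ : RVec m → (RVec m →L[ℝ] ℝ)} {y : RVec m} (hθ : ContDiffAt ℝ ∞ θ y)
    (Z W : CVec m) :
    bilC (dForm θ y) Z W = dC (thetaC θ) y Z W - dC (thetaC θ) y W Z := by
  have hθ' : DifferentiableAt ℝ θ y := hθ.differentiableAt (by simp)
  have hd : DifferentiableAt ℝ (thetaC θ) y :=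
    (contDiffAt_thetaC hθ).differentiableAt (by simp)
  have hv : ∀ v, DifferentiableAt ℝ (fun x => ((θ x v : ℝ) : ℂ)) y := fun v =>
    Complex.ofRealCLM.differentiableAt.comp y (hθ'.clm_apply (differentiableAt_const v))
  have hf : ∀ u v, fderiv ℝ (fun x => ((θ x v : ℝ) : ℂ)) y u = fderiv ℝ θ y u v := by
    intro u v
    have h₁ := Complex.ofRealCLM.hasFDerivAt.comp y
      (hθ'.hasFDerivAt.clm_apply (hasFDerivAt_const v y))
    have h₂ := congrArg (fun L : RVec m →L[ℝ] ℂ => L u) h₁.fderiv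
    refine Eq.trans h₂ ?_
    simp
  have key : ∀ Z W : CVec m, dC (thetaC θ) y Z W =
      (fderiv ℝ θ y (rePart Z) (rePart W) : ℂ) +
        Complex.I * fderiv ℝ θ y (rePart Z) (imPart W) +
        Complex.I * (fderiv ℝ θ y (imPart Z) (rePart W) +
          Complex.I * fderiv ℝ θ y (imPart Z) (imPart W)) := by
    intro Z W
    have e : ∀ u, fderiv ℝ (fun x => thetaC θ x W) y u =
        (fderiv ℝ θ y u (rePart W) : ℂ) + Complex.I * fderiv ℝ θ y u (imPart W) := by
      intro u
      have h₁ := ((hv (rePart W)).hasFDerivAt.add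
        ((hv (imPart W)).hasFDerivAt.const_mul Complex.I)).fderiv
      rw [← hf, ← hf]
      exact congrArg (fun L : RVec m →L[ℝ] ℂ => L u) h₁
    rw [← dC_clm_const hd, dC, e, e, smul_eq_mul]
  rw [key, key, bilC]
  simp only [dForm]
  push_cast
  linear_combination (-(fderiv ℝ θ y (imPart Z) (imPart W) : ℂ) +
    fderiv ℝ θ y (imPart W) (imPart Z)) * Complex.I_sq

/-- The bilinear form `dθ + θ ⊗ θ`, which is nondegenerate when `θ` is a contact form; its inverse
yields the Reeb field and the tangential projection. -/
noncomputable def contactForm (θ : RVec m → (RVec m →L[ℝ] ℝ)) (y : RVec m) :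
    CVec m →L[ℂ] CVec m →L[ℂ] ℂ :=
  toCLM₂ (LinearMap.mk₂ ℂ
    (fun Z W => dC (thetaC θ) y Z W - dC (thetaC θ) y W Z + thetaC θ y Z * thetaC θ y W)
    (fun Z Z' W => by simp only [dC_add_dir, add_apply, map_add]; ring)
    (fun c Z W => by
      simp only [dC_smul_dir, smul_apply, map_smul, smul_eq_mul]; ring)
    (fun Z W W' => by simp only [dC_add_dir, add_apply, map_add]; ring)
    (fun c Z W => by
      simp only [dC_smul_dir, smul_apply, map_smul, smul_eq_mul]; ring))

lemma contactForm_apply {θ : RVec m → (RVec m →L[ℝ] ℝ)} {y : RVec m} (hθ : ContDiffAt ℝ ∞ θ y)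
    (Z W : CVec m) :
    contactForm θ y Z W = bilC (dForm θ y) Z W + thetaC θ y Z * thetaC θ y W := by
  rw [bilC_dForm hθ]
  rfl

lemma contDiffAt_contactForm {θ : RVec m → (RVec m →L[ℝ] ℝ)} {y : RVec m}
    (hθ : ContDiffAt ℝ ∞ θ y) : ContDiffAt ℝ ∞ (contactForm θ) y := by
  have h := contDiffAt_thetaC hθ
  refine contDiffAt_clm_of_apply fun Z => contDiffAt_clm_of_apply fun W => ?_
  exact ((contDiffAt_clm_apply (contDiffAt_dC h Z) contDiffAt_const).sub
    (contDiffAt_clm_apply (contDiffAt_dC h W) contDiffAt_const)).add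
    ((contDiffAt_clm_apply h contDiffAt_const).mul (contDiffAt_clm_apply h contDiffAt_const))

lemma star_reebC (θ : RVec m → (RVec m →L[ℝ] ℝ)) (y : RVec m) :
    star (reebC θ y) = reebC θ y := star_toC _

end ContactForm

/-- A semi-isometric pseudohermitian hypersurface in coordinates: `F` immerses the open set
`U ⊆ ℝ^{2n+1}` into the domain `V ⊆ ℂ^{n+1}` of the Kähler metric `g`, `ker θ = H(M)` and
`dθ = F^* ω`. -/
structure IsLocalHypersurface {n : ℕ}
    (g : CVec (n + 1) → Matrix (Fin (n + 1)) (Fin (n + 1)) ℂ)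
    (F : RVec (2 * n + 1) → CVec (n + 1)) (θ : RVec (2 * n + 1) → (RVec (2 * n + 1) →L[ℝ] ℝ))
    (U : Set (RVec (2 * n + 1))) (V : Set (CVec (n + 1))) : Prop where
  isOpen : IsOpen U
  kahler : IsKahlerOn g V
  mapsTo : ∀ y ∈ U, F y ∈ V
  smooth_map : ContDiffOn ℝ ∞ F U
  injective : ∀ y ∈ U, Function.Injective (fderiv ℝ F y)
  smooth_form : ContDiffOn ℝ ∞ θ U
  ker_eq : ∀ y ∈ U, ∀ v, θ y v = 0 ↔ IsHorizontal F y (toC v)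
  dForm_eq : ∀ y ∈ U, ∀ u v,
    (dForm θ y u v : ℂ) = kahlerForm (g (F y)) (fderiv ℝ F y u) (fderiv ℝ F y v)

namespace IsLocalHypersurface

variable {n : ℕ} {g : CVec (n + 1) → Matrix (Fin (n + 1)) (Fin (n + 1)) ℂ}
  {F : RVec (2 * n + 1) → CVec (n + 1)} {θ : RVec (2 * n + 1) → (RVec (2 * n + 1) →L[ℝ] ℝ)}
  {U : Set (RVec (2 * n + 1))} {V : Set (CVec (n + 1))}
  (hM : IsLocalHypersurface g F θ U V) {y : RVec (2 * n + 1)} (hy : y ∈ U)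
include hM hy

lemma mem_nhds : U ∈ 𝓝 y := hM.isOpen.mem_nhds hy

lemma contDiffAt_map : ContDiffAt ℝ ∞ F y := hM.smooth_map.contDiffAt (hM.mem_nhds hy)

lemma contDiffAt_form : ContDiffAt ℝ ∞ θ y := hM.smooth_form.contDiffAt (hM.mem_nhds hy)

lemma star_herm (a b : CVec (n + 1)) : star (herm (g (F y)) a b) = herm (g (F y)) b a :=
  PseudoHermitian.star_herm (hM.kahler.hermitian _ (hM.mapsTo y hy)) a b

lemma herm_eq_zero_comm {a b : CVec (n + 1)} (h : herm (g (F y)) a b = 0) :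
    herm (g (F y)) b a = 0 := by
  rw [← hM.star_herm hy, h, star_zero]

lemma herm_pos {a : CVec (n + 1)} (ha : a ≠ 0) : 0 < (herm (g (F y)) a a).re :=
  hM.kahler.pos _ (hM.mapsTo y hy) a ha

lemma eq_zero_of_herm_self {a : CVec (n + 1)} (h : herm (g (F y)) a a = 0) : a = 0 := by
  by_contra hne
  have := hM.herm_pos hy hne
  rw [h] at this
  simp at this

lemma bilC_dForm_eq (Z W : CVec (2 * n + 1)) :
    bilC (dForm θ y) Z W = Complex.I * (herm (g (F y)) (dC F y Z) (dC F y (star W)) -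
      herm (g (F y)) (dC F y W) (dC F y (star Z))) := by
  have hd : ∀ u v, (dForm θ y u v : ℂ) = Complex.I *
      (herm (g (F y)) (fderiv ℝ F y u) (fderiv ℝ F y v) -
        herm (g (F y)) (fderiv ℝ F y v) (fderiv ℝ F y u)) := fun u v => by
    rw [hM.dForm_eq y hy, kahlerForm_eq]
  simp only [bilC, dC, rePart_star, imPart_star, map_neg, smul_neg]
  push_cast
  rw [hd, hd, hd, hd]
  simp only [herm_add_left, herm_smul_left, herm_add_right, herm_smul_right, herm_neg_right,
    Complex.star_def, Complex.conj_I]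
  linear_combination (Complex.I * (herm (g (F y)) (fderiv ℝ F y (imPart Z))
    (fderiv ℝ F y (imPart W)) - herm (g (F y)) (fderiv ℝ F y (imPart W))
    (fderiv ℝ F y (imPart Z)))) * (-Complex.I_sq)

lemma levi_eq (Z W : CVec (2 * n + 1)) :
    levi θ y Z W = herm (g (F y)) (dC F y Z) (dC F y W) -
      herm (g (F y)) (dC F y (star W)) (dC F y (star Z)) := by
  rw [levi, hM.bilC_dForm_eq hy, star_star, ← mul_assoc, neg_mul, Complex.I_mul_I, neg_neg,
    one_mul]

lemma levi_eq_herm_of_right (Z : CVec (2 * n + 1)) {W : CVec (2 * n + 1)} (hW : W ∈ T10 F y) :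
    levi θ y Z W = herm (g (F y)) (dC F y Z) (dC F y W) := by
  rw [hM.levi_eq hy, mem_T10_iff.1 hW, herm_zero_left, sub_zero]

lemma levi_eq_herm_of_left {Z : CVec (2 * n + 1)} (W : CVec (2 * n + 1)) (hZ : Z ∈ T10 F y) :
    levi θ y Z W = herm (g (F y)) (dC F y Z) (dC F y W) := by
  rw [hM.levi_eq hy, mem_T10_iff.1 hZ, herm_zero_right, sub_zero]

lemma eq_zero_of_dC_eq_zero {Z : CVec (2 * n + 1)} (h₁ : dC F y Z = 0)
    (h₂ : dC F y (star Z) = 0) : Z = 0 := by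
  have hre : fderiv ℝ F y (rePart Z) = 0 := by
    have : (2 : ℂ) • fderiv ℝ F y (rePart Z) = dC F y Z + dC F y (star Z) := by
      simp only [dC, rePart_star, imPart_star, map_neg]
      module
    rw [h₁, h₂, add_zero] at this
    exact (smul_eq_zero.1 this).resolve_left two_ne_zero
  have him : fderiv ℝ F y (imPart Z) = 0 := by
    rw [dC, hre, zero_add] at h₁
    exact (smul_eq_zero.1 h₁).resolve_left Complex.I_ne_zero
  have h := hM.injective y hy
  rw [eq_toC_add Z, h (hre.trans (map_zero _).symm), h (him.trans (map_zero _).symm)]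
  ext k
  simp [toC]

lemma dC_ne_zero {Z : CVec (2 * n + 1)} (hZ : Z ∈ T10 F y) (hne : Z ≠ 0) : dC F y Z ≠ 0 :=
  fun h => hne (hM.eq_zero_of_dC_eq_zero hy h (mem_T10_iff.1 hZ))

lemma thetaC_eq_zero {Z : CVec (2 * n + 1)} (hZ : Z ∈ T10 F y) : thetaC θ y Z = 0 := by
  have h : ∀ Z ∈ T10 F y, θ y (rePart Z) = 0 := by
    intro Z hZ
    refine (hM.ker_eq y hy _).2 ⟨(1 / 2 : ℂ) • Z, Submodule.smul_mem _ _ hZ, ?_⟩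
    ext k
    apply Complex.ext <;> simp [toC, rePart]
    ring
  have h' := h _ (Submodule.smul_mem _ (-Complex.I) hZ)
  rw [rePart_smul] at h'
  simp only [Complex.neg_re, Complex.I_re, neg_zero, zero_smul, Complex.neg_im, Complex.I_im,
    zero_sub, neg_smul, one_smul, neg_neg] at h'
  rw [thetaC_apply, h Z hZ, h']
  simp

lemma thetaC_star_eq_zero {Z : CVec (2 * n + 1)} (hZ : Z ∈ T10 F y) :
    thetaC θ y (star Z) = 0 := by
  rw [thetaC_star, hM.thetaC_eq_zero hy hZ, star_zero]

/-- `ker θ = T^{1,0} ⊕ T^{0,1}` on the complexified tangent space. -/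
lemma exists_add_star {Z : CVec (2 * n + 1)} (hZ : thetaC θ y Z = 0) :
    ∃ A ∈ T10 F y, ∃ B ∈ T10 F y, Z = A + star B := by
  have hre : θ y (rePart Z) = 0 := by
    have := congrArg Complex.re hZ
    simpa [thetaC_apply] using this
  have him : θ y (imPart Z) = 0 := by
    have := congrArg Complex.im hZ
    simpa [thetaC_apply] using this
  obtain ⟨A, hA, hA'⟩ := (hM.ker_eq y hy _).1 hre
  obtain ⟨B, hB, hB'⟩ := (hM.ker_eq y hy _).1 him
  refine ⟨A + Complex.I • B, add_mem hA (Submodule.smul_mem _ _ hB),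
    A - Complex.I • B, sub_mem hA (Submodule.smul_mem _ _ hB), ?_⟩
  rw [eq_toC_add Z, hA', hB']
  simp only [star_sub, star_smul, Complex.star_def, Complex.conj_I]
  module

/-- Positivity of `ω` makes `dθ` nondegenerate on the horizontal space. -/
lemma eq_zero_of_bilC_eq_zero {Z : CVec (2 * n + 1)} (hZ : thetaC θ y Z = 0)
    (h : ∀ W ∈ T10 F y, bilC (dForm θ y) Z W = 0 ∧ bilC (dForm θ y) Z (star W) = 0) : Z = 0 := by
  obtain ⟨A, hA, B, hB, rfl⟩ := hM.exists_add_star hy hZ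
  have hA0 := mem_T10_iff.1 hA
  have hB0 := mem_T10_iff.1 hB
  have h₁ := (h A hA).2
  have h₂ := (h B hB).1
  rw [hM.bilC_dForm_eq hy] at h₁ h₂
  simp only [star_star, star_add, dC_add_dir, hA0, hB0, add_zero, zero_add, herm_zero_left,
    sub_zero, herm_zero_right, zero_sub] at h₁ h₂
  have eA : dC F y A = 0 := hM.eq_zero_of_herm_self hy
    ((mul_eq_zero.1 h₁).resolve_left Complex.I_ne_zero)
  have eB : dC F y B = 0 := hM.eq_zero_of_herm_self hy
    (neg_eq_zero.1 ((mul_eq_zero.1 h₂).resolve_left Complex.I_ne_zero))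
  rw [hM.eq_zero_of_dC_eq_zero hy eA hA0, hM.eq_zero_of_dC_eq_zero hy eB hB0]
  simp

lemma contactForm_injective : Function.Injective (contactForm θ y) := by
  have hform := hM.contDiffAt_form hy
  -- a real vector in the kernel is horizontal, as `dθ` is skew
  have hre : ∀ v, (∀ w, dForm θ y v w + θ y v * θ y w = 0) → v = 0 := by
    intro v hv
    have hθ : θ y v = 0 := by
      have := hv v
      simpa [dForm] using this
    have h0 : toC v = 0 := by
      refine hM.eq_zero_of_bilC_eq_zero hy (by rw [thetaC_toC, hθ]; simp) fun W hW => ?_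
      have hb : ∀ w, dForm θ y v w = 0 := fun w => by simpa [hθ] using hv w
      have hz : ∀ w, dForm θ y 0 w = 0 := fun w => by simp [dForm]
      constructor <;> simp [bilC, hb, hz]
    have := congrArg rePart h0
    rw [rePart_toC] at this
    rw [this]
    ext k
    simp [rePart]
  refine (injective_iff_map_eq_zero _).2 fun Z hZ => ?_
  have hz : ∀ w, dForm θ y (rePart Z) w + θ y (rePart Z) * θ y w = 0 ∧
      dForm θ y (imPart Z) w + θ y (imPart Z) * θ y w = 0 := by
    intro w
    have h := congrArg (fun L : CVec (2 * n + 1) →L[ℂ] ℂ => L (toC w)) hZ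
    simp only [contactForm_apply hform, zero_apply, thetaC_apply] at h
    have hz : ∀ w, dForm θ y w 0 = 0 := fun w => by simp [dForm]
    have h₁ := congrArg Complex.re h
    have h₂ := congrArg Complex.im h
    simp [bilC, hz] at h₁ h₂
    exact ⟨h₁, h₂⟩
  rw [eq_toC_add Z, hre _ fun w => (hz w).1, hre _ fun w => (hz w).2]
  ext k
  simp [toC]

lemma exists_contactForm_equiv :
    ∃ e : CVec (2 * n + 1) ≃L[ℂ] (CVec (2 * n + 1) →L[ℂ] ℂ), (e : _ →L[ℂ] _) = contactForm θ y := by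
  have hrank : Module.finrank ℂ (CVec (2 * n + 1)) =
      Module.finrank ℂ (CVec (2 * n + 1) →L[ℂ] ℂ) := by
    rw [← (LinearMap.toContinuousLinearMap :
      (CVec (2 * n + 1) →ₗ[ℂ] ℂ) ≃ₗ[ℂ] (CVec (2 * n + 1) →L[ℂ] ℂ)).finrank_eq]
    exact (Subspace.dual_finrank_eq (K := ℂ) (V := CVec (2 * n + 1))).symm
  let e := LinearEquiv.ofInjectiveOfFinrankEq (contactForm θ y).toLinearMap
    (hM.contactForm_injective hy) hrank
  refine ⟨e.toContinuousLinearEquiv, ?_⟩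
  ext Z W
  rfl

lemma contactForm_inverse_apply (φ : CVec (2 * n + 1) →L[ℂ] ℂ) :
    contactForm θ y ((contactForm θ y).inverse φ) = φ := by
  obtain ⟨e, he⟩ := hM.exists_contactForm_equiv hy
  rw [← he, ContinuousLinearMap.inverse_equiv]
  exact e.apply_symm_apply φ

lemma contDiffAt_contactForm_inverse :
    ContDiffAt ℝ ∞ (fun y' => (contactForm θ y').inverse) y := by
  obtain ⟨e, he⟩ := hM.exists_contactForm_equiv hy
  have h : ContDiffAt ℂ ∞ ContinuousLinearMap.inverse (contactForm θ y) := by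
    rw [← he]
    exact contDiffAt_map_inverse e
  exact (h.restrict_scalars ℝ).comp y (contDiffAt_contactForm (hM.contDiffAt_form hy))

/-- The form `θ` has no zeros: otherwise the differential of `F` would identify `ℝ^{2n+1}` with a
complex subspace of `ℂ^{n+1}`, which has even real dimension. -/
lemma form_ne_zero : θ y ≠ 0 := by
  intro h0
  have hJ : ∀ v, ∃ w, fderiv ℝ F y w = Complex.I • fderiv ℝ F y v := by
    intro v
    obtain ⟨Z, hZ, hv⟩ := (hM.ker_eq y hy v).1 (by rw [h0]; rfl)
    have e₁ : dC F y (toC v) = dC F y Z := by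
      rw [hv, dC_add_dir, mem_T10_iff.1 hZ, add_zero]
    have e₂ : dC F y (toC (rePart (Complex.I • Z + star (Complex.I • Z)))) =
        Complex.I • dC F y Z := by
      have : toC (rePart (Complex.I • Z + star (Complex.I • Z))) =
          Complex.I • Z + star (Complex.I • Z) := by
        ext k
        apply Complex.ext <;> simp [toC, rePart]
      rw [this, dC_add_dir, mem_T10_iff.1 (Submodule.smul_mem _ Complex.I hZ), add_zero,
        dC_smul_dir]
    refine ⟨rePart (Complex.I • Z + star (Complex.I • Z)), ?_⟩
    rw [← dC_toC, e₂, ← e₁, dC_toC]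
  let S : Submodule ℂ (CVec (n + 1)) :=
    { carrier := Set.range (fderiv ℝ F y)
      add_mem' := by
        rintro _ _ ⟨u, rfl⟩ ⟨v, rfl⟩
        exact ⟨u + v, map_add _ _ _⟩
      zero_mem' := ⟨0, map_zero _⟩
      smul_mem' := by
        rintro c _ ⟨u, rfl⟩
        obtain ⟨w, hw⟩ := hJ u
        refine ⟨c.re • u + c.im • w, ?_⟩
        rw [map_add, map_smul, map_smul, hw]
        conv_rhs => rw [← Complex.re_add_im c]
        rw [add_smul, mul_smul]
        rfl }
  have hS : Module.finrank ℝ S = 2 * n + 1 := by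
    let e : RVec (2 * n + 1) ≃ₗ[ℝ] S := LinearEquiv.ofBijective
      { toFun := fun v => (⟨fderiv ℝ F y v, v, rfl⟩ : S)
        map_add' := fun u v => Subtype.ext (map_add _ _ _)
        map_smul' := fun c v => Subtype.ext (map_smul _ _ _) }
      ⟨fun u v huv => hM.injective y hy (congrArg Subtype.val huv),
        fun ⟨_, v, hv⟩ => ⟨v, Subtype.ext hv⟩⟩
    rw [← e.finrank_eq]
    simp
  rw [finrank_real_of_complex] at hS
  omega

lemma exists_reeb : ∃ T, θ y T = 1 ∧ ∀ v, dForm θ y T v = 0 := by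
  have hform := hM.contDiffAt_form hy
  set τ := (contactForm θ y).inverse (thetaC θ y) with hτ
  have hτ' : contactForm θ y τ = thetaC θ y := hM.contactForm_inverse_apply hy _
  set T := rePart τ with hT
  have h₁ : ∀ v, dForm θ y T v + θ y T * θ y v = θ y v := by
    intro v
    have h := congrArg (fun L : CVec (2 * n + 1) →L[ℂ] ℂ => L (toC v)) hτ'
    simp only [contactForm_apply hform, thetaC_apply] at h
    have hz : ∀ w, dForm θ y w 0 = 0 := fun w => by simp [dForm]
    have h₁ := congrArg Complex.re h
    simpa [bilC, hz] using h₁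
  have h₂ : θ y T * θ y T = θ y T := by simpa [dForm] using h₁ T
  rcases mul_eq_zero.1 (show θ y T * (θ y T - 1) = 0 by linear_combination h₂) with h0 | h1
  · -- then `T` is horizontal and `dθ(T, ·) = θ` vanishes on the horizontal space
    exfalso
    have hT0 : toC T = 0 := by
      have hb : ∀ w, dForm θ y T w = θ y w := fun w => by simpa [h0] using h₁ w
      have hz : ∀ w, dForm θ y 0 w = 0 := fun w => by simp [dForm]
      have hbil : ∀ W, bilC (dForm θ y) (toC T) W = thetaC θ y W := fun W => by
        simp [bilC, hb, hz, thetaC_apply]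
      refine hM.eq_zero_of_bilC_eq_zero hy (by rw [thetaC_toC, h0]; simp) fun W hW => ?_
      rw [hbil, hbil, hM.thetaC_eq_zero hy hW, hM.thetaC_star_eq_zero hy hW]
      exact ⟨rfl, rfl⟩
    have hT0' : T = 0 := by
      have := congrArg rePart hT0
      rw [rePart_toC] at this
      rw [this]
      ext k
      simp [rePart]
    refine hM.form_ne_zero hy (ContinuousLinearMap.ext fun v => ?_)
    rw [← h₁ v, hT0']
    simp [dForm]
  · have h1' : θ y T = 1 := by linarith
    exact ⟨T, h1', fun v => by simpa [h1'] using h₁ v⟩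

lemma form_reeb : θ y (reeb θ y) = 1 :=
  (Classical.epsilon_spec (hM.exists_reeb hy)).1

lemma dForm_reeb (v : RVec (2 * n + 1)) : dForm θ y (reeb θ y) v = 0 :=
  (Classical.epsilon_spec (hM.exists_reeb hy)).2 v

lemma thetaC_reebC : thetaC θ y (reebC θ y) = 1 := by
  rw [reebC, thetaC_toC, hM.form_reeb hy, Complex.ofReal_one]

lemma bilC_reebC (W : CVec (2 * n + 1)) : bilC (dForm θ y) (reebC θ y) W = 0 := by
  have hz : ∀ w, dForm θ y 0 w = 0 := fun w => by simp [dForm]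
  simp [bilC, reebC, hM.dForm_reeb hy, hz]

/-- The Reeb field is determined by its defining equations. -/
lemma reeb_eq_of {T : RVec (2 * n + 1)} (h₁ : θ y T = 1) (h₂ : ∀ v, dForm θ y T v = 0) :
    reeb θ y = T := by
  have hz : ∀ w, dForm θ y 0 w = 0 := fun w => by simp [dForm]
  have h : reebC θ y = toC T := by
    refine hM.contactForm_injective hy (ContinuousLinearMap.ext fun W => ?_)
    rw [contactForm_apply (hM.contDiffAt_form hy), contactForm_apply (hM.contDiffAt_form hy),
      hM.bilC_reebC hy, hM.thetaC_reebC hy, thetaC_toC, h₁]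
    simp [bilC, h₂, hz]
  have := congrArg rePart h
  rwa [reebC, rePart_toC, rePart_toC] at this

lemma reebC_eq_inverse : reebC θ y = (contactForm θ y).inverse (thetaC θ y) := by
  refine hM.contactForm_injective hy ?_
  rw [hM.contactForm_inverse_apply hy]
  ext W
  rw [contactForm_apply (hM.contDiffAt_form hy), hM.bilC_reebC hy, hM.thetaC_reebC hy]
  simp

lemma contDiffAt_reebC : ContDiffAt ℝ ∞ (reebC θ) y := by
  have h : ContDiffAt ℝ ∞ (fun y' => (contactForm θ y').inverse (thetaC θ y')) y :=
    contDiffAt_clm_apply (hM.contDiffAt_contactForm_inverse hy)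
      (contDiffAt_thetaC (hM.contDiffAt_form hy))
  refine h.congr_of_eventuallyEq ?_
  filter_upwards [hM.mem_nhds hy] with y' hy' using hM.reebC_eq_inverse hy'

end IsLocalHypersurface

/-! ### The normal direction and the tangential projection -/

/-- The `(1,0)`-part `ξ` of the Reeb field, which spans the orthogonal complement of `T^{1,0}M`. -/
noncomputable def normalVec {m N : ℕ} (F : RVec m → CVec N) (θ : RVec m → (RVec m →L[ℝ] ℝ))
    (y : RVec m) : CVec N :=
  dC F y (reebC θ y)

/-- The squared length `κ = |ξ|²`.  It is real, and it turns out to be `|H|²`. -/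
noncomputable def normalSq {m N : ℕ} (g : CVec N → Matrix (Fin N) (Fin N) ℂ) (F : RVec m → CVec N)
    (θ : RVec m → (RVec m →L[ℝ] ℝ)) (y : RVec m) : ℂ :=
  herm (g (F y)) (normalVec F θ y) (normalVec F θ y)

/-- The form `V ↦ i ⟨a, F_* V̄⟩ - i θ(V) ⟨a, ξ̄⟩`, to be represented by the tangential part of
`a`. -/
noncomputable def tanForm {m N : ℕ} (g : CVec N → Matrix (Fin N) (Fin N) ℂ) (F : RVec m → CVec N)
    (θ : RVec m → (RVec m →L[ℝ] ℝ)) (y : RVec m) : CVec N →L[ℂ] CVec m →L[ℂ] ℂ :=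
  toCLM₂ (LinearMap.mk₂ ℂ
    (fun a Z => Complex.I * herm (g (F y)) a (dC F y (star Z)) -
      Complex.I * thetaC θ y Z * herm (g (F y)) a (normalVec F θ y))
    (fun a a' Z => by simp only [herm_add_left]; ring)
    (fun c a Z => by simp only [herm_smul_left, smul_eq_mul]; ring)
    (fun a Z Z' => by simp only [star_add, dC_add_dir, herm_add_right, map_add]; ring)
    (fun c a Z => by
      simp only [star_smul, dC_smul_dir, herm_smul_right, map_smul, smul_eq_mul, star_star]; ring))

lemma tanForm_apply {m N : ℕ} (g : CVec N → Matrix (Fin N) (Fin N) ℂ) (F : RVec m → CVec N)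
    (θ : RVec m → (RVec m →L[ℝ] ℝ)) (y : RVec m) (a : CVec N) (Z : CVec m) :
    tanForm g F θ y a Z = Complex.I * herm (g (F y)) a (dC F y (star Z)) -
      Complex.I * thetaC θ y Z * herm (g (F y)) a (normalVec F θ y) := rfl

/-- The orthogonal projection of `T^{1,0}X` onto `T^{1,0}M`. -/
noncomputable def tanProj {m N : ℕ} (g : CVec N → Matrix (Fin N) (Fin N) ℂ) (F : RVec m → CVec N)
    (θ : RVec m → (RVec m →L[ℝ] ℝ)) (y : RVec m) : CVec N →L[ℂ] CVec m :=
  (contactForm θ y).inverse.comp (tanForm g F θ y)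

lemma IsKahlerOn.contDiffAt_herm {m N : ℕ} {g : CVec N → Matrix (Fin N) (Fin N) ℂ}
    {V : Set (CVec N)} (hg : IsKahlerOn g V) {F : RVec m → CVec N} {y : RVec m}
    (hF : ContDiffAt ℝ ∞ F y) (hx : F y ∈ V) {s t : RVec m → CVec N}
    (hs : ContDiffAt ℝ ∞ s y) (ht : ContDiffAt ℝ ∞ t y) :
    ContDiffAt ℝ ∞ (fun y' => herm (g (F y')) (s y') (t y')) y := by
  have hgF : ∀ j k, ContDiffAt ℝ ∞ (fun y' => g (F y') j k) y := fun j k =>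
    (hg.contDiffAt hx j k).comp y hF
  exact ContDiffAt.sum fun j _ => ContDiffAt.sum fun k _ =>
    ((hgF j k).mul (contDiffAt_pi.1 hs j)).mul (contDiffAt_conj (contDiffAt_pi.1 ht k))

namespace IsLocalHypersurface

variable {n : ℕ} {g : CVec (n + 1) → Matrix (Fin (n + 1)) (Fin (n + 1)) ℂ}
  {F : RVec (2 * n + 1) → CVec (n + 1)} {θ : RVec (2 * n + 1) → (RVec (2 * n + 1) →L[ℝ] ℝ)}
  {U : Set (RVec (2 * n + 1))} {V : Set (CVec (n + 1))}
  (hM : IsLocalHypersurface g F θ U V) {y : RVec (2 * n + 1)} (hy : y ∈ U)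
include hM hy

lemma contDiffAt_normalVec : ContDiffAt ℝ ∞ (normalVec F θ) y :=
  contDiffAt_clm_apply (contDiffAt_dCL (hM.contDiffAt_map hy)) (hM.contDiffAt_reebC hy)

lemma contDiffAt_normalSq : ContDiffAt ℝ ∞ (normalSq g F θ) y :=
  hM.kahler.contDiffAt_herm (hM.contDiffAt_map hy) (hM.mapsTo y hy) (hM.contDiffAt_normalVec hy)
    (hM.contDiffAt_normalVec hy)

lemma contDiffAt_tanProj : ContDiffAt ℝ ∞ (tanProj g F θ) y := by
  refine contDiffAt_clm_of_apply fun a => ?_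
  have hF := hM.contDiffAt_map hy
  have h : ContDiffAt ℝ ∞ (fun y' => tanForm g F θ y' a) y := by
    refine contDiffAt_clm_of_apply fun Z => ?_
    have h₁ := hM.kahler.contDiffAt_herm hF (hM.mapsTo y hy) (contDiffAt_const (c := a))
      (contDiffAt_dC hF (star Z))
    have h₂ := hM.kahler.contDiffAt_herm hF (hM.mapsTo y hy) (contDiffAt_const (c := a))
      (hM.contDiffAt_normalVec hy)
    have h₃ : ContDiffAt ℝ ∞ (fun y' => thetaC θ y' Z) y :=
      contDiffAt_clm_apply (contDiffAt_thetaC (hM.contDiffAt_form hy)) contDiffAt_const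
    exact (contDiffAt_const.mul h₁).sub ((contDiffAt_const.mul h₃).mul h₂)
  have h' : ContDiffAt ℝ ∞ (fun y' => (contactForm θ y').inverse (tanForm g F θ y' a)) y :=
    contDiffAt_clm_apply (hM.contDiffAt_contactForm_inverse hy) h
  exact h'

/-- Every complex tangent vector is a sum of vectors in `T^{1,0}`, `T^{0,1}` and `ℂ T`. -/
lemma exists_decomposition (Z : CVec (2 * n + 1)) :
    ∃ A ∈ T10 F y, ∃ B ∈ T10 F y, Z = A + star B + thetaC θ y Z • reebC θ y := by
  have h0 : thetaC θ y (Z - thetaC θ y Z • reebC θ y) = 0 := by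
    rw [map_sub, map_smul, hM.thetaC_reebC hy, smul_eq_mul, mul_one, sub_self]
  obtain ⟨A, hA, B, hB, h⟩ := hM.exists_add_star hy h0
  exact ⟨A, hA, B, hB, by rw [← h, sub_add_cancel]⟩

lemma herm_normalVec {W : CVec (2 * n + 1)} (hW : W ∈ T10 F y) :
    herm (g (F y)) (normalVec F θ y) (dC F y W) = 0 := by
  have h := hM.bilC_reebC hy (star W)
  rw [hM.bilC_dForm_eq hy, star_star, mem_T10_iff.1 hW, herm_zero_left, sub_zero] at h
  exact (mul_eq_zero.1 h).resolve_left Complex.I_ne_zero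

lemma herm_normalVec_right {W : CVec (2 * n + 1)} (hW : W ∈ T10 F y) :
    herm (g (F y)) (dC F y W) (normalVec F θ y) = 0 :=
  hM.herm_eq_zero_comm hy (hM.herm_normalVec hy hW)

lemma normalVec_ne_zero : normalVec F θ y ≠ 0 := by
  intro h
  have h0 : reebC θ y = 0 := hM.eq_zero_of_dC_eq_zero hy h (by rw [star_reebC]; exact h)
  have := hM.thetaC_reebC hy
  rw [h0, map_zero] at this
  exact zero_ne_one this

lemma normalSq_pos : 0 < (normalSq g F θ y).re := hM.herm_pos hy (hM.normalVec_ne_zero hy)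

lemma normalSq_ne_zero : normalSq g F θ y ≠ 0 := fun h => by
  have := hM.normalSq_pos hy
  rw [h] at this
  simp at this

lemma star_normalSq : star (normalSq g F θ y) = normalSq g F θ y := hM.star_herm hy _ _

lemma normalSq_eq_re : normalSq g F θ y = ((normalSq g F θ y).re : ℂ) :=
  (Complex.conj_eq_iff_re.1 (hM.star_normalSq hy)).symm

/-- The differential of `F` maps `ℂ ⊗ TM` onto `T^{1,0}X`. -/
lemma dC_surjective : Function.Surjective (dCL F y) := by
  let S : Submodule ℂ (CVec (n + 1)) := LinearMap.range (dCL F y).toLinearMap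
  have h₁ : 2 * n + 1 ≤ Module.finrank ℝ S := by
    let f : RVec (2 * n + 1) →ₗ[ℝ] S :=
      { toFun := fun v => (⟨fderiv ℝ F y v, ⟨toC v, dC_toC F y v⟩⟩ : S)
        map_add' := fun u v => Subtype.ext (map_add _ _ _)
        map_smul' := fun c v => Subtype.ext (map_smul _ _ _) }
    have hf : Function.Injective f := fun u v huv =>
      hM.injective y hy (congrArg Subtype.val huv)
    have := LinearMap.finrank_le_finrank_of_injective hf
    simpa using this
  rw [finrank_real_of_complex] at h₁
  have h₂ : Module.finrank ℂ S = Module.finrank ℂ (CVec (n + 1)) := by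
    have h₃ := Submodule.finrank_le S
    have h₄ : Module.finrank ℂ (CVec (n + 1)) = n + 1 := by simp
    omega
  exact LinearMap.range_eq_top.1 (Submodule.eq_top_of_finrank_eq h₂)

/-- Every `(1,0)`-vector is the sum of a vector tangent to `M` and a multiple of `ξ`. -/
lemma exists_tangent_add (a : CVec (n + 1)) :
    ∃ A ∈ T10 F y, ∃ c : ℂ, a = dC F y A + c • normalVec F θ y := by
  obtain ⟨Z, rfl⟩ := hM.dC_surjective hy a
  obtain ⟨A, hA, B, hB, h⟩ := hM.exists_decomposition hy Z
  refine ⟨A, hA, thetaC θ y Z, ?_⟩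
  rw [dCL_apply]
  conv_lhs => rw [h]
  rw [dC_add_dir, dC_add_dir, mem_T10_iff.1 hB, add_zero, dC_smul_dir]
  rfl

lemma contactForm_tanProj (a : CVec (n + 1)) (Z : CVec (2 * n + 1)) :
    contactForm θ y (tanProj g F θ y a) Z = tanForm g F θ y a Z := by
  rw [tanProj, comp_apply, hM.contactForm_inverse_apply hy]

/-- The vectors of `T^{1,0}M` are fixed by the projection. -/
lemma tanProj_dC {Z : CVec (2 * n + 1)} (hZ : Z ∈ T10 F y) :
    tanProj g F θ y (dC F y Z) = Z := by
  refine hM.contactForm_injective hy (ContinuousLinearMap.ext fun W => ?_)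
  rw [hM.contactForm_tanProj hy, tanForm_apply, contactForm_apply (hM.contDiffAt_form hy),
    hM.bilC_dForm_eq hy, hM.thetaC_eq_zero hy hZ, hM.herm_normalVec_right hy hZ,
    mem_T10_iff.1 hZ, herm_zero_right]
  ring

lemma tanProj_normalVec : tanProj g F θ y (normalVec F θ y) = 0 := by
  refine hM.contactForm_injective hy (ContinuousLinearMap.ext fun W => ?_)
  rw [hM.contactForm_tanProj hy, tanForm_apply, map_zero, zero_apply]
  obtain ⟨A, hA, B, hB, h⟩ := hM.exists_decomposition hy W
  have e : dC F y (star W) = dC F y B + star (thetaC θ y W) • normalVec F θ y := by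
    conv_lhs => rw [h]
    rw [star_add, star_add, star_star, star_smul, star_reebC, dC_add_dir, dC_add_dir,
      mem_T10_iff.1 hA, zero_add, dC_smul_dir]
    rfl
  rw [e, herm_add_right, herm_smul_right, hM.herm_normalVec hy hB, star_star]
  ring

lemma tanProj_mem (a : CVec (n + 1)) : tanProj g F θ y a ∈ T10 F y := by
  obtain ⟨A, hA, c, rfl⟩ := hM.exists_tangent_add hy a
  rw [map_add, map_smul, hM.tanProj_dC hy hA, hM.tanProj_normalVec hy, smul_zero, add_zero]
  exact hA

/-- The orthogonal decomposition of a `(1,0)`-vector. -/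
lemma dC_tanProj (a : CVec (n + 1)) :
    dC F y (tanProj g F θ y a) =
      a - (herm (g (F y)) a (normalVec F θ y) / normalSq g F θ y) • normalVec F θ y := by
  obtain ⟨A, hA, c, rfl⟩ := hM.exists_tangent_add hy a
  rw [map_add, map_smul, hM.tanProj_dC hy hA, hM.tanProj_normalVec hy, smul_zero, add_zero,
    herm_add_left, herm_smul_left, hM.herm_normalVec_right hy hA, zero_add, ← normalSq,
    mul_div_cancel_right₀ _ (hM.normalSq_ne_zero hy), add_sub_cancel_right]

lemma herm_dC_tanProj (a : CVec (n + 1)) {W : CVec (2 * n + 1)} (hW : W ∈ T10 F y) :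
    herm (g (F y)) (dC F y (tanProj g F θ y a)) (dC F y W) = herm (g (F y)) a (dC F y W) := by
  rw [hM.dC_tanProj hy, herm_sub_left, herm_smul_left, hM.herm_normalVec hy hW, mul_zero, sub_zero]

lemma herm_dC_tanProj_right (a : CVec (n + 1)) {W : CVec (2 * n + 1)} (hW : W ∈ T10 F y) :
    herm (g (F y)) (dC F y W) (dC F y (tanProj g F θ y a)) = herm (g (F y)) (dC F y W) a := by
  rw [← hM.star_herm hy, hM.herm_dC_tanProj hy a hW, hM.star_herm hy]

lemma tanProj_dC_eq {Z A B : CVec (2 * n + 1)} {c : ℂ} (hA : A ∈ T10 F y) (hB : B ∈ T10 F y)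
    (h : Z = A + star B + c • reebC θ y) : tanProj g F θ y (dC F y Z) = A := by
  rw [h, dC_add_dir, dC_add_dir, mem_T10_iff.1 hB, add_zero, dC_smul_dir, map_add, map_smul,
    hM.tanProj_dC hy hA, ← normalVec, hM.tanProj_normalVec hy, smul_zero, add_zero]

/-- The splitting of a complex tangent vector into its components in `T^{1,0}`, `T^{0,1}` and
`ℂ T`. -/
lemma decomposition (Z : CVec (2 * n + 1)) :
    tanProj g F θ y (dC F y Z) + star (tanProj g F θ y (dC F y (star Z))) +
      thetaC θ y Z • reebC θ y = Z := by
  obtain ⟨A, hA, B, hB, h⟩ := hM.exists_decomposition hy Z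
  have h' : star Z = B + star A + star (thetaC θ y Z) • reebC θ y := by
    conv_lhs => rw [h]
    rw [star_add, star_add, star_star, star_smul, star_reebC, add_comm (star A)]
  rw [hM.tanProj_dC_eq hy hA hB h, hM.tanProj_dC_eq hy hB hA h', ← h]

end IsLocalHypersurface

/-! ### Lie brackets -/

section Bracket

variable {m N : ℕ}

/-- The Lie bracket of two complex vector fields on `ℝ^m`. -/
noncomputable def bracket (A B : RVec m → CVec m) (y : RVec m) : CVec m :=
  dC B y (A y) - dC A y (B y)

lemma star_bracket (A B : RVec m → CVec m) (y : RVec m) :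
    star (bracket A B y) = bracket (fun x => star (A x)) (fun x => star (B x)) y := by
  simp only [bracket, dC_star, star_star, star_sub]

lemma dC_dCL_comm {F : RVec m → CVec N} {y : RVec m} (hF : ContDiffAt ℝ ∞ F y) (X Y : CVec m) :
    dC (dCL F) y X Y = dC (dCL F) y Y X := by
  have hd : DifferentiableAt ℝ (dCL F) y := (contDiffAt_dCL hF).differentiableAt (by simp)
  rw [← dC_clm_const hd, ← dC_clm_const hd]
  exact dC_comm hF X Y

lemma dC_dC_apply {F : RVec m → CVec N} {y : RVec m} (hF : ContDiffAt ℝ ∞ F y)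
    {B : RVec m → CVec m} (hB : DifferentiableAt ℝ B y) (X : CVec m) :
    dC (fun x => dC F x (B x)) y X = dC (dCL F) y X (B y) + dC F y (dC B y X) :=
  dC_clm_apply (A := dCL F) ((contDiffAt_dCL hF).differentiableAt (by simp)) hB X

/-- `F_* [A, B] = A (F_* B) - B (F_* A)`. -/
lemma dC_bracket {F : RVec m → CVec N} {y : RVec m} (hF : ContDiffAt ℝ ∞ F y)
    {A B : RVec m → CVec m} (hA : DifferentiableAt ℝ A y) (hB : DifferentiableAt ℝ B y) :
    dC F y (bracket A B y) =
      dC (fun x => dC F x (B x)) y (A y) - dC (fun x => dC F x (A x)) y (B y) := by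
  rw [dC_dC_apply hF hA, dC_dC_apply hF hB, dC_dCL_comm hF (A y) (B y), bracket, ← dCL_apply,
    map_sub]
  simp only [dCL_apply]
  abel

/-- Cartan's formula `θ([A, B]) = A θ(B) - B θ(A) - dθ(A, B)`. -/
lemma thetaC_bracket {θ : RVec m → (RVec m →L[ℝ] ℝ)} {y : RVec m} (hθ : ContDiffAt ℝ ∞ θ y)
    {A B : RVec m → CVec m} (hA : DifferentiableAt ℝ A y) (hB : DifferentiableAt ℝ B y) :
    thetaC θ y (bracket A B y) = dC (fun x => thetaC θ x (B x)) y (A y) -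
      dC (fun x => thetaC θ x (A x)) y (B y) - bilC (dForm θ y) (A y) (B y) := by
  have hd : DifferentiableAt ℝ (thetaC θ) y := (contDiffAt_thetaC hθ).differentiableAt (by simp)
  rw [dC_clm_apply hd hA, dC_clm_apply hd hB, bilC_dForm hθ, bracket, map_sub]
  ring

lemma torsion_eq_bracket (Γ : Christoffel m) (A B : RVec m → CVec m) (y : RVec m) :
    torsion Γ y (A y) (B y) = covDeriv Γ B y (A y) - covDeriv Γ A y (B y) - bracket A B y := by
  simp only [torsion, covDeriv, bracket]
  abel

lemma covDeriv_star {Γ : Christoffel m} {y : RVec m}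
    (hΓ : ∀ X Y, star (Γ y X Y) = Γ y (star X) (star Y)) (W : RVec m → CVec m) (X : CVec m) :
    covDeriv Γ (fun x => star (W x)) y X = star (covDeriv Γ W y (star X)) := by
  simp only [covDeriv, dC_star, star_add, hΓ, star_star]

end Bracket

/-! ### The Tanaka–Webster connection -/

section Definitions

variable {m N : ℕ} (g : CVec N → Matrix (Fin N) (Fin N) ℂ) (F : RVec m → CVec N)
  (θ : RVec m → (RVec m →L[ℝ] ℝ))

/-- The projection of `ℂ ⊗ TM` onto `T^{1,0}M` along `T^{0,1}M ⊕ ℂ T`. -/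
noncomputable def proj10 (y : RVec m) : CVec m →L[ℂ] CVec m :=
  (tanProj g F θ y).comp (dCL F y)

variable {F} in
lemma proj10_star_of_mem {y : RVec m} {Z : CVec m} (hZ : Z ∈ T10 F y) :
    proj10 g F θ y (star Z) = 0 := by
  rw [proj10, comp_apply, dCL_apply, mem_T10_iff.1 hZ, map_zero]

/-- The push-forward of the `(1,0)`-component. -/
noncomputable def pushProj (y : RVec m) : CVec m →L[ℂ] CVec N :=
  (dCL F y).comp (proj10 g F θ y)

/-- The `(1,0)`-component of the Tanaka–Webster connection form: on sections `W` of `T^{1,0}M` the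
connection is `∇_X W = (∇̃_X W)^⊤ - i |ξ|² θ(X) W`. -/
noncomputable def twForm10 (y : RVec m) : CVec m →L[ℂ] CVec m →L[ℂ] CVec m :=
  toCLM₂ (LinearMap.mk₂ ℂ
    (fun X Y => tanProj g F θ y (dC (pushProj g F θ) y X Y +
        chernConn g F y X (pushProj g F θ y Y)) -
      (Complex.I * normalSq g F θ y * thetaC θ y X) • proj10 g F θ y Y)
    (fun X X' Y => by
      simp only [dC_add_dir, add_apply, map_add, mul_add, add_smul]; abel)
    (fun c X Y => by
      simp only [dC_smul_dir, smul_apply, map_smul, map_add, smul_sub, smul_add, smul_eq_mul,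
        smul_smul]
      module)
    (fun X Y Y' => by simp only [map_add, smul_add]; abel)
    (fun c X Y => by
      simp only [map_smul, map_add, smul_sub, smul_add, smul_smul]
      module))

lemma twForm10_apply (y : RVec m) (X Y : CVec m) :
    twForm10 g F θ y X Y = tanProj g F θ y (dC (pushProj g F θ) y X Y +
        chernConn g F y X (pushProj g F θ y Y)) -
      (Complex.I * normalSq g F θ y * thetaC θ y X) • proj10 g F θ y Y := rfl

/-- The connection form of the Tanaka–Webster connection. -/
noncomputable def twForm (y : RVec m) : CVec m →L[ℂ] CVec m →L[ℂ] CVec m :=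
  toCLM₂ (LinearMap.mk₂ ℂ
    (fun X Y => twForm10 g F θ y X Y + star (twForm10 g F θ y (star X) (star Y)) +
      dC (thetaC θ) y X Y • reebC θ y)
    (fun X X' Y => by
      simp only [dC_add_dir, add_apply, map_add, star_add, add_smul]; abel)
    (fun c X Y => by
      simp only [dC_smul_dir, smul_apply, map_smul, star_smul, star_star, smul_add, smul_eq_mul,
        smul_smul])
    (fun X Y Y' => by simp only [map_add, star_add, add_smul]; abel)
    (fun c X Y => by
      simp only [map_smul, star_smul, star_star, smul_add, smul_eq_mul, smul_smul]))

lemma twForm_apply (y : RVec m) (X Y : CVec m) :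
    twForm g F θ y X Y = twForm10 g F θ y X Y + star (twForm10 g F θ y (star X) (star Y)) +
      dC (thetaC θ) y X Y • reebC θ y := rfl

end Definitions

namespace IsLocalHypersurface

variable {n : ℕ} {g : CVec (n + 1) → Matrix (Fin (n + 1)) (Fin (n + 1)) ℂ}
  {F : RVec (2 * n + 1) → CVec (n + 1)} {θ : RVec (2 * n + 1) → (RVec (2 * n + 1) →L[ℝ] ℝ)}
  {U : Set (RVec (2 * n + 1))} {V : Set (CVec (n + 1))}
  (hM : IsLocalHypersurface g F θ U V) {y : RVec (2 * n + 1)} (hy : y ∈ U)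
include hM hy

lemma contDiffAt_proj10 : ContDiffAt ℝ ∞ (proj10 g F θ) y := by
  refine contDiffAt_clm_of_apply fun Z => ?_
  have h : ContDiffAt ℝ ∞ (fun y' => tanProj g F θ y' (dC F y' Z)) y :=
    contDiffAt_clm_apply (hM.contDiffAt_tanProj hy) (contDiffAt_dC (hM.contDiffAt_map hy) Z)
  exact h

lemma contDiffAt_pushProj : ContDiffAt ℝ ∞ (pushProj g F θ) y := by
  refine contDiffAt_clm_of_apply fun Z => ?_
  have h : ContDiffAt ℝ ∞ (fun y' => dCL F y' (proj10 g F θ y' Z)) y :=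
    contDiffAt_clm_apply (contDiffAt_dCL (hM.contDiffAt_map hy))
      (contDiffAt_clm_apply (hM.contDiffAt_proj10 hy) contDiffAt_const)
  exact h

lemma proj10_mem (Z : CVec (2 * n + 1)) : proj10 g F θ y Z ∈ T10 F y := hM.tanProj_mem hy _

lemma proj10_of_mem {Z : CVec (2 * n + 1)} (hZ : Z ∈ T10 F y) : proj10 g F θ y Z = Z :=
  hM.tanProj_dC hy hZ

lemma proj10_reebC : proj10 g F θ y (reebC θ y) = 0 := hM.tanProj_normalVec hy

/-- A vector of `T^{1,0}M` extends to a section. -/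
lemma exists_section {Z : CVec (2 * n + 1)} (hZ : Z ∈ T10 F y) :
    ∃ W : RVec (2 * n + 1) → CVec (2 * n + 1), ContDiff ℝ ∞ W ∧ (∀ y', W y' ∈ T10 F y') ∧
      W y = Z := by
  obtain ⟨r, hr, hrU⟩ := Metric.isOpen_iff.1 hM.isOpen y hy
  let χ : ContDiffBump y := ⟨r / 4, r / 2, by positivity, by linarith⟩
  have hsupp : tsupport χ ⊆ U := by
    rw [χ.tsupport_eq]
    exact (Metric.closedBall_subset_ball (by change r / 2 < r; linarith)).trans hrU
  refine ⟨fun y' => (χ y' : ℂ) • proj10 g F θ y' Z, ?_, fun y' => ?_, ?_⟩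
  · refine contDiff_iff_contDiffAt.2 fun x => ?_
    by_cases hx : x ∈ U
    · have h₁ : ContDiffAt ℝ ∞ (fun y' => ((χ y' : ℝ) : ℂ)) x :=
        Complex.ofRealCLM.contDiff.contDiffAt.comp x χ.contDiff.contDiffAt
      exact contDiffAt_smul h₁ (contDiffAt_clm_apply (hM.contDiffAt_proj10 hx) contDiffAt_const)
    · have h₁ : (χ : RVec (2 * n + 1) → ℝ) =ᶠ[𝓝 x] 0 :=
        notMem_tsupport_iff_eventuallyEq.1 fun h => hx (hsupp h)
      refine (contDiffAt_const (c := (0 : CVec (2 * n + 1)))).congr_of_eventuallyEq ?_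
      filter_upwards [h₁] with x' hx'
      rw [hx']
      simp
  · by_cases hx : y' ∈ U
    · exact Submodule.smul_mem _ _ (hM.proj10_mem hx Z)
    · have h₁ : χ y' = 0 := image_eq_zero_of_notMem_tsupport fun h => hx (hsupp h)
      simp only [h₁, Complex.ofReal_zero, zero_smul]
      exact zero_mem _
  · have h₁ : χ y = 1 := χ.one_of_mem_closedBall (by simp [χ]; positivity)
    simp only [h₁, Complex.ofReal_one, one_smul]
    exact hM.proj10_of_mem hy hZ

lemma contDiffAt_twForm : ContDiffAt ℝ ∞ (twForm g F θ) y := by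
  have hF := hM.contDiffAt_map hy
  have hp := hM.contDiffAt_pushProj hy
  have hθ := contDiffAt_thetaC (hM.contDiffAt_form hy)
  have h10 : ∀ X Y, ContDiffAt ℝ ∞ (fun y' => twForm10 g F θ y' X Y) y := by
    intro X Y
    have h𝒢 := hM.kahler.contDiffAt_chernConn hF (hM.mapsTo y hy)
    have h₁ : ContDiffAt ℝ ∞ (fun y' => tanProj g F θ y' (dC (pushProj g F θ) y' X Y +
        chernConn g F y' X (pushProj g F θ y' Y))) y := by
      refine contDiffAt_clm_apply (hM.contDiffAt_tanProj hy) ?_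
      exact (contDiffAt_clm_apply (contDiffAt_dC hp X) contDiffAt_const).add
        (contDiffAt_clm_apply (contDiffAt_clm_apply h𝒢 contDiffAt_const)
          (contDiffAt_clm_apply hp contDiffAt_const))
    have h₂ : ContDiffAt ℝ ∞ (fun y' => (Complex.I * normalSq g F θ y' * thetaC θ y' X) •
        proj10 g F θ y' Y) y := by
      refine contDiffAt_smul ?_ (contDiffAt_clm_apply (hM.contDiffAt_proj10 hy) contDiffAt_const)
      exact (contDiffAt_const.mul (hM.contDiffAt_normalSq hy)).mul
        (contDiffAt_clm_apply hθ contDiffAt_const)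
    exact h₁.sub h₂
  refine contDiffAt_clm_of_apply fun X => contDiffAt_clm_of_apply fun Y => ?_
  exact ((h10 X Y).add (contDiffAt_star (h10 _ _))).add
    (contDiffAt_smul (contDiffAt_clm_apply (contDiffAt_dC hθ X) contDiffAt_const)
      (hM.contDiffAt_reebC hy))

lemma star_twForm (X Y : CVec (2 * n + 1)) :
    star (twForm g F θ y X Y) = twForm g F θ y (star X) (star Y) := by
  have hθ : DifferentiableAt ℝ (thetaC θ) y :=
    (contDiffAt_thetaC (hM.contDiffAt_form hy)).differentiableAt (by simp)
  have h : star (dC (thetaC θ) y X Y) = dC (thetaC θ) y (star X) (star Y) := by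
    rw [← dC_clm_const hθ, ← dC_clm_const hθ]
    simp only [thetaC_star]
    rw [dC_conj, star_star]
  simp only [twForm_apply, star_add, star_star, star_smul, star_reebC, h]
  abel

/-- The Tanaka–Webster covariant derivative of an arbitrary vector field. -/
lemma covDeriv_twForm {Y : RVec (2 * n + 1) → CVec (2 * n + 1)} (hY : DifferentiableAt ℝ Y y)
    (X : CVec (2 * n + 1)) :
    covDeriv (twForm g F θ) Y y X =
      (tanProj g F θ y (covDeriv (chernConn g F) (fun x => pushProj g F θ x (Y x)) y X) -
        (Complex.I * normalSq g F θ y * thetaC θ y X) • proj10 g F θ y (Y y)) +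
      star (tanProj g F θ y (covDeriv (chernConn g F)
          (fun x => pushProj g F θ x (star (Y x))) y (star X)) -
        (Complex.I * normalSq g F θ y * thetaC θ y (star X)) • proj10 g F θ y (star (Y y))) +
      dC (fun x => thetaC θ x (Y x)) y X • reebC θ y := by
  have hp : DifferentiableAt ℝ (pushProj g F θ) y :=
    (hM.contDiffAt_pushProj hy).differentiableAt (by simp)
  have hθ : DifferentiableAt ℝ (thetaC θ) y :=
    (contDiffAt_thetaC (hM.contDiffAt_form hy)).differentiableAt (by simp)
  have hY' : DifferentiableAt ℝ (fun x => star (Y x)) y :=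
    (starL' ℝ : CVec (2 * n + 1) ≃L[ℝ] CVec (2 * n + 1)).differentiableAt.comp y hY
  have hpp : ∀ Z, tanProj g F θ y (pushProj g F θ y Z) = proj10 g F θ y Z := fun Z =>
    hM.tanProj_dC hy (hM.proj10_mem hy Z)
  have hdec := hM.decomposition hy (dC Y y X)
  have e₁ : ∀ Z, tanProj g F θ y (dC F y Z) = proj10 g F θ y Z := fun Z => rfl
  rw [e₁, e₁] at hdec
  simp only [covDeriv]
  rw [dC_clm_apply hp hY, dC_clm_apply hp hY', dC_clm_apply hθ hY, dC_star, star_star,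
    twForm_apply, twForm10_apply, twForm10_apply]
  simp only [map_add, hpp, star_add, star_sub, add_smul]
  conv_lhs => rw [← hdec]
  abel

/-- On sections of `T^{1,0}M` the Tanaka–Webster derivative is, up to a multiple of the section,
the tangential part of the Chern derivative. -/
lemma covDeriv_twForm_section {W : RVec (2 * n + 1) → CVec (2 * n + 1)}
    (hW : ContDiffAt ℝ ∞ W y) (hW' : ∀ᶠ x in 𝓝 y, W x ∈ T10 F x) (X : CVec (2 * n + 1)) :
    covDeriv (twForm g F θ) W y X =
      tanProj g F θ y (covDeriv (chernConn g F) (fun x => dC F x (W x)) y X) -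
        (Complex.I * normalSq g F θ y * thetaC θ y X) • W y := by
  have hU := hM.mem_nhds hy
  have e₁ : (fun x => pushProj g F θ x (W x)) =ᶠ[𝓝 y] fun x => dC F x (W x) := by
    filter_upwards [hU, hW'] with x hx hx'
    rw [pushProj, comp_apply, hM.proj10_of_mem hx hx', dCL_apply]
  have e₂ : (fun x => pushProj g F θ x (star (W x))) =ᶠ[𝓝 y] fun _ => 0 := by
    filter_upwards [hU, hW'] with x hx hx'
    rw [pushProj, comp_apply, proj10_star_of_mem g θ hx', map_zero]
  have e₃ : (fun x => thetaC θ x (W x)) =ᶠ[𝓝 y] fun _ => 0 := by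
    filter_upwards [hU, hW'] with x hx hx' using hM.thetaC_eq_zero hx hx'
  have hWy := hW'.self_of_nhds
  rw [hM.covDeriv_twForm hy (hW.differentiableAt (by simp)), covDeriv_congr e₁,
    covDeriv_congr e₂, dC_congr e₃, hM.proj10_of_mem hy hWy, proj10_star_of_mem g θ hWy]
  simp [covDeriv]

end IsLocalHypersurface

/-! ### Characterization of the Tanaka–Webster connection -/

section Sections

variable {m N : ℕ} {F : RVec m → CVec N} {y : RVec m} {W : RVec m → CVec m}

lemma differentiableAt_star {W : RVec m → CVec N} (hW : DifferentiableAt ℝ W y) :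
    DifferentiableAt ℝ (fun x => star (W x)) y :=
  (starL' ℝ : CVec N ≃L[ℝ] CVec N).differentiableAt.comp y hW

lemma covDeriv_chernConn_of_eq_zero (g : CVec N → Matrix (Fin N) (Fin N) ℂ) {s : RVec m → CVec N}
    {X : CVec m} (hX : dC F y X = 0) : covDeriv (chernConn g F) s y X = dC s y X := by
  simp [covDeriv, hX]

lemma dC_eq_zero_of_star_section (hW : ∀ x, W x ∈ T10 F x) (X : CVec m) :
    dC (fun x => dC F x (star (W x))) y X = 0 := by
  have : (fun x => dC F x (star (W x))) = fun _ => 0 := funext fun x => mem_T10_iff.1 (hW x)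
  rw [this, dC_const]

end Sections

namespace IsLocalHypersurface

variable {n : ℕ} {g : CVec (n + 1) → Matrix (Fin (n + 1)) (Fin (n + 1)) ℂ}
  {F : RVec (2 * n + 1) → CVec (n + 1)} {θ : RVec (2 * n + 1) → (RVec (2 * n + 1) →L[ℝ] ℝ)}
  {U : Set (RVec (2 * n + 1))} {V : Set (CVec (n + 1))}
  (hM : IsLocalHypersurface g F θ U V) {y : RVec (2 * n + 1)} (hy : y ∈ U)
  {A B W : RVec (2 * n + 1) → CVec (2 * n + 1)}
include hM hy

/-- The Chern connection is torsion free along `F`. -/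
lemma dC_bracket_eq (hA : DifferentiableAt ℝ A y) (hB : DifferentiableAt ℝ B y) :
    dC F y (bracket A B y) =
      covDeriv (chernConn g F) (fun x => dC F x (B x)) y (A y) -
        covDeriv (chernConn g F) (fun x => dC F x (A x)) y (B y) := by
  rw [dC_bracket (hM.contDiffAt_map hy) hA hB]
  simp only [covDeriv, chernConn_apply]
  rw [hM.kahler.chernGamma_comm (hM.mapsTo y hy)]
  abel

/-- The `ξ`-component of `∇̃_Z̄ W`. -/
lemma dC_section_star (hW : ContDiff ℝ ∞ W) (hW' : ∀ x, W x ∈ T10 F x) {Z : CVec (2 * n + 1)}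
    (hZ : Z ∈ T10 F y) :
    dC (fun x => dC F x (W x)) y (star Z) =
      dC F y (tanProj g F θ y (dC (fun x => dC F x (W x)) y (star Z))) +
        (Complex.I * levi θ y (W y) Z) • normalVec F θ y := by
  obtain ⟨B, hB, hB', rfl⟩ := hM.exists_section hy hZ
  have dW : DifferentiableAt ℝ W y := hW.contDiffAt.differentiableAt (by simp)
  have dB : DifferentiableAt ℝ B y := hB.contDiffAt.differentiableAt (by simp)
  have dB' := differentiableAt_star dB
  have e := dC_bracket (hM.contDiffAt_map hy) dB' dW
  rw [dC_eq_zero_of_star_section hB', sub_zero] at e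
  have t := thetaC_bracket (hM.contDiffAt_form hy) dB' dW
  have z₁ : (fun x => thetaC θ x (W x)) =ᶠ[𝓝 y] fun _ => 0 := by
    filter_upwards [hM.mem_nhds hy] with x hx using hM.thetaC_eq_zero hx (hW' x)
  have z₂ : (fun x => thetaC θ x (star (B x))) =ᶠ[𝓝 y] fun _ => 0 := by
    filter_upwards [hM.mem_nhds hy] with x hx using hM.thetaC_star_eq_zero hx (hB' x)
  rw [dC_congr z₁, dC_congr z₂, dC_const, dC_const, sub_zero, zero_sub] at t
  have hlevi : thetaC θ y (bracket (fun x => star (B x)) W y) =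
      Complex.I * levi θ y (W y) (B y) := by
    rw [t, levi, ← mul_assoc, mul_neg, Complex.I_mul_I, neg_neg, one_mul]
    simp only [bilC, dForm]
    push_cast
    ring
  rw [← hlevi, ← e]
  conv_lhs => rw [← hM.decomposition hy (bracket (fun x => star (B x)) W y)]
  rw [dC_add_dir, dC_add_dir, dC_smul_dir, mem_T10_iff.1 (hM.tanProj_mem hy _), add_zero]
  rfl

/-- `(∇̃_Z ξ)^⊤ = i |ξ|² Z`. -/
lemma tanProj_covDeriv_normalVec {Z : CVec (2 * n + 1)} (hZ : Z ∈ T10 F y) :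
    tanProj g F θ y (covDeriv (chernConn g F) (normalVec F θ) y Z) =
      (Complex.I * normalSq g F θ y) • Z := by
  have hF := hM.contDiffAt_map hy
  set a := covDeriv (chernConn g F) (normalVec F θ) y Z with ha
  -- it suffices to compare the scalar products with the vectors of `T^{1,0}M`
  have key : ∀ W ∈ T10 F y, herm (g (F y)) a (dC F y W) =
      Complex.I * normalSq g F θ y * herm (g (F y)) (dC F y Z) (dC F y W) := by
    intro W₀ hW₀
    obtain ⟨W, hW, hW', rfl⟩ := hM.exists_section hy hW₀
    have dW : ContDiffAt ℝ ∞ (fun x => dC F x (W x)) y :=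
      contDiffAt_clm_apply (contDiffAt_dCL hF) hW.contDiffAt
    have h := hM.kahler.dC_herm hF (hM.mapsTo y hy)
      ((hM.contDiffAt_normalVec hy).differentiableAt (by simp)) (dW.differentiableAt (by simp)) Z
    have z : (fun x => herm (g (F x)) (normalVec F θ x) (dC F x (W x))) =ᶠ[𝓝 y] fun _ => 0 := by
      filter_upwards [hM.mem_nhds hy] with x hx using hM.herm_normalVec hx (hW' x)
    rw [dC_congr z, dC_const, covDeriv_chernConn_of_eq_zero g (mem_T10_iff.1 hZ),
      hM.dC_section_star hy hW hW' hZ, herm_add_right, hM.herm_normalVec hy (hM.tanProj_mem hy _),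
      zero_add, herm_smul_right, ← normalSq, ← ha, star_mul',
      hM.levi_eq_herm_of_right hy _ hZ, hM.star_herm hy, Complex.star_def, Complex.conj_I] at h
    linear_combination -h
  have hmem : tanProj g F θ y a - (Complex.I * normalSq g F θ y) • Z ∈ T10 F y :=
    sub_mem (hM.tanProj_mem hy _) (Submodule.smul_mem _ _ hZ)
  have h0 : dC F y (tanProj g F θ y a - (Complex.I * normalSq g F θ y) • Z) = 0 := by
    refine hM.eq_zero_of_herm_self hy ?_
    conv_lhs =>
      arg 2
      rw [← dCL_apply, map_sub, map_smul]
    rw [herm_sub_left, herm_smul_left, dCL_apply, dCL_apply, hM.herm_dC_tanProj hy _ hmem,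
      key _ hmem, sub_self]
  exact sub_eq_zero.1 (hM.eq_zero_of_dC_eq_zero hy h0 (mem_T10_iff.1 hmem))

lemma covDeriv_twForm_reebC (X : CVec (2 * n + 1)) :
    covDeriv (twForm g F θ) (reebC θ) y X = 0 := by
  have hU := hM.mem_nhds hy
  have e₁ : (fun x => pushProj g F θ x (reebC θ x)) =ᶠ[𝓝 y] fun _ => 0 := by
    filter_upwards [hU] with x hx
    rw [pushProj, comp_apply, hM.proj10_reebC hx, map_zero]
  have e₃ : (fun x => thetaC θ x (reebC θ x)) =ᶠ[𝓝 y] fun _ => 1 := by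
    filter_upwards [hU] with x hx using hM.thetaC_reebC hx
  rw [hM.covDeriv_twForm hy ((hM.contDiffAt_reebC hy).differentiableAt (by simp))]
  simp only [star_reebC]
  rw [covDeriv_congr e₁, covDeriv_congr e₁, dC_congr e₃, hM.proj10_reebC hy]
  simp [covDeriv]

lemma twForm_preserves (hW : ContDiffAt ℝ ∞ W y) (hW' : ∀ᶠ x in 𝓝 y, W x ∈ T10 F x)
    (X : CVec (2 * n + 1)) : covDeriv (twForm g F θ) W y X ∈ T10 F y := by
  rw [hM.covDeriv_twForm_section hy hW hW']
  exact sub_mem (hM.tanProj_mem hy _) (Submodule.smul_mem _ _ hW'.self_of_nhds)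

lemma twForm_metric (hA : ContDiffAt ℝ ∞ A y) (hA' : ∀ᶠ x in 𝓝 y, A x ∈ T10 F x)
    (hB : ContDiffAt ℝ ∞ B y) (hB' : ∀ᶠ x in 𝓝 y, B x ∈ T10 F x) (X : CVec (2 * n + 1)) :
    dC (fun x => levi θ x (A x) (B x)) y X =
      levi θ y (covDeriv (twForm g F θ) A y X) (B y) +
        levi θ y (A y) (covDeriv (twForm g F θ) B y (star X)) := by
  have hF := hM.contDiffAt_map hy
  have e : (fun x => levi θ x (A x) (B x)) =ᶠ[𝓝 y]
      fun x => herm (g (F x)) (dC F x (A x)) (dC F x (B x)) := by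
    filter_upwards [hM.mem_nhds hy, hB'] with x hx hx' using hM.levi_eq_herm_of_right hx _ hx'
  have dA : ContDiffAt ℝ ∞ (fun x => dC F x (A x)) y :=
    contDiffAt_clm_apply (contDiffAt_dCL hF) hA
  have dB : ContDiffAt ℝ ∞ (fun x => dC F x (B x)) y :=
    contDiffAt_clm_apply (contDiffAt_dCL hF) hB
  have hAy := hA'.self_of_nhds
  have hBy := hB'.self_of_nhds
  rw [dC_congr e, hM.kahler.dC_herm hF (hM.mapsTo y hy) (dA.differentiableAt (by simp))
    (dB.differentiableAt (by simp)), hM.levi_eq_herm_of_right hy _ hBy,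
    hM.levi_eq_herm_of_left hy _ hAy, hM.covDeriv_twForm_section hy hA hA',
    hM.covDeriv_twForm_section hy hB hB']
  simp only [← dCL_apply, map_sub, map_smul]
  simp only [dCL_apply, herm_sub_left, herm_sub_right, herm_smul_left, herm_smul_right]
  rw [hM.herm_dC_tanProj hy _ hBy, hM.herm_dC_tanProj_right hy _ hAy, thetaC_star]
  simp only [star_mul', hM.star_normalSq hy, Complex.star_def, Complex.conj_I]
  simp only [← Complex.star_def, star_star]
  ring

lemma twForm_torsion_20 {Z W : CVec (2 * n + 1)} (hZ : Z ∈ T10 F y) (hW : W ∈ T10 F y) :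
    torsion (twForm g F θ) y Z W = 0 := by
  obtain ⟨A, hA, hA', rfl⟩ := hM.exists_section hy hZ
  obtain ⟨B, hB, hB', rfl⟩ := hM.exists_section hy hW
  have dA : DifferentiableAt ℝ A y := hA.contDiffAt.differentiableAt (by simp)
  have dB : DifferentiableAt ℝ B y := hB.contDiffAt.differentiableAt (by simp)
  have hmem : bracket A B y ∈ T10 F y := by
    rw [mem_T10_iff, star_bracket, dC_bracket (hM.contDiffAt_map hy)
      (differentiableAt_star dA) (differentiableAt_star dB),
      dC_eq_zero_of_star_section hA', dC_eq_zero_of_star_section hB', sub_zero]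
  rw [torsion_eq_bracket, hM.covDeriv_twForm_section hy hA.contDiffAt (Eventually.of_forall hA'),
    hM.covDeriv_twForm_section hy hB.contDiffAt (Eventually.of_forall hB'),
    hM.thetaC_eq_zero hy hZ, hM.thetaC_eq_zero hy hW]
  simp only [mul_zero, zero_smul, sub_zero]
  rw [← map_sub, ← hM.dC_bracket_eq hy dA dB, hM.tanProj_dC hy hmem, sub_self]

lemma twForm_torsion_11 {Z W : CVec (2 * n + 1)} (hZ : Z ∈ T10 F y) (hW : W ∈ T10 F y) :
    torsion (twForm g F θ) y Z (star W) = (Complex.I * levi θ y Z W) • reebC θ y := by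
  obtain ⟨A, hA, hA', rfl⟩ := hM.exists_section hy hZ
  obtain ⟨B, hB, hB', rfl⟩ := hM.exists_section hy hW
  have hF := hM.contDiffAt_map hy
  have dA : DifferentiableAt ℝ A y := hA.contDiffAt.differentiableAt (by simp)
  have dB : DifferentiableAt ℝ B y := hB.contDiffAt.differentiableAt (by simp)
  have dA' := differentiableAt_star dA
  have dB' := differentiableAt_star dB
  set b := bracket A (fun x => star (B x)) y with hb
  have e₁ : dC F y b = -dC (fun x => dC F x (A x)) y (star (B y)) := by
    rw [hb, dC_bracket hF dA dB', dC_eq_zero_of_star_section hB', zero_sub]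
  have e₂ : dC F y (star b) = dC (fun x => dC F x (B x)) y (star (A y)) := by
    rw [hb, star_bracket]
    simp only [star_star]
    rw [dC_bracket hF dA' dB, dC_eq_zero_of_star_section hA', sub_zero]
  have t : thetaC θ y b = -(Complex.I * levi θ y (A y) (B y)) := by
    have z₁ : (fun x => thetaC θ x (A x)) =ᶠ[𝓝 y] fun _ => 0 := by
      filter_upwards [hM.mem_nhds hy] with x hx using hM.thetaC_eq_zero hx (hA' x)
    have z₂ : (fun x => thetaC θ x (star (B x))) =ᶠ[𝓝 y] fun _ => 0 := by
      filter_upwards [hM.mem_nhds hy] with x hx using hM.thetaC_star_eq_zero hx (hB' x)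
    rw [hb, thetaC_bracket (hM.contDiffAt_form hy) dA dB', dC_congr z₁, dC_congr z₂, dC_const,
      dC_const, levi, ← mul_assoc, mul_neg, Complex.I_mul_I, neg_neg, one_mul, sub_zero, zero_sub]
  have hdec := hM.decomposition hy b
  rw [e₁, e₂, t, map_neg, neg_smul] at hdec
  have hstar := hM.star_twForm hy
  have h := torsion_eq_bracket (twForm g F θ) A (fun x => star (B x)) y
  rw [covDeriv_star hstar, hM.covDeriv_twForm_section hy hA.contDiffAt (Eventually.of_forall hA'),
    hM.covDeriv_twForm_section hy hB.contDiffAt (Eventually.of_forall hB'),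
    hM.thetaC_star_eq_zero hy hZ, hM.thetaC_star_eq_zero hy hW, ← hb,
    covDeriv_chernConn_of_eq_zero g (mem_T10_iff.1 hZ),
    covDeriv_chernConn_of_eq_zero g (mem_T10_iff.1 hW)] at h
  simp only [mul_zero, zero_smul, sub_zero] at h
  rw [h]
  conv_lhs => rw [← hdec]
  abel

/-- The pseudohermitian torsion in terms of the normal direction: `τ Z̄ = (∇̃_Z̄ ξ)^⊤`. -/
lemma star_torsion_reebC {Z : CVec (2 * n + 1)} (hZ : Z ∈ T10 F y) :
    star (torsion (twForm g F θ) y (reebC θ y) Z) =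
      tanProj g F θ y (dC (normalVec F θ) y (star Z)) ∧
    dC F y (tanProj g F θ y (dC (normalVec F θ) y (star Z))) = dC (normalVec F θ) y (star Z) := by
  obtain ⟨A, hA, hA', rfl⟩ := hM.exists_section hy hZ
  have hF := hM.contDiffAt_map hy
  have dA : DifferentiableAt ℝ A y := hA.contDiffAt.differentiableAt (by simp)
  have dA' := differentiableAt_star dA
  have dT : DifferentiableAt ℝ (reebC θ) y := (hM.contDiffAt_reebC hy).differentiableAt (by simp)
  set b := bracket (reebC θ) A y with hb
  have e₁ : dC F y (star b) = -dC (normalVec F θ) y (star (A y)) := by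
    rw [hb, star_bracket]
    simp only [star_reebC]
    rw [dC_bracket hF dT dA', dC_eq_zero_of_star_section hA', zero_sub]
    rfl
  have e₂ : tanProj g F θ y (dC F y b) = tanProj g F θ y
      (covDeriv (chernConn g F) (fun x => dC F x (A x)) y (reebC θ y)) -
        (Complex.I * normalSq g F θ y) • A y := by
    rw [hb, hM.dC_bracket_eq hy dT dA, map_sub, ← hM.tanProj_covDeriv_normalVec hy hZ]
    rfl
  have t : thetaC θ y b = 0 := by
    have z₁ : (fun x => thetaC θ x (A x)) =ᶠ[𝓝 y] fun _ => 0 := by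
      filter_upwards [hM.mem_nhds hy] with x hx using hM.thetaC_eq_zero hx (hA' x)
    have z₂ : (fun x => thetaC θ x (reebC θ x)) =ᶠ[𝓝 y] fun _ => 1 := by
      filter_upwards [hM.mem_nhds hy] with x hx using hM.thetaC_reebC hx
    rw [hb, thetaC_bracket (hM.contDiffAt_form hy) dT dA, dC_congr z₁, dC_congr z₂, dC_const,
      dC_const, hM.bilC_reebC hy]
    simp
  have hdec := hM.decomposition hy b
  rw [e₁, t, zero_smul, add_zero, map_neg, star_neg] at hdec
  have h : torsion (twForm g F θ) y (reebC θ y) (A y) =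
      star (tanProj g F θ y (dC (normalVec F θ) y (star (A y)))) := by
    rw [torsion_eq_bracket, hM.covDeriv_twForm_reebC hy, hM.covDeriv_twForm_section hy
      hA.contDiffAt (Eventually.of_forall hA'), hM.thetaC_reebC hy, ← hb, mul_one, sub_zero, ← e₂]
    conv_lhs =>
      arg 2
      rw [← hdec]
    abel
  refine ⟨by rw [h, star_star], ?_⟩
  have hdec' := hM.decomposition hy (star b)
  have e₃ := congrArg (dC F y) hdec'
  rw [e₁, thetaC_star, t, star_zero, zero_smul, add_zero, dC_add_dir,
    mem_T10_iff.1 (hM.tanProj_mem hy _), add_zero, ← dCL_apply, map_neg, map_neg, dCL_apply,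
    neg_inj] at e₃
  exact e₃

omit hy in
/-- The connection form `twForm` is the Tanaka–Webster connection. -/
lemma isTanakaWebster : IsTanakaWebster F θ U (twForm g F θ) where
  smooth := fun y hy => (hM.contDiffAt_twForm hy).contDiffWithinAt
  real := fun y hy => hM.star_twForm hy
  preserves := fun W hW y hy X => hM.twForm_preserves hy (hW.1.contDiffAt (hM.mem_nhds hy))
    (by filter_upwards [hM.mem_nhds hy] with x hx using hW.2 x hx) X
  reeb_parallel := fun y hy => hM.covDeriv_twForm_reebC hy
  metric := fun A B hA hB y hy X => hM.twForm_metric hy (hA.1.contDiffAt (hM.mem_nhds hy))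
    (by filter_upwards [hM.mem_nhds hy] with x hx using hA.2 x hx)
    (hB.1.contDiffAt (hM.mem_nhds hy))
    (by filter_upwards [hM.mem_nhds hy] with x hx using hB.2 x hx) X
  torsion_20 := fun y hy Z hZ W hW => hM.twForm_torsion_20 hy hZ hW
  torsion_11 := fun y hy Z hZ W hW => hM.twForm_torsion_11 hy hZ hW
  torsion_reeb := fun y hy Z hZ => by
    rw [(hM.star_torsion_reebC hy hZ).1]
    exact hM.tanProj_mem hy _

/-- `T^{1,0}M ∩ T^{0,1}M = 0`. -/
lemma eq_zero_of_mem_of_star_mem {Z : CVec (2 * n + 1)} (hZ : Z ∈ T10 F y)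
    (hZ' : star Z ∈ T10 F y) : Z = 0 :=
  hM.eq_zero_of_dC_eq_zero hy (by simpa using mem_T10_iff.1 hZ') (mem_T10_iff.1 hZ)

/-- Uniqueness of the Tanaka–Webster connection: the difference of two such connections is a
tensor which preserves the type and has no torsion, hence vanishes. -/
lemma tanakaWebster_unique {U₁ U₂ : Set (RVec (2 * n + 1))} {Γ₁ Γ₂ : Christoffel (2 * n + 1)}
    (h₁ : IsTanakaWebster F θ U₁ Γ₁) (h₂ : IsTanakaWebster F θ U₂ Γ₂) (hy₁ : y ∈ U₁)
    (hy₂ : y ∈ U₂) : Γ₁ y = Γ₂ y := by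
  let S : CVec (2 * n + 1) → CVec (2 * n + 1) → CVec (2 * n + 1) := fun X Y => Γ₁ y X Y - Γ₂ y X Y
  have hSadd : ∀ X Y Y', S X (Y + Y') = S X Y + S X Y' := fun X Y Y' => by
    simp only [S, map_add]; abel
  have hSsmul : ∀ X (c : ℂ) Y, S X (c • Y) = c • S X Y := fun X c Y => by
    simp only [S, map_smul, smul_sub]
  have hSadd' : ∀ X X' Y, S (X + X') Y = S X Y + S X' Y := fun X X' Y => by
    simp only [S, map_add, add_apply]; abel
  have hSsmul' : ∀ (c : ℂ) X Y, S (c • X) Y = c • S X Y := fun c X Y => by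
    simp only [S, map_smul, smul_apply, smul_sub]
  have hstar : ∀ X Y, star (S X Y) = S (star X) (star Y) := fun X Y => by
    simp only [S, star_sub, h₁.real y hy₁, h₂.real y hy₂]
  have hsec : ∀ {W : RVec (2 * n + 1) → CVec (2 * n + 1)}, ContDiff ℝ ∞ W →
      (∀ x, W x ∈ T10 F x) → ∀ U', IsSection10 F U' W := fun hW hW' U' =>
    ⟨hW.contDiffOn, fun x _ => hW' x⟩
  have hScov : ∀ (W : RVec (2 * n + 1) → CVec (2 * n + 1)) X,
      cov Γ₁ W y X = cov Γ₂ W y X + S X (W y) := fun W X => by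
    simp only [cov, S]; abel
  have hmem : ∀ X, ∀ Z ∈ T10 F y, S X Z ∈ T10 F y := by
    intro X Z hZ
    obtain ⟨W, hW, hW', rfl⟩ := hM.exists_section hy hZ
    have h := sub_mem (h₁.preserves W (hsec hW hW' _) y hy₁ X)
      (h₂.preserves W (hsec hW hW' _) y hy₂ X)
    rwa [hScov, add_sub_cancel_left] at h
  have hT : ∀ X, S X (reebC θ y) = 0 := by
    intro X
    have h := hScov (reebC θ) X
    rw [h₁.reeb_parallel y hy₁, h₂.reeb_parallel y hy₂, zero_add] at h
    exact h.symm
  -- the torsions of type (1,1) agree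
  have h11 : ∀ Z ∈ T10 F y, ∀ W ∈ T10 F y, S (star W) Z = 0 := by
    intro Z hZ W hW
    have h : S Z (star W) = S (star W) Z := by
      have := (h₁.torsion_11 y hy₁ Z hZ W hW).trans (h₂.torsion_11 y hy₂ Z hZ W hW).symm
      simp only [torsion] at this
      simp only [S]
      linear_combination this
    refine hM.eq_zero_of_mem_of_star_mem hy (hmem _ _ hZ) ?_
    rw [← h, hstar, star_star]
    exact hmem _ _ hW
  have h20 : ∀ Z ∈ T10 F y, ∀ W ∈ T10 F y, S Z W = 0 := by
    intro Z hZ W hW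
    obtain ⟨A, hA, hA', rfl⟩ := hM.exists_section hy hW
    have hS := hmem Z _ hW
    obtain ⟨B, hB, hB', hBy⟩ := hM.exists_section hy hS
    have e₁ := h₁.metric A B (hsec hA hA' _) (hsec hB hB' _) y hy₁ Z
    have e₂ := h₂.metric A B (hsec hA hA' _) (hsec hB hB' _) y hy₂ Z
    have hBT : B y ∈ T10 F y := hB' y
    rw [hM.levi_eq_herm_of_right hy _ hBT, hM.levi_eq_herm_of_left hy _ hW] at e₁ e₂
    rw [hScov, hScov, h11 (B y) hBT Z hZ, add_zero, dC_add_dir, herm_add_left, e₂] at e₁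
    have e₃ : herm (g (F y)) (dC F y (S Z (A y))) (dC F y (S Z (A y))) = 0 := by
      rw [hBy] at e₁
      linear_combination -e₁
    exact hM.eq_zero_of_dC_eq_zero hy (hM.eq_zero_of_herm_self hy e₃) (mem_T10_iff.1 hS)
  have hTZ : ∀ Z ∈ T10 F y, S (reebC θ y) Z = 0 := by
    intro Z hZ
    have h := sub_mem (h₁.torsion_reeb y hy₁ Z hZ) (h₂.torsion_reeb y hy₂ Z hZ)
    rw [← star_sub] at h
    have e : torsion Γ₁ y (reebC θ y) Z - torsion Γ₂ y (reebC θ y) Z =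
        S (reebC θ y) Z - S Z (reebC θ y) := by
      simp only [torsion, S]
      abel
    rw [e, hT, sub_zero] at h
    exact hM.eq_zero_of_mem_of_star_mem hy (hmem _ _ hZ) h
  have hX : ∀ X, ∀ Z ∈ T10 F y, S X Z = 0 := by
    intro X Z hZ
    obtain ⟨A, hA, B, hB, h⟩ := hM.exists_decomposition hy X
    rw [h, hSadd', hSadd', hSsmul', h20 A hA Z hZ, h11 Z hZ B hB, hTZ Z hZ]
    simp
  refine ContinuousLinearMap.ext fun X => ContinuousLinearMap.ext fun Y => ?_
  obtain ⟨A, hA, B, hB, h⟩ := hM.exists_decomposition hy Y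
  have hSB : S X (star B) = 0 := by
    have := hstar (star X) B
    rw [star_star, hX _ B hB, star_zero] at this
    exact this.symm
  have hSY : S X Y = 0 := by
    rw [h, hSadd, hSadd, hSsmul, hX X A hA, hSB, hT]
    simp
  exact sub_eq_zero.1 hSY

lemma twConn_eventuallyEq : twConn F θ y =ᶠ[𝓝 y] twForm g F θ := by
  have hex : ∃ Γ U, IsOpen U ∧ y ∈ U ∧ IsTanakaWebster F θ U Γ :=
    ⟨twForm g F θ, U, hM.isOpen, hy, hM.isTanakaWebster⟩
  obtain ⟨U', hU', hyU', h⟩ := Classical.epsilon_spec hex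
  filter_upwards [hU'.mem_nhds hyU', hM.mem_nhds hy] with x hx hx'
  exact hM.tanakaWebster_unique hx' h hM.isTanakaWebster hx hx'

lemma twConn_self : twConn F θ y y = twForm g F θ y := (hM.twConn_eventuallyEq hy).self_of_nhds

lemma curv_twConn (X Y Z : CVec (2 * n + 1)) :
    curv (twConn F θ y) y X Y Z = curvForm (twForm g F θ) y X Y Z := by
  simp only [curv, curvForm, dC_congr (hM.twConn_eventuallyEq hy), hM.twConn_self hy]

end IsLocalHypersurface

/-! ### The second fundamental form -/

/-- The `(1,0)`-component of the second fundamental form. -/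
noncomputable def secondFF10 {m N : ℕ} (g : CVec N → Matrix (Fin N) (Fin N) ℂ)
    (F : RVec m → CVec N) (θ : RVec m → (RVec m →L[ℝ] ℝ)) (y : RVec m) (X Y : CVec m) : CVec N :=
  dC (dCL F) y X Y + chernConn g F y X (dC F y Y) - dC F y (twForm g F θ y X Y)

/-- The scalar `⟨τ Z, W⟩`, where `τ Z` is expressed as the conjugate of `∇̃_Z̄ ξ`; for `Z` of type
`(1,0)` the latter is a plain derivative, as the Chern connection has type `(1,0)`. -/
noncomputable def torsionForm {m N : ℕ} (g : CVec N → Matrix (Fin N) (Fin N) ℂ)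
    (F : RVec m → CVec N) (θ : RVec m → (RVec m →L[ℝ] ℝ)) (y : RVec m) (Z W : CVec m) : ℂ :=
  herm (g (F y)) (dC F y W) (dC (normalVec F θ) y (star Z))

/-- The scalar product is given as a core, so that it need not agree with a norm that `E`
carries already. -/
lemma exists_basis_core_inner {E : Type*} [AddCommGroup E] [Module ℂ E] [FiniteDimensional ℂ E]
    (core : InnerProductSpace.Core ℂ E) {k : ℕ} (hk : Module.finrank ℂ E = k) :
    ∃ b : Module.Basis (Fin k) ℂ E, ∀ i j, core.inner (b i) (b j) = if i = j then 1 else 0 := by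
  let _ : NormedAddCommGroup E := core.toNormedAddCommGroup
  let _ : InnerProductSpace ℂ E := InnerProductSpace.ofCore core.toCore
  let b := (stdOrthonormalBasis ℂ E).reindex (finCongr hk)
  refine ⟨b.toBasis, fun i j => ?_⟩
  have h := orthonormal_iff_ite.1 b.orthonormal i j
  rw [b.coe_toBasis]
  exact h

namespace IsLocalHypersurface

variable {n : ℕ} {g : CVec (n + 1) → Matrix (Fin (n + 1)) (Fin (n + 1)) ℂ}
  {F : RVec (2 * n + 1) → CVec (n + 1)} {θ : RVec (2 * n + 1) → (RVec (2 * n + 1) →L[ℝ] ℝ)}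
  {U : Set (RVec (2 * n + 1))} {V : Set (CVec (n + 1))}
  (hM : IsLocalHypersurface g F θ U V) {y : RVec (2 * n + 1)} (hy : y ∈ U)
include hM hy

lemma secondFF_eq (X Y : CVec (2 * n + 1)) :
    secondFF g F θ y X Y =
      (secondFF10 g F θ y X Y, star (secondFF10 g F θ y (star X) (star Y))) := by
  have hF := hM.contDiffAt_map hy
  have hd : DifferentiableAt ℝ (dCL F) y := (contDiffAt_dCL hF).differentiableAt (by simp)
  have e : ∀ X Y, dC (fun x => dC F x Y) y X = dC (dCL F) y X Y := fun X Y =>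
    dC_clm_const hd Y X
  have e₂ : ∀ x Z, (push F x Z).2 = star (dC F x (star Z)) := fun x Z => dC_star F x Z
  refine Prod.ext ?_ ?_
  · simp only [secondFF, chernAlong, Prod.fst_sub, hM.twConn_self hy, secondFF10,
      chernConn_apply]
    rw [← e]
    rfl
  · simp only [secondFF, chernAlong, Prod.snd_sub, hM.twConn_self hy, secondFF10, e₂,
      chernConn_apply, star_star]
    rw [dC_star, e, hM.star_twForm hy, star_sub, star_add]

lemma secondFF10_section {W : RVec (2 * n + 1) → CVec (2 * n + 1)}
    (hW : DifferentiableAt ℝ W y) (X : CVec (2 * n + 1)) :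
    secondFF10 g F θ y X (W y) = covDeriv (chernConn g F) (fun x => dC F x (W x)) y X -
      dC F y (covDeriv (twForm g F θ) W y X) := by
  simp only [covDeriv, secondFF10, dC_dC_apply (hM.contDiffAt_map hy) hW, dC_add_dir]
  abel

omit hM hy in
lemma secondFF10_add_left (X X' Y : CVec (2 * n + 1)) :
    secondFF10 g F θ y (X + X') Y = secondFF10 g F θ y X Y + secondFF10 g F θ y X' Y := by
  simp only [secondFF10, dC_add_dir, map_add, add_apply]
  abel

omit hM hy in
lemma secondFF10_add_right (X Y Y' : CVec (2 * n + 1)) :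
    secondFF10 g F θ y X (Y + Y') = secondFF10 g F θ y X Y + secondFF10 g F θ y X Y' := by
  simp only [secondFF10, map_add, dC_add_dir]
  abel

lemma secondFF10_star_right (X : CVec (2 * n + 1)) {Z : CVec (2 * n + 1)} (hZ : Z ∈ T10 F y) :
    secondFF10 g F θ y X (star Z) = 0 := by
  obtain ⟨W, hW, hW', rfl⟩ := hM.exists_section hy hZ
  have dW : DifferentiableAt ℝ W y := hW.contDiffAt.differentiableAt (by simp)
  have e : (fun x => dC F x (star (W x))) = fun _ => 0 := funext fun x => mem_T10_iff.1 (hW' x)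
  have h := hM.secondFF10_section hy (differentiableAt_star dW) X
  rw [e, covDeriv_star (hM.star_twForm hy), mem_T10_iff.1 (hM.twForm_preserves hy
    hW.contDiffAt (Eventually.of_forall hW') _)] at h
  rw [h]
  simp [covDeriv]

/-- `II(W̄, Z) = i ⟨Z, W̄⟩ ξ`. -/
lemma secondFF10_star_left {Z W : CVec (2 * n + 1)} (hZ : Z ∈ T10 F y) (hW : W ∈ T10 F y) :
    secondFF10 g F θ y (star W) Z = (Complex.I * levi θ y Z W) • normalVec F θ y := by
  obtain ⟨A, hA, hA', rfl⟩ := hM.exists_section hy hZ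
  rw [hM.secondFF10_section hy (hA.contDiffAt.differentiableAt (by simp)),
    hM.covDeriv_twForm_section hy hA.contDiffAt (Eventually.of_forall hA'),
    covDeriv_chernConn_of_eq_zero g (mem_T10_iff.1 hW), hM.thetaC_star_eq_zero hy hW, mul_zero,
    zero_smul, sub_zero, sub_eq_iff_eq_add']
  exact hM.dC_section_star hy hA hA' hW

/-- `II(W, Z) = -(⟨τ W, Z⟩ / |ξ|²) ξ`. -/
lemma secondFF10_eq {Z W : CVec (2 * n + 1)} (hZ : Z ∈ T10 F y) (hW : W ∈ T10 F y) :
    secondFF10 g F θ y W Z =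
      (-torsionForm g F θ y W Z / normalSq g F θ y) • normalVec F θ y := by
  obtain ⟨A, hA, hA', rfl⟩ := hM.exists_section hy hZ
  have hF := hM.contDiffAt_map hy
  have dA : ContDiffAt ℝ ∞ (fun x => dC F x (A x)) y :=
    contDiffAt_clm_apply (contDiffAt_dCL hF) hA.contDiffAt
  have z : (fun x => herm (g (F x)) (dC F x (A x)) (normalVec F θ x)) =ᶠ[𝓝 y] fun _ => 0 := by
    filter_upwards [hM.mem_nhds hy] with x hx using hM.herm_normalVec_right hx (hA' x)
  have h := hM.kahler.dC_herm hF (hM.mapsTo y hy) (dA.differentiableAt (by simp))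
    ((hM.contDiffAt_normalVec hy).differentiableAt (by simp)) W
  rw [dC_congr z, dC_const, covDeriv_chernConn_of_eq_zero g (mem_T10_iff.1 hW)] at h
  rw [hM.secondFF10_section hy (hA.contDiffAt.differentiableAt (by simp)),
    hM.covDeriv_twForm_section hy hA.contDiffAt (Eventually.of_forall hA'),
    hM.thetaC_eq_zero hy hW, mul_zero, zero_smul, sub_zero, hM.dC_tanProj hy, sub_sub_cancel,
    torsionForm, ← eq_neg_of_add_eq_zero_left h.symm]

/-! ### The mean curvature -/

/-- `T^{1,0}M` is the kernel of the differential of `F̄`, which maps `ℂTM` onto `ℂ^{n+1}`. -/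
lemma finrank_T10 : Module.finrank ℂ (T10 F y) = n := by
  let L := dCL (fun x => star (F x)) y
  have hL : ∀ Z, L Z = star (dC F y (star Z)) := fun Z => dC_star F y Z
  have hker : T10 F y = LinearMap.ker L.toLinearMap := rfl
  have hsurj : LinearMap.range L.toLinearMap = ⊤ := by
    refine LinearMap.range_eq_top.2 fun a => ?_
    obtain ⟨Z, hZ⟩ := hM.dC_surjective hy (star a)
    refine ⟨star Z, (hL _).trans ?_⟩
    rw [star_star, ← dCL_apply, hZ, star_star]
  have h := LinearMap.finrank_range_add_finrank_ker L.toLinearMap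
  rw [hsurj, finrank_top] at h
  simp only [Module.finrank_fintype_fun_eq_card, Fintype.card_fin] at h
  rw [hker]
  omega

lemma exists_unitaryBasis : ∃ e : Fin n → CVec (2 * n + 1), IsUnitaryBasis F θ y e := by
  let core : InnerProductSpace.Core ℂ (T10 F y) :=
    { inner := fun Z W => herm (g (F y)) (dC F y W) (dC F y Z)
      conj_inner_symm := fun Z W => hM.star_herm hy _ _
      re_inner_nonneg := fun Z => by
        by_cases hZ : dC F y (Z : CVec (2 * n + 1)) = 0
        · simp [hZ]
        · exact (hM.herm_pos hy hZ).le
      add_left := fun Z W Z' => by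
        simp only [Submodule.coe_add, dC_add_dir, herm_add_right]
      smul_left := fun Z W c => by
        simp only [Submodule.coe_smul, dC_smul_dir, herm_smul_right]
        rfl
      definite := fun Z hZ => Subtype.ext (hM.eq_zero_of_dC_eq_zero hy
        (hM.eq_zero_of_herm_self hy hZ) (mem_T10_iff.1 Z.2)) }
  obtain ⟨b, hb⟩ := exists_basis_core_inner core (hM.finrank_T10 hy)
  refine ⟨fun α => (b α : CVec (2 * n + 1)), ?_, fun α β => ?_⟩
  · have h := congrArg (Submodule.map (T10 F y).subtype) b.span_eq
    rw [Submodule.map_span, Submodule.map_top, Submodule.range_subtype, ← Set.range_comp] at h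
    exact h
  · rw [hM.levi_eq_herm_of_right hy _ (b β).2]
    have h := hb β α
    simp only [eq_comm (a := β)] at h
    exact h

lemma unitaryBasis_spec : IsUnitaryBasis F θ y (unitaryBasis n F θ y) :=
  Classical.epsilon_spec (hM.exists_unitaryBasis hy)

/-- The mean curvature vector is `H = i ξ`. -/
lemma meanCurv_eq (hn : 1 ≤ n) :
    meanCurv n g F θ y = (Complex.I • normalVec F θ y, 0) := by
  obtain ⟨hspan, horth⟩ := hM.unitaryBasis_spec hy
  have hmem : ∀ α, unitaryBasis n F θ y α ∈ T10 F y := fun α => by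
    rw [← hspan]
    exact Submodule.subset_span ⟨α, rfl⟩
  have h : ∀ α, secondFF g F θ y (star (unitaryBasis n F θ y α)) (unitaryBasis n F θ y α) =
      (Complex.I • normalVec F θ y, 0) := by
    intro α
    rw [hM.secondFF_eq hy, hM.secondFF10_star_left hy (hmem α) (hmem α), star_star,
      hM.secondFF10_star_right hy _ (hmem α), horth, if_pos rfl, mul_one, star_zero]
  simp only [meanCurv, h, Finset.sum_const, Finset.card_univ, Fintype.card_fin]
  have hn' : (n : ℂ) ≠ 0 := Nat.cast_ne_zero.2 (by omega)
  rw [← Nat.cast_smul_eq_nsmul ℂ, smul_smul, one_div, inv_mul_cancel₀ hn', one_smul]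

lemma normSqT_meanCurv (hn : 1 ≤ n) :
    normSqT (g (F y)) (meanCurv n g F θ y) = (normalSq g F θ y).re := by
  rw [hM.meanCurv_eq hy hn]
  simp only [normSqT, pairT, conjT, star_star, star_zero, herm_zero_right, add_zero,
    herm_smul_left, herm_smul_right, Complex.star_def, Complex.conj_I]
  rw [← mul_assoc, neg_mul, Complex.I_mul_I, neg_neg, one_mul]
  rfl

lemma muVec_eq (hn : 1 ≤ n) :
    muVec n g F θ y = ((1 / 2 : ℂ) • Complex.I • normalVec F θ y,
      (1 / 2 : ℂ) • star (Complex.I • normalVec F θ y)) := by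
  rw [muVec, hM.meanCurv_eq hy hn]
  simp [conjT, Prod.smul_mk]

lemma secTorsion_eq {Z : CVec (2 * n + 1)} (hZ : Z ∈ T10 F y) :
    secTorsion F θ y Z = Complex.I * torsionForm g F θ y Z Z / levi θ y Z Z := by
  obtain ⟨h₁, h₂⟩ := hM.star_torsion_reebC hy hZ
  have h : star (tau F θ y Z) = tanProj g F θ y (dC (normalVec F θ) y (star Z)) := by
    rw [← h₁, tau]
    simp only [torsion, hM.twConn_self hy]
  rw [secTorsion, hM.levi_eq_herm_of_left hy _ hZ, h, h₂, torsionForm]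

lemma levi_self_re {Z : CVec (2 * n + 1)} (hZ : Z ∈ T10 F y) :
    levi θ y Z Z = ((levi θ y Z Z).re : ℂ) := by
  rw [hM.levi_eq_herm_of_left hy _ hZ]
  exact (Complex.conj_eq_iff_re.1 (hM.star_herm hy _ _)).symm

lemma levi_self_pos {Z : CVec (2 * n + 1)} (hZ : Z ∈ T10 F y) (hne : Z ≠ 0) :
    0 < (levi θ y Z Z).re := by
  rw [hM.levi_eq_herm_of_left hy _ hZ]
  exact hM.herm_pos hy (hM.dC_ne_zero hy hZ hne)

/-- The scalar second fundamental form on `Z + Z̄` is `|Z|² (Re A(Z) + |H|²)` up to the positive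
factor `1 / |μ|`. -/
lemma scalarFF_eq (hn : 1 ≤ n) {Z : CVec (2 * n + 1)} (hZ : Z ∈ T10 F y) (hne : Z ≠ 0) :
    scalarFF n g F θ y (Z + star Z) (Z + star Z) =
      (levi θ y Z Z).re * ((secTorsion F θ y Z).re + (normalSq g F θ y).re) /
        Real.sqrt ((normalSq g F θ y).re / 2) := by
  have hκ := hM.normalSq_ne_zero hy
  have hl := hM.levi_self_re hy hZ
  have hl0 : levi θ y Z Z ≠ 0 := fun h => by
    have := hM.levi_self_pos hy hZ hne
    rw [h] at this
    simp at this
  have hstar : star (Z + star Z) = Z + star Z := by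
    rw [star_add, star_star]
    exact add_comm _ _
  have e : secondFF10 g F θ y (Z + star Z) (Z + star Z) =
      (-torsionForm g F θ y Z Z / normalSq g F θ y + Complex.I * levi θ y Z Z) •
        normalVec F θ y := by
    rw [secondFF10_add_right, hM.secondFF10_star_right hy _ hZ, add_zero, secondFF10_add_left,
      hM.secondFF10_eq hy hZ hZ, hM.secondFF10_star_left hy hZ hZ, add_smul]
  have hnum : (pairT (g (F y)) (secondFF g F θ y (Z + star Z) (Z + star Z))
      (muVec n g F θ y)).re =
      (levi θ y Z Z).re * ((secTorsion F θ y Z).re + (normalSq g F θ y).re) := by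
    set a := secondFF10 g F θ y (Z + star Z) (Z + star Z) with ha
    have h₁ : pairT (g (F y)) (secondFF g F θ y (Z + star Z) (Z + star Z)) (muVec n g F θ y) =
        (1 / 2 : ℂ) * (herm (g (F y)) a (Complex.I • normalVec F θ y) +
          star (herm (g (F y)) a (Complex.I • normalVec F θ y))) := by
      rw [hM.secondFF_eq hy, hM.muVec_eq hy hn, hstar, ← ha, hM.star_herm hy]
      simp only [pairT, star_star, star_smul, herm_smul_left, herm_smul_right]
      ring
    have h₂ : herm (g (F y)) a (Complex.I • normalVec F θ y) =
        levi θ y Z Z * (secTorsion F θ y Z + normalSq g F θ y) := by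
      rw [e, herm_smul_left, herm_smul_right, ← normalSq, hM.secTorsion_eq hy hZ,
        Complex.star_def, Complex.conj_I]
      field_simp
      linear_combination (-(levi θ y Z Z) * normalSq g F θ y) * Complex.I_sq
    rw [h₁, Complex.star_def, Complex.add_conj, h₂, hl, Complex.re_ofReal_mul]
    simp only [Complex.ofReal_re, Complex.add_re]
    push_cast
    rw [one_div, inv_mul_cancel_left₀ two_ne_zero]
    norm_cast
  have hden : normSqT (g (F y)) (muVec n g F θ y) = (normalSq g F θ y).re / 2 := by
    rw [hM.muVec_eq hy hn]
    simp only [normSqT, pairT, conjT, star_smul, star_star, herm_smul_left, herm_smul_right]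
    rw [← normalSq, hM.normalSq_eq_re hy]
    simp
    ring
  rw [scalarFF, hnum, hden]

/-! ### The Gauss equation -/

/-- The Gauss equation for the Tanaka–Webster and Chern curvatures:
`⟨R(Z, Z̄)Z, Z̄⟩ = ⟨R̃(Z, Z̄)Z, Z̄⟩ + 2 |H|² |Z|⁴ - |⟨τZ, Z⟩|² / |H|²`. -/
lemma levi_curvForm {Z : CVec (2 * n + 1)} (hZ : Z ∈ T10 F y) :
    levi θ y (curvForm (twForm g F θ) y Z (star Z) Z) Z =
      herm (g (F y)) (chernCurv g (F y) (dC F y Z) (dC F y Z) (dC F y Z)) (dC F y Z) +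
        2 * normalSq g F θ y * levi θ y Z Z ^ 2 -
        torsionForm g F θ y Z Z * star (torsionForm g F θ y Z Z) / normalSq g F θ y := by
  obtain ⟨W, hW, hW', hWy⟩ := hM.exists_section hy hZ
  have hF := hM.contDiffAt_map hy
  have hx := hM.mapsTo y hy
  have h𝒢 := hM.kahler.contDiffAt_chernConn hF hx
  have hθ := contDiffAt_thetaC (hM.contDiffAt_form hy)
  have dW : ∀ x ∈ U, ContDiffAt ℝ ∞ (fun x => dC F x (W x)) x := fun x hx =>
    contDiffAt_clm_apply (contDiffAt_dCL (hM.contDiffAt_map hx)) hW.contDiffAt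
  -- `S X = ∇_X W`, `D X = ∇̃_X W` and their difference `Nv X = II(X, W)`
  let S : CVec (2 * n + 1) → RVec (2 * n + 1) → CVec (2 * n + 1) := fun X x =>
    covDeriv (twForm g F θ) W x X
  let D : CVec (2 * n + 1) → RVec (2 * n + 1) → CVec (n + 1) := fun X x =>
    covDeriv (chernConn g F) (fun x => dC F x (W x)) x X
  let Nv : CVec (2 * n + 1) → RVec (2 * n + 1) → CVec (n + 1) := fun X x =>
    D X x - dC F x (S X x)
  have hS : ∀ X, ContDiffAt ℝ ∞ (S X) y := fun X =>
    contDiffAt_covDeriv (hM.contDiffAt_twForm hy) hW.contDiffAt X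
  have hS' : ∀ X, ∀ x ∈ U, S X x ∈ T10 F x := fun X x hx =>
    hM.twForm_preserves hx hW.contDiffAt (Eventually.of_forall hW') X
  have hS'' : ∀ X, ∀ᶠ x in 𝓝 y, S X x ∈ T10 F x := fun X => by
    filter_upwards [hM.mem_nhds hy] with x hx using hS' X x hx
  have hD : ∀ X, ContDiffAt ℝ ∞ (D X) y := fun X => contDiffAt_covDeriv h𝒢 (dW y hy) X
  have hFS : ∀ X, ContDiffAt ℝ ∞ (fun x => dC F x (S X x)) y := fun X =>
    contDiffAt_clm_apply (contDiffAt_dCL hF) (hS X)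
  have hNv : ∀ X, ContDiffAt ℝ ∞ (Nv X) y := fun X => (hD X).sub (hFS X)
  have hNv' : ∀ X, Nv X y = secondFF10 g F θ y X Z := fun X => by
    rw [← hWy, hM.secondFF10_section hy (hW.contDiffAt.differentiableAt (by simp))]
  -- the scalar product of `R(X, Y) W` with `W` for horizontal `X`
  have h₁ : ∀ X Y, thetaC θ y X = 0 →
      herm (g (F y)) (dC F y (covDeriv (twForm g F θ) (S Y) y X)) (dC F y Z) =
        herm (g (F y)) (covDeriv (chernConn g F) (D Y) y X) (dC F y Z) -
          herm (g (F y)) (covDeriv (chernConn g F) (Nv Y) y X) (dC F y Z) := by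
    intro X Y hX
    rw [hM.covDeriv_twForm_section hy (hS Y) (hS'' Y), hX, mul_zero, zero_smul, sub_zero,
      hM.herm_dC_tanProj hy _ hZ, ← herm_sub_left, ← covDeriv_sub
        ((hD Y).differentiableAt (by simp)) ((hNv Y).differentiableAt (by simp))]
    simp only [Nv, sub_sub_cancel]
  have h₂ : ∀ X Y (c : ℂ), thetaC θ y Y = 0 → Nv Y y = c • normalVec F θ y →
      herm (g (F y)) (covDeriv (chernConn g F) (Nv Y) y X) (dC F y Z) =
        Complex.I * normalSq g F θ y * dC (thetaC θ) y X Y * levi θ y Z Z -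
          herm (g (F y)) (Nv Y y) (Nv (star X) y) := by
    intro X Y c hY hc
    have hd := hM.kahler.dC_herm hF hx ((hNv Y).differentiableAt (by simp))
      ((dW y hy).differentiableAt (by simp)) X
    have e : (fun x => herm (g (F x)) (Nv Y x) (dC F x (W x))) =ᶠ[𝓝 y] fun x =>
        thetaC θ x Y * (Complex.I * normalSq g F θ x *
          herm (g (F x)) (dC F x (W x)) (dC F x (W x))) := by
      filter_upwards [hM.mem_nhds hy] with x hx
      simp only [Nv, S, D]
      rw [hM.covDeriv_twForm_section hx hW.contDiffAt (Eventually.of_forall hW'), herm_sub_left]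
      simp only [← dCL_apply, map_sub, map_smul]
      simp only [dCL_apply, herm_sub_left, herm_smul_left]
      rw [hM.herm_dC_tanProj hx _ (hW' x)]
      ring
    have hdθ : DifferentiableAt ℝ (fun x => thetaC θ x Y) y :=
      (contDiffAt_clm_apply hθ contDiffAt_const).differentiableAt (by simp)
    have hdr : DifferentiableAt ℝ (fun x => Complex.I * normalSq g F θ x *
        herm (g (F x)) (dC F x (W x)) (dC F x (W x))) y :=
      ((contDiffAt_const.mul (hM.contDiffAt_normalSq hy)).mul
        (hM.kahler.contDiffAt_herm hF hx (dW y hy) (dW y hy))).differentiableAt (by simp)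
    rw [dC_congr e, dC_mul hdθ hdr, hY, zero_mul, add_zero,
      dC_clm_const (hθ.differentiableAt (by simp)), hWy] at hd
    have e₂ : herm (g (F y)) (Nv Y y)
        (covDeriv (chernConn g F) (fun x => dC F x (W x)) y (star X)) =
        herm (g (F y)) (Nv Y y) (Nv (star X) y) := by
      have e₃ : covDeriv (chernConn g F) (fun x => dC F x (W x)) y (star X) =
          Nv (star X) y + dC F y (S (star X) y) := by
        simp only [Nv, D, sub_add_cancel]
      rw [e₃, herm_add_right, hc, herm_smul_left, herm_smul_left,
        hM.herm_normalVec hy (hS' _ y hy)]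
      ring
    rw [e₂] at hd
    rw [hM.levi_eq_herm_of_left hy _ hZ]
    linear_combination -hd
  have hθZ := hM.thetaC_eq_zero hy hZ
  have hθZ' := hM.thetaC_star_eq_zero hy hZ
  have hN₁ : Nv Z y = (-torsionForm g F θ y Z Z / normalSq g F θ y) • normalVec F θ y := by
    rw [hNv', hM.secondFF10_eq hy hZ hZ]
  have hN₂ : Nv (star Z) y = (Complex.I * levi θ y Z Z) • normalVec F θ y := by
    rw [hNv', hM.secondFF10_star_left hy hZ hZ]
  have hR := covDeriv_covDeriv_sub (hM.contDiffAt_twForm hy) hW.contDiffAt Z (star Z)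
  have hR' := covDeriv_covDeriv_sub h𝒢 (dW y hy) Z (star Z)
  rw [hWy] at hR hR'
  rw [hM.kahler.curvForm_chernConn hF hx (mem_T10_iff.1 hZ)] at hR'
  have hκ := hM.normalSq_ne_zero hy
  have hl : star (levi θ y Z Z) = levi θ y Z Z := by
    rw [hM.levi_eq_herm_of_left hy _ hZ, hM.star_herm hy]
  have hb : dC (thetaC θ) y Z (star Z) - dC (thetaC θ) y (star Z) Z =
      Complex.I * levi θ y Z Z := by
    rw [← bilC_dForm (hM.contDiffAt_form hy), levi, ← mul_assoc, mul_neg, Complex.I_mul_I,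
      neg_neg, one_mul]
  rw [← hR, hM.levi_eq_herm_of_right hy _ hZ, ← dCL_apply, map_sub, dCL_apply, dCL_apply,
    herm_sub_left, h₁ Z (star Z) hθZ, h₁ (star Z) Z hθZ', h₂ Z (star Z) _ hθZ' hN₂,
    h₂ (star Z) Z _ hθZ hN₁, star_star, hN₁, hN₂, ← hR', herm_sub_left]
  simp only [herm_smul_left, herm_smul_right, star_mul', star_div₀, star_neg,
    hM.star_normalSq hy, hl, D]
  rw [← normalSq]
  simp only [Complex.star_def, Complex.conj_I]
  field_simp
  linear_combination (-(Complex.I) * normalSq g F θ y ^ 2 * levi θ y Z Z) * hb -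
    2 * normalSq g F θ y ^ 2 * levi θ y Z Z ^ 2 * Complex.I_sq

/-- The relation between the holomorphic sectional curvatures:
`K(Z) = ½ K̃(Z) + |H|² - |A(Z)|² / (2 |H|²)`. -/
lemma twHSC_eq {Z : CVec (2 * n + 1)} (hZ : Z ∈ T10 F y) (hne : Z ≠ 0) :
    twHSC F θ y Z = 1 / 2 * kahlerHSC g (F y) (dC F y Z) + (normalSq g F θ y).re -
      ‖secTorsion F θ y Z‖ ^ 2 / (2 * (normalSq g F θ y).re) := by
  have hl := hM.levi_self_re hy hZ
  have hl0 := hM.levi_self_pos hy hZ hne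
  have hκ := hM.normalSq_eq_re hy
  have hκ0 := hM.normalSq_pos hy
  have hG := hM.levi_curvForm hy hZ
  rw [twHSC, hM.curv_twConn hy, hG, kahlerHSC, ← hM.levi_eq_herm_of_left hy Z hZ,
    hM.secTorsion_eq hy hZ]
  set l := (levi θ y Z Z).re
  set κ := (normalSq g F θ y).re
  set t := torsionForm g F θ y Z Z
  set r := herm (g (F y)) (chernCurv g (F y) (dC F y Z) (dC F y Z) (dC F y Z)) (dC F y Z)
  rw [hl, hκ, Complex.star_def, Complex.mul_conj]
  have e₁ : ‖Complex.I * t / (l : ℂ)‖ ^ 2 = Complex.normSq t / l ^ 2 := by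
    rw [norm_div, norm_mul, Complex.norm_I, one_mul, div_pow, Complex.sq_norm, Complex.norm_real,
      Real.norm_eq_abs, sq_abs]
  rw [e₁]
  have e₂ : (1 / 2 : ℂ) * (r + 2 * κ * (l : ℂ) ^ 2 - (Complex.normSq t : ℂ) / κ) / (l : ℂ) ^ 2 =
      ((1 / 2 : ℝ) : ℂ) * (r / (l : ℂ) ^ 2) +
        ((κ - Complex.normSq t / l ^ 2 / (2 * κ) : ℝ) : ℂ) := by
    have : (l : ℂ) ≠ 0 := Complex.ofReal_ne_zero.2 hl0.ne'
    have : (κ : ℂ) ≠ 0 := Complex.ofReal_ne_zero.2 hκ0.ne'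
    push_cast
    field_simp
    ring
  rw [e₂, Complex.add_re, Complex.re_ofReal_mul, Complex.ofReal_re]
  ring

end IsLocalHypersurface

/-! ### Convexity of a hypersurface in coordinates -/

lemma exists_sq_mul_eq_neg_norm (a : ℂ) : ∃ c : ℂ, ‖c‖ = 1 ∧ c ^ 2 * a = -(‖a‖ : ℂ) := by
  by_cases ha : a = 0
  · exact ⟨1, by simp, by simp [ha]⟩
  obtain ⟨c, hc⟩ := IsAlgClosed.exists_pow_nat_eq (-(‖a‖ : ℂ) / a) two_pos
  refine ⟨c, ?_, by rw [hc, div_mul_cancel₀ _ ha]⟩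
  have h := congrArg norm hc
  rw [norm_pow, norm_div, norm_neg, Complex.norm_real, norm_norm,
    div_self (norm_ne_zero_iff.2 ha)] at h
  exact (pow_eq_one_iff_of_nonneg (norm_nonneg c) two_ne_zero).1 h

namespace IsLocalHypersurface

variable {n : ℕ} {g : CVec (n + 1) → Matrix (Fin (n + 1)) (Fin (n + 1)) ℂ}
  {F : RVec (2 * n + 1) → CVec (n + 1)} {θ : RVec (2 * n + 1) → (RVec (2 * n + 1) →L[ℝ] ℝ)}
  {U : Set (RVec (2 * n + 1))} {V : Set (CVec (n + 1))}
  (hM : IsLocalHypersurface g F θ U V) {y : RVec (2 * n + 1)} (hy : y ∈ U)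
include hM hy

lemma secTorsion_smul {Z : CVec (2 * n + 1)} (hZ : Z ∈ T10 F y) {c : ℂ} (hc : ‖c‖ = 1) :
    secTorsion F θ y (c • Z) = c ^ 2 * secTorsion F θ y Z := by
  have hcZ : c • Z ∈ T10 F y := Submodule.smul_mem _ _ hZ
  have hc' : star c * c = 1 := by
    rw [Complex.star_def, Complex.conj_mul', hc]
    simp
  rw [hM.secTorsion_eq hy hcZ, hM.secTorsion_eq hy hZ, hM.levi_eq_herm_of_left hy _ hcZ,
    hM.levi_eq_herm_of_left hy _ hZ, torsionForm, torsionForm, star_smul]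
  simp only [dC_smul_dir, herm_smul_left, herm_smul_right, star_star]
  rw [← mul_assoc (star c) c, hc', one_mul]
  ring

lemma add_star_ne_zero {Z : CVec (2 * n + 1)} (hZ : Z ∈ T10 F y) (hne : Z ≠ 0) :
    Z + star Z ≠ 0 := by
  intro h
  refine hM.dC_ne_zero hy hZ hne ?_
  have h' := congrArg (dC F y) h
  rwa [dC_add_dir, mem_T10_iff.1 hZ, add_zero, ← dCL_apply F y 0, map_zero] at h'

lemma scalarFF_zero : scalarFF n g F θ y 0 0 = 0 := by
  have h : secondFF g F θ y 0 0 = 0 := by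
    rw [hM.secondFF_eq hy]
    simp [secondFF10, ← dCL_apply]
  rw [scalarFF, h]
  simp [pairT]

/-- Rotating `Z` by a phase turns `Re A(Z)` into `-|A(Z)|`. -/
lemma exists_scalarFF_eq (hn : 1 ≤ n) {Z : CVec (2 * n + 1)} (hZ : Z ∈ T10 F y) (hne : Z ≠ 0) :
    ∃ W ∈ T10 F y, W ≠ 0 ∧ ∃ r : ℝ, 0 < r ∧ scalarFF n g F θ y (W + star W) (W + star W) =
      r * ((normalSq g F θ y).re - ‖secTorsion F θ y Z‖) := by
  obtain ⟨c, hc, hc'⟩ := exists_sq_mul_eq_neg_norm (secTorsion F θ y Z)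
  have hc0 : c ≠ 0 := fun h => by simp [h] at hc
  have hW : c • Z ∈ T10 F y := Submodule.smul_mem _ _ hZ
  have hW0 : c • Z ≠ 0 := smul_ne_zero hc0 hne
  have hκ := hM.normalSq_pos hy
  refine ⟨c • Z, hW, hW0, (levi θ y (c • Z) (c • Z)).re / Real.sqrt ((normalSq g F θ y).re / 2),
    div_pos (hM.levi_self_pos hy hW hW0) (Real.sqrt_pos.2 (half_pos hκ)), ?_⟩
  rw [hM.scalarFF_eq hy hn hW hW0, hM.secTorsion_smul hy hZ hc, hc', Complex.neg_re,
    Complex.ofReal_re]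
  ring

lemma scalarFF_nonneg_iff (hn : 1 ≤ n) :
    (∀ X, IsHorizontal F y X → 0 ≤ scalarFF n g F θ y X X) ↔
      ∀ Z ∈ T10 F y, Z ≠ 0 → ‖secTorsion F θ y Z‖ ≤ (normalSq g F θ y).re := by
  constructor
  · intro h Z hZ hne
    obtain ⟨W, hW, -, r, hr, e⟩ := hM.exists_scalarFF_eq hy hn hZ hne
    have := h _ ⟨W, hW, rfl⟩
    rw [e] at this
    linarith [nonneg_of_mul_nonneg_right this hr]
  · rintro h X ⟨Z, hZ, rfl⟩
    by_cases hne : Z = 0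
    · simp [hne, hM.scalarFF_zero hy]
    · rw [hM.scalarFF_eq hy hn hZ hne]
      have h₁ := h Z hZ hne
      have h₂ := neg_abs_le (secTorsion F θ y Z).re
      have h₃ := Complex.abs_re_le_norm (secTorsion F θ y Z)
      exact div_nonneg (mul_nonneg (hM.levi_self_pos hy hZ hne).le (by linarith))
        (Real.sqrt_nonneg _)

lemma scalarFF_pos_iff (hn : 1 ≤ n) :
    (∀ X, IsHorizontal F y X → X ≠ 0 → 0 < scalarFF n g F θ y X X) ↔
      ∀ Z ∈ T10 F y, Z ≠ 0 → ‖secTorsion F θ y Z‖ < (normalSq g F θ y).re := by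
  constructor
  · intro h Z hZ hne
    obtain ⟨W, hW, hW0, r, hr, e⟩ := hM.exists_scalarFF_eq hy hn hZ hne
    have := h _ ⟨W, hW, rfl⟩ (hM.add_star_ne_zero hy hW hW0)
    rw [e] at this
    linarith [(pos_iff_pos_of_mul_pos this).1 hr]
  · rintro h X ⟨Z, hZ, rfl⟩ hX
    have hne : Z ≠ 0 := fun h => hX (by simp [h])
    rw [hM.scalarFF_eq hy hn hZ hne]
    have h₁ := h Z hZ hne
    have h₂ := neg_abs_le (secTorsion F θ y Z).re
    have h₃ := Complex.abs_re_le_norm (secTorsion F θ y Z)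
    exact div_pos (mul_pos (hM.levi_self_pos hy hZ hne) (by linarith))
      (Real.sqrt_pos.2 (half_pos (hM.normalSq_pos hy)))

lemma le_twHSC {Z : CVec (2 * n + 1)} (hZ : Z ∈ T10 F y) (hne : Z ≠ 0)
    (h : ‖secTorsion F θ y Z‖ ≤ (normalSq g F θ y).re) :
    1 / 2 * kahlerHSC g (F y) (dC F y Z) + 1 / 2 * (normalSq g F θ y).re ≤ twHSC F θ y Z := by
  have hκ := hM.normalSq_pos hy
  rw [hM.twHSC_eq hy hZ hne]
  have : ‖secTorsion F θ y Z‖ ^ 2 / (2 * (normalSq g F θ y).re) ≤ (normalSq g F θ y).re / 2 := by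
    rw [div_le_iff₀ (by positivity)]
    nlinarith [norm_nonneg (secTorsion F θ y Z)]
  linarith

lemma twHSC_eq_of_norm_eq {Z : CVec (2 * n + 1)} (hZ : Z ∈ T10 F y) (hne : Z ≠ 0)
    (h : ‖secTorsion F θ y Z‖ = (normalSq g F θ y).re) :
    twHSC F θ y Z = 1 / 2 * kahlerHSC g (F y) (dC F y Z) + 1 / 2 * (normalSq g F θ y).re := by
  have hκ := hM.normalSq_pos hy
  rw [hM.twHSC_eq hy hZ hne, h]
  field_simp
  ring

end IsLocalHypersurface

/-! ### From manifolds to coordinates -/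

section Chart

/-- A complex manifold is a smooth real manifold, with the same charts. -/
lemma isManifold_restrictScalars {E : Type*} [NormedAddCommGroup E] [NormedSpace ℝ E]
    [NormedSpace ℂ E] (X : Type*) [TopologicalSpace X] [ChartedSpace E X]
    [IsManifold 𝓘(ℂ, E) ω X] : IsManifold 𝓘(ℝ, E) ∞ X := by
  refine isManifold_of_contDiffOn _ _ _ fun e e' he he' => ?_
  have h := contMDiffOn_iff_contDiffOn.1 (contMDiffOn_of_mem_contDiffGroupoid
    (StructureGroupoid.compatible (contDiffGroupoid ω 𝓘(ℂ, E)) he he'))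
  have h' := (h.restrict_scalars ℝ).of_le (m := ∞) le_top
  simpa using h'

variable {n : ℕ} {X : Type*} [TopologicalSpace X] [ChartedSpace (CVec (n + 1)) X]

/-- The matrix in a chart represents the metric on all vectors, not only on the basis vectors. -/
lemma herm_coordMatrix (g : KahlerMetric n X) (x₀ : X) (z a b : CVec (n + 1)) :
    herm (coordMatrix g.form x₀ z) a b = g.form ((extChartAt 𝓘(ℂ, CVec (n + 1)) x₀).symm z)
      (mfderiv 𝓘(ℂ, CVec (n + 1)) 𝓘(ℂ, CVec (n + 1))
        (extChartAt 𝓘(ℂ, CVec (n + 1)) x₀).symm z a)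
      (mfderiv 𝓘(ℂ, CVec (n + 1)) 𝓘(ℂ, CVec (n + 1))
        (extChartAt 𝓘(ℂ, CVec (n + 1)) x₀).symm z b) := by
  set x := (extChartAt 𝓘(ℂ, CVec (n + 1)) x₀).symm z with hx
  let B : CVec (n + 1) → CVec (n + 1) → ℂ := g.form x
  let L : CVec (n + 1) →L[ℂ] CVec (n + 1) := mfderiv 𝓘(ℂ, CVec (n + 1)) 𝓘(ℂ, CVec (n + 1))
        (extChartAt 𝓘(ℂ, CVec (n + 1)) x₀).symm z
  have add_left : ∀ u v w, B (u + v) w = B u w + B v w := g.add_left x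
  have smul_left : ∀ (c : ℂ) u w, B (c • u) w = c * B u w := g.smul_left x
  have conj : ∀ u w, star (B u w) = B w u := g.conj_symm x
  have add_right : ∀ u v w, B w (u + v) = B w u + B w v := fun u v w => by
    rw [← conj, add_left, star_add, conj, conj]
  have smul_right : ∀ (c : ℂ) u w, B w (c • u) = star c * B w u := fun c u w => by
    rw [← conj, smul_left, star_mul', conj]
  have sum_left : ∀ (a : CVec (n + 1)) w,
      B (L a) w = ∑ j, a j * B (L (Pi.single j 1)) w := by
    intro a w
    let φ : CVec (n + 1) →ₗ[ℂ] ℂ :=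
      { toFun := fun a => B (L a) w
        map_add' := fun u v => by rw [map_add, add_left]
        map_smul' := fun c u => by rw [map_smul, smul_left]; rfl }
    have e : ∀ j : Fin (n + 1), (fun k => if j = k then (1 : ℂ) else 0) = Pi.single j 1 :=
      fun j => by
        ext k
        simp [Pi.single_apply, eq_comm]
    have h := φ.pi_apply_eq_sum_univ a
    simp only [e] at h
    exact h
  have sum_right : ∀ (b : CVec (n + 1)) w,
      B w (L b) = ∑ k, star (b k) * B w (L (Pi.single k 1)) := by
    intro b w
    rw [← conj, sum_left, star_sum]
    exact Finset.sum_congr rfl fun k _ => by rw [star_mul', conj]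
  have hg : ∀ j k, coordMatrix g.form x₀ z j k = B (L (Pi.single j 1)) (L (Pi.single k 1)) :=
    fun j k => rfl
  change _ = B (L a) (L b)
  rw [sum_left]
  simp only [sum_right b, herm, hg, Finset.mul_sum]
  exact Finset.sum_congr rfl fun j _ => Finset.sum_congr rfl fun k _ => by ring

lemma isKahlerOn_coordMatrix [IsManifold 𝓘(ℂ, CVec (n + 1)) ω X] (g : KahlerMetric n X) (x₀ : X) :
    IsKahlerOn (coordMatrix g.form x₀) (extChartAt 𝓘(ℂ, CVec (n + 1)) x₀).target where
  isOpen := isOpen_extChartAt_target x₀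
  smooth := g.smooth x₀
  hermitian x _ j k := g.conj_symm _ _ _
  pos z hz a ha := by
    rw [herm_coordMatrix]
    refine g.pos _ _ fun h => ha ?_
    have : IsManifold 𝓘(ℂ, CVec (n + 1)) 1 X := IsManifold.of_le (n := ω) le_top
    have hinv := isInvertible_mfderivWithin_extChartAt_symm (I := 𝓘(ℂ, CVec (n + 1))) hz
    rw [modelWithCornersSelf_coe, Set.range_id, mfderivWithin_univ] at hinv
    exact hinv.injective (h.trans (map_zero _).symm)
  closed := g.closed x₀

variable [IsManifold 𝓘(ℂ, CVec (n + 1)) ω X]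
  {M : Type*} [TopologicalSpace M] [ChartedSpace (RVec (2 * n + 1)) M]
  [IsManifold 𝓘(ℝ, RVec (2 * n + 1)) ∞ M]
  {g : KahlerMetric n X} {ι : M → X} {θ : ∀ p : M, TangentSpace 𝓘(ℝ, RVec (2 * n + 1)) p →L[ℝ] ℝ}

lemma injective_fderiv_chartMap (hι : ContMDiff 𝓘(ℝ, RVec (2 * n + 1)) 𝓘(ℝ, CVec (n + 1)) ∞ ι)
    (hinj : ∀ p, Function.Injective (mfderiv 𝓘(ℝ, RVec (2 * n + 1)) 𝓘(ℝ, CVec (n + 1)) ι p))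
    (p : M) {y : RVec (2 * n + 1)} (hy : y ∈ chartDom ι p) :
    Function.Injective (fderiv ℝ (chartMap ι p) y) := by
  have := isManifold_restrictScalars (E := CVec (n + 1)) X
  have : IsManifold 𝓘(ℝ, CVec (n + 1)) 1 X := IsManifold.of_le (n := ∞) (by simp)
  have : IsManifold 𝓘(ℝ, RVec (2 * n + 1)) 1 M := IsManifold.of_le (n := ∞) (by simp)
  set ψ := extChartAt 𝓘(ℝ, RVec (2 * n + 1)) p
  set φ := extChartAt 𝓘(ℝ, CVec (n + 1)) (ι p)
  have hy₂ : ι (ψ.symm y) ∈ φ.source := hy.2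
  have h₁ := isInvertible_mfderivWithin_extChartAt_symm (I := 𝓘(ℝ, RVec (2 * n + 1))) hy.1
  rw [modelWithCornersSelf_coe, Set.range_id, mfderivWithin_univ] at h₁
  have h₃ := isInvertible_mfderiv_extChartAt (I := 𝓘(ℝ, CVec (n + 1))) hy₂
  have d₁ := mdifferentiableAt_of_isInvertible_mfderiv h₁
  have d₃ := mdifferentiableAt_of_isInvertible_mfderiv h₃
  have d₂ := (hι (ψ.symm y)).mdifferentiableAt (by simp)
  have e : chartMap ι p = φ ∘ ι ∘ ψ.symm := rfl
  have hc := (d₃.hasMFDerivAt.comp y (d₂.hasMFDerivAt.comp y d₁.hasMFDerivAt)).mfderiv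
  rw [← mfderiv_eq_fderiv, e]
  erw [hc]
  exact h₃.injective.comp ((hinj _).comp h₁.injective)

/-- In the preferred charts, a semi-isometric hypersurface is a local hypersurface. -/
lemma IsSemiIsometric.isLocalHypersurface (h : IsSemiIsometric g ι θ) (p : M) :
    IsLocalHypersurface (coordMatrix g.form (ι p)) (chartMap ι p) (chartForm θ p) (chartDom ι p)
      (extChartAt 𝓘(ℂ, CVec (n + 1)) (ι p)).target where
  isOpen := (continuousOn_extChartAt_symm p).isOpen_inter_preimage (isOpen_extChartAt_target p)
    ((isOpen_extChartAt_source (ι p)).preimage h.smooth_map.continuous)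
  kahler := isKahlerOn_coordMatrix g (ι p)
  mapsTo y hy := (extChartAt 𝓘(ℂ, CVec (n + 1)) (ι p)).map_source hy.2
  smooth_map := by
    have := isManifold_restrictScalars (E := CVec (n + 1)) X
    exact (contMDiff_iff.1 h.smooth_map).2 p (ι p)
  injective y hy := injective_fderiv_chartMap h.smooth_map h.immersion p hy
  smooth_form := (h.smooth_form p).mono Set.inter_subset_left
  ker_eq := h.ker_eq p
  dForm_eq := h.dForm_eq p

omit [IsManifold 𝓘(ℂ, CVec (n + 1)) ω X] [IsManifold 𝓘(ℝ, RVec (2 * n + 1)) ∞ M] in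
lemma chartPt_mem_chartDom (ι : M → X) (p : M) : chartPt (n := n) p ∈ chartDom ι p := by
  refine ⟨mem_extChartAt_target p, ?_⟩
  rw [chartPt, Set.mem_ofPred_eq, extChartAt_to_inv]
  exact mem_extChartAt_source (ι p)

lemma IsSemiIsometric.meanCurvSq_eq (h : IsSemiIsometric g ι θ) (hn : 1 ≤ n) (p : M) :
    meanCurvSq g ι θ p =
      (normalSq (coordMatrix g.form (ι p)) (chartMap ι p) (chartForm θ p) (chartPt p)).re :=
  (h.isLocalHypersurface p).normSqT_meanCurv (chartPt_mem_chartDom ι p) hn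

lemma IsSemiIsometric.isCConvex_iff (h : IsSemiIsometric g ι θ) (hn : 1 ≤ n) :
    IsCConvex g ι θ ↔
      ∀ p : M, ∀ Z ∈ holTangent ι p, Z ≠ 0 → ‖holTorsion ι θ p Z‖ ≤ meanCurvSq g ι θ p := by
  refine forall_congr' fun p => ?_
  rw [h.meanCurvSq_eq hn]
  exact (h.isLocalHypersurface p).scalarFF_nonneg_iff (chartPt_mem_chartDom ι p) hn

lemma IsSemiIsometric.isStrictlyCConvex_iff (h : IsSemiIsometric g ι θ) (hn : 1 ≤ n) :
    IsStrictlyCConvex g ι θ ↔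
      ∀ p : M, ∀ Z ∈ holTangent ι p, Z ≠ 0 → ‖holTorsion ι θ p Z‖ < meanCurvSq g ι θ p := by
  refine forall_congr' fun p => ?_
  rw [h.meanCurvSq_eq hn]
  exact (h.isLocalHypersurface p).scalarFF_pos_iff (chartPt_mem_chartDom ι p) hn

lemma IsSemiIsometric.le_holCurv (h : IsSemiIsometric g ι θ) (hn : 1 ≤ n) {p : M}
    {Z : CVec (2 * n + 1)} (hZ : Z ∈ holTangent ι p) (hne : Z ≠ 0)
    (hA : ‖holTorsion ι θ p Z‖ ≤ meanCurvSq g ι θ p) :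
    1 / 2 * ambientCurv g ι p Z + 1 / 2 * meanCurvSq g ι θ p ≤ holCurv ι θ p Z := by
  rw [h.meanCurvSq_eq hn] at hA ⊢
  exact (h.isLocalHypersurface p).le_twHSC (chartPt_mem_chartDom ι p) hZ hne hA

lemma IsSemiIsometric.holCurv_eq (h : IsSemiIsometric g ι θ) (hn : 1 ≤ n) {p : M}
    {Z : CVec (2 * n + 1)} (hZ : Z ∈ holTangent ι p) (hne : Z ≠ 0)
    (hA : ‖holTorsion ι θ p Z‖ = meanCurvSq g ι θ p) :
    holCurv ι θ p Z = 1 / 2 * ambientCurv g ι p Z + 1 / 2 * meanCurvSq g ι θ p := by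
  rw [h.meanCurvSq_eq hn] at hA ⊢
  exact (h.isLocalHypersurface p).twHSC_eq_of_norm_eq (chartPt_mem_chartDom ι p) hZ hne hA

end Chart

/-! ### Parametrizations of the quadric -/

section Quadric

variable {n : ℕ}

/-- The real bilinear form `∑ Re a_j Re b_j`. -/
noncomputable def reForm (n : ℕ) : CVec (n + 1) →L[ℝ] CVec (n + 1) →L[ℝ] ℝ :=
  ∑ j, (Complex.reCLM.comp (proj j : CVec (n + 1) →L[ℝ] ℂ)).smulRight
    (Complex.reCLM.comp (proj j : CVec (n + 1) →L[ℝ] ℂ))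

/-- The real bilinear form `∑ Re a_j Im b_j`. -/
noncomputable def imForm (n : ℕ) : CVec (n + 1) →L[ℝ] CVec (n + 1) →L[ℝ] ℝ :=
  ∑ j, (Complex.reCLM.comp (proj j : CVec (n + 1) →L[ℝ] ℂ)).smulRight
    (Complex.imCLM.comp (proj j : CVec (n + 1) →L[ℝ] ℂ))

lemma reForm_apply (a b : CVec (n + 1)) : reForm n a b = ∑ j, (a j).re * (b j).re := by
  simp [reForm, sum_apply]

lemma imForm_apply (a b : CVec (n + 1)) : imForm n a b = ∑ j, (a j).re * (b j).im := by
  simp [imForm, sum_apply]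

lemma reForm_comm (a b : CVec (n + 1)) : reForm n a b = reForm n b a := by
  simp only [reForm_apply, mul_comm]

lemma reForm_I_smul (a b : CVec (n + 1)) : reForm n a (Complex.I • b) = -imForm n a b := by
  simp [reForm_apply, imForm_apply]

lemma imForm_I_smul (a b : CVec (n + 1)) : imForm n a (Complex.I • b) = reForm n a b := by
  simp [reForm_apply, imForm_apply]

lemma reForm_realPart (a b : CVec (n + 1)) : reForm n a (toC (rePart b)) = reForm n a b := by
  simp [reForm_apply, toC, rePart]

lemma imForm_realPart (a b : CVec (n + 1)) : imForm n a (toC (rePart b)) = 0 := by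
  simp [imForm_apply, toC]

lemma mem_quadric_iff {z : CVec (n + 1)} : z ∈ quadric n ↔ reForm n z z = 1 / 2 := by
  have h : ∑ j, ‖z j‖ ^ 2 + (∑ j, z j ^ 2).re = 2 * reForm n z z := by
    rw [Complex.re_sum, ← Finset.sum_add_distrib, reForm_apply, Finset.mul_sum]
    refine Finset.sum_congr rfl fun j _ => ?_
    rw [Complex.sq_norm, Complex.normSq_apply, pow_two, Complex.mul_re]
    ring
  rw [quadric, Set.mem_ofPred_eq, h]
  constructor <;> intro h <;> linarith

/-- A linear identification of `ℝ^{2n+1}` with the tangent space `{a : ∑ Re p_j Re a_j = 0}` of the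
quadric at `p`, together with the projection onto it along `Re p`. -/
structure TangentSplitting (p : CVec (n + 1)) where
  incl : RVec (2 * n + 1) →L[ℝ] CVec (n + 1)
  proj : CVec (n + 1) →L[ℝ] RVec (2 * n + 1)
  proj_incl : ∀ v, proj (incl v) = v
  incl_proj : ∀ a, incl (proj a) = a - (2 * reForm n p a) • toC (rePart p)

lemma nonempty_tangentSplitting {p : CVec (n + 1)} (hp : p ∈ quadric n) :
    Nonempty (TangentSplitting p) := by
  rw [mem_quadric_iff] at hp
  let φ : CVec (n + 1) →ₗ[ℝ] ℝ := (reForm n p).toLinearMap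
  have hφ : ∀ a, φ a = reForm n p a := fun _ => rfl
  have hsurj : LinearMap.range φ = ⊤ := LinearMap.range_eq_top.2 fun c =>
    ⟨(2 * c) • p, by rw [map_smul, hφ, hp, smul_eq_mul]; ring⟩
  have hrank := LinearMap.finrank_range_add_finrank_ker φ
  rw [hsurj, finrank_top, Module.finrank_self] at hrank
  have hC : Module.finrank ℝ (CVec (n + 1)) = 2 * (n + 1) := by
    rw [← Module.finrank_mul_finrank ℝ ℂ (CVec (n + 1)), Complex.finrank_real_complex]
    simp
  rw [hC] at hrank
  have e : RVec (2 * n + 1) ≃L[ℝ] LinearMap.ker φ := ContinuousLinearEquiv.ofFinrankEq (by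
    rw [Module.finrank_fintype_fun_eq_card, Fintype.card_fin]
    omega)
  let π : CVec (n + 1) →L[ℝ] CVec (n + 1) :=
    ContinuousLinearMap.id ℝ _ - (2 • reForm n p).smulRight (toC (rePart p))
  have hπ : ∀ a, π a = a - (2 * reForm n p a) • toC (rePart p) := fun a => by
    simp [π, two_smul, two_mul]
  have hπ' : ∀ a, π a ∈ LinearMap.ker φ := fun a => by
    rw [LinearMap.mem_ker, hφ, hπ, map_sub, map_smul, reForm_realPart, hp, smul_eq_mul]
    ring
  refine ⟨⟨(LinearMap.ker φ).subtypeL.comp (e : _ →L[ℝ] _),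
    (e.symm : _ →L[ℝ] _).comp (π.codRestrict _ hπ'), fun v => ?_, fun a => ?_⟩⟩
  · refine e.symm_apply_eq.2 (Subtype.ext ?_)
    have h : reForm n p (e v) = 0 := (e v).2
    change π (e v) = e v
    rw [hπ, h]
    simp
  · rw [← hπ]
    simp

namespace TangentSplitting

variable {p : CVec (n + 1)} (σ : TangentSplitting p)

lemma reForm_incl (hp : p ∈ quadric n) (v : RVec (2 * n + 1)) : reForm n p (σ.incl v) = 0 := by
  rw [mem_quadric_iff] at hp
  have h := congrArg (reForm n p) (σ.incl_proj (σ.incl v))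
  rw [σ.proj_incl, map_sub, map_smul, reForm_realPart, hp, smul_eq_mul] at h
  linarith

lemma proj_realPart (hp : p ∈ quadric n) : σ.proj (toC (rePart p)) = 0 := by
  have h := σ.incl_proj (toC (rePart p))
  rw [reForm_realPart, mem_quadric_iff.1 hp] at h
  have h' := σ.proj_incl (σ.proj (toC (rePart p)))
  rw [h] at h'
  simpa using h'.symm

/-- The coordinates in which the quadric is parametrized as a graph over its tangent space
at `p`. -/
def target : Set (RVec (2 * n + 1)) := {v | 2 * reForm n (σ.incl v) (σ.incl v) < 1}

/-- The parametrization of the quadric as a graph over its tangent space at `p`. -/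
noncomputable def param (v : RVec (2 * n + 1)) : CVec (n + 1) :=
  σ.incl v + Real.sqrt (1 - 2 * reForm n (σ.incl v) (σ.incl v)) • toC (rePart p)

lemma contDiff_radicand :
    ContDiff ℝ ∞ fun v => 1 - 2 * reForm n (σ.incl v) (σ.incl v) :=
  contDiff_const.sub (contDiff_const.mul
    (((reForm n).contDiff.comp σ.incl.contDiff).clm_apply σ.incl.contDiff))

lemma isOpen_target : IsOpen σ.target := by
  have h : σ.target = {v | 0 < 1 - 2 * reForm n (σ.incl v) (σ.incl v)} := by
    ext v
    exact (sub_pos (a := (1 : ℝ))).symm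
  rw [h]
  exact isOpen_lt continuous_const σ.contDiff_radicand.continuous

lemma contDiffOn_param : ContDiffOn ℝ ∞ σ.param σ.target :=
  σ.incl.contDiff.contDiffOn.add ((σ.contDiff_radicand.contDiffOn.sqrt fun _ hv =>
    (sub_pos.2 hv).ne').smul contDiffOn_const)

lemma proj_param (hp : p ∈ quadric n) (v : RVec (2 * n + 1)) : σ.proj (σ.param v) = v := by
  rw [param, map_add, map_smul, σ.proj_realPart hp, smul_zero, add_zero, σ.proj_incl]

lemma reForm_param (hp : p ∈ quadric n) (v : RVec (2 * n + 1)) :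
    reForm n p (σ.param v) = Real.sqrt (1 - 2 * reForm n (σ.incl v) (σ.incl v)) / 2 := by
  rw [param, map_add, map_smul, σ.reForm_incl hp, reForm_realPart, mem_quadric_iff.1 hp,
    smul_eq_mul]
  ring

lemma param_mem (hp : p ∈ quadric n) {v : RVec (2 * n + 1)} (hv : v ∈ σ.target) :
    σ.param v ∈ quadric n := by
  have hx : reForm n (toC (rePart p)) (toC (rePart p)) = 1 / 2 := by
    rw [reForm_realPart, reForm_comm, reForm_realPart, mem_quadric_iff.1 hp]
  have hc : reForm n (σ.incl v) (toC (rePart p)) = 0 := by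
    rw [reForm_realPart, reForm_comm, σ.reForm_incl hp]
  rw [mem_quadric_iff, param]
  simp only [map_add, map_smul, add_apply, smul_apply, smul_eq_mul]
  rw [reForm_comm (toC (rePart p)) (σ.incl v), hc, hx]
  have := Real.mul_self_sqrt (sub_pos.2 hv).le
  linear_combination this / 2

/-- A point of the quadric on the same side as `p` is recovered from its projection. -/
lemma param_proj (hp : p ∈ quadric n) {z : CVec (n + 1)} (hz : z ∈ quadric n)
    (h : 0 < reForm n p z) : σ.proj z ∈ σ.target ∧ σ.param (σ.proj z) = z := by
  have hx : reForm n (toC (rePart p)) (toC (rePart p)) = 1 / 2 := by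
    rw [reForm_realPart, reForm_comm, reForm_realPart, mem_quadric_iff.1 hp]
  have hxz : reForm n (toC (rePart p)) z = reForm n p z := by
    rw [reForm_comm, reForm_realPart, reForm_comm]
  have hzx : reForm n z (toC (rePart p)) = reForm n p z := by
    rw [reForm_realPart, reForm_comm]
  have e : 1 - 2 * reForm n (σ.incl (σ.proj z)) (σ.incl (σ.proj z)) = (2 * reForm n p z) ^ 2 := by
    rw [σ.incl_proj]
    simp only [map_sub, map_smul, sub_apply, smul_apply, smul_eq_mul]
    rw [hxz, hzx, hx, mem_quadric_iff.1 hz]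
    ring
  refine ⟨?_, ?_⟩
  · rw [target, Set.mem_ofPred_eq]
    nlinarith
  · rw [param, e, Real.sqrt_sq (by positivity), σ.incl_proj, sub_add_cancel]

end TangentSplitting

/-- `F` parametrizes an open piece of the quadric over `U`, with the linear map `B` as chart. -/
structure IsQuadricParam (F : RVec (2 * n + 1) → CVec (n + 1))
    (B : CVec (n + 1) →L[ℝ] RVec (2 * n + 1)) (U : Set (RVec (2 * n + 1))) : Prop where
  isOpen : IsOpen U
  smooth : ContDiffOn ℝ ∞ F U
  mem : ∀ y ∈ U, F y ∈ quadric n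
  left_inv : ∀ y ∈ U, B (F y) = y
  fderiv_chart : ∀ y ∈ U, ∀ a, reForm n (F y) a = 0 → fderiv ℝ F y (B a) = a

section Tangent

variable {F : RVec (2 * n + 1) → CVec (n + 1)} {B : CVec (n + 1) →L[ℝ] RVec (2 * n + 1)}
  {U : Set (RVec (2 * n + 1))}

lemma reForm_fderiv (hU : IsOpen U) (hF : ContDiffOn ℝ ∞ F U) (hmem : ∀ y ∈ U, F y ∈ quadric n)
    {y : RVec (2 * n + 1)} (hy : y ∈ U) (v : RVec (2 * n + 1)) :
    reForm n (F y) (fderiv ℝ F y v) = 0 := by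
  have hd := ((hF.contDiffAt (hU.mem_nhds hy)).differentiableAt (by simp)).hasFDerivAt
  have h := ((reForm n).hasFDerivAt.comp y hd).clm_apply hd
  have e : (fun x => (reForm n ∘ F) x (F x)) =ᶠ[𝓝 y] fun _ => 1 / 2 := by
    filter_upwards [hU.mem_nhds hy] with x hx using mem_quadric_iff.1 (hmem x hx)
  have h' := congrArg (fun L : RVec (2 * n + 1) →L[ℝ] ℝ => L v)
    ((h.congr_of_eventuallyEq e.symm).unique (hasFDerivAt_const (1 / 2 : ℝ) y))
  simp at h'
  rw [reForm_comm (fderiv ℝ F y v)] at h'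
  linarith

lemma chart_fderiv (hU : IsOpen U) (hF : ContDiffOn ℝ ∞ F U) (hB : ∀ y ∈ U, B (F y) = y)
    {y : RVec (2 * n + 1)} (hy : y ∈ U) (v : RVec (2 * n + 1)) : B (fderiv ℝ F y v) = v := by
  have hd := ((hF.contDiffAt (hU.mem_nhds hy)).differentiableAt (by simp)).hasFDerivAt
  have e : (fun x => B (F x)) =ᶠ[𝓝 y] fun x => x := by
    filter_upwards [hU.mem_nhds hy] with x hx using hB x hx
  exact congrArg (fun L : RVec (2 * n + 1) →L[ℝ] RVec (2 * n + 1) => L v)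
    (((B.hasFDerivAt.comp y hd).congr_of_eventuallyEq e.symm).unique (hasFDerivAt_id y))

lemma TangentSplitting.isQuadricParam {p : CVec (n + 1)} (σ : TangentSplitting p)
    (hp : p ∈ quadric n) (hU : IsOpen U) (hUσ : U ⊆ σ.target) (hF : Set.EqOn F σ.param U) :
    IsQuadricParam F σ.proj U := by
  have hs : ContDiffOn ℝ ∞ F U := (σ.contDiffOn_param.mono hUσ).congr hF
  have hmem : ∀ y ∈ U, F y ∈ quadric n := fun y hy => by
    rw [hF hy]
    exact σ.param_mem hp (hUσ hy)
  have hleft : ∀ y ∈ U, σ.proj (F y) = y := fun y hy => by rw [hF hy, σ.proj_param hp]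
  refine ⟨hU, hs, hmem, hleft, fun y hy a ha => ?_⟩
  -- the difference of the two sides is a multiple of `Re p`, and it is tangent to the quadric
  set d := fderiv ℝ F y (σ.proj a) - a with hd
  have h₁ : σ.proj d = 0 := by rw [hd, map_sub, chart_fderiv hU hs hleft hy, sub_self]
  have h₂ : d = (2 * reForm n p d) • toC (rePart p) := by
    have := σ.incl_proj d
    rw [h₁, map_zero] at this
    exact (sub_eq_zero.1 this.symm)
  have h₃ : reForm n (F y) d = 0 := by
    rw [hd, map_sub, reForm_fderiv hU hs hmem hy, ha, sub_zero]
  have h₄ : reForm n (F y) p ≠ 0 := by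
    rw [hF hy, reForm_comm, σ.reForm_param hp]
    exact (half_pos (Real.sqrt_pos.2 (sub_pos.2 (hUσ hy)))).ne'
  rw [h₂, map_smul, reForm_realPart, smul_eq_mul, mul_eq_zero, or_iff_left h₄] at h₃
  rw [h₃, zero_smul] at h₂
  exact sub_eq_zero.1 h₂

end Tangent

end Quadric

/-! ### The pseudohermitian geometry of the quadric -/

namespace IsQuadricParam

variable {n : ℕ} {F : RVec (2 * n + 1) → CVec (n + 1)} {B : CVec (n + 1) →L[ℝ] RVec (2 * n + 1)}
  {U : Set (RVec (2 * n + 1))} {θ : RVec (2 * n + 1) → (RVec (2 * n + 1) →L[ℝ] ℝ)}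

section

variable (hF : IsQuadricParam F B U) {y : RVec (2 * n + 1)} (hy : y ∈ U)
include hF hy

lemma contDiffAt : ContDiffAt ℝ ∞ F y := hF.smooth.contDiffAt (hF.isOpen.mem_nhds hy)

lemma reForm_fderiv (v : RVec (2 * n + 1)) : reForm n (F y) (fderiv ℝ F y v) = 0 :=
  PseudoHermitian.reForm_fderiv hF.isOpen hF.smooth hF.mem hy v

/-- A complex vector `a` with `∑ Re F_j a_j = 0` is of the form `F_* Z` with `Z` of type
`(1,0)`. -/
lemma exists_mem_T10 {a : CVec (n + 1)} (h₁ : reForm n (F y) a = 0) (h₂ : imForm n (F y) a = 0) :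
    ∃ Z ∈ T10 F y, dC F y Z = a ∧ Z + star Z = toC (B a) := by
  have e₁ := hF.fderiv_chart y hy a h₁
  have e₂ := hF.fderiv_chart y hy (Complex.I • a) (by rw [reForm_I_smul, h₂, neg_zero])
  have hs : star ((1 / 2 : ℂ) • (toC (B a) - Complex.I • toC (B (Complex.I • a)))) =
      (1 / 2 : ℂ) • (toC (B a) + Complex.I • toC (B (Complex.I • a))) := by
    have h : star (1 / 2 : ℂ) = 1 / 2 := by simp
    simp only [star_smul, star_sub, star_toC, h]
    rw [Complex.star_def, Complex.conj_I, neg_smul, sub_neg_eq_add]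
  refine ⟨(1 / 2 : ℂ) • (toC (B a) - Complex.I • toC (B (Complex.I • a))), ?_, ?_, ?_⟩
  · rw [mem_T10_iff, hs]
    simp only [← dCL_apply, map_smul, map_add]
    simp only [dCL_apply, dC_toC, e₁, e₂, smul_smul, Complex.I_mul_I]
    module
  · simp only [← dCL_apply, map_smul, map_sub]
    simp only [dCL_apply, dC_toC, e₁, e₂, smul_smul, Complex.I_mul_I]
    module
  · rw [hs]
    module

variable (hθ : ∀ y ∈ U, θ y = (2 : ℝ) • (imForm n (F y)).comp (fderiv ℝ F y))
include hθ

omit hF in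
lemma form_apply (v : RVec (2 * n + 1)) : θ y v = 2 * imForm n (F y) (fderiv ℝ F y v) := by
  rw [hθ y hy]
  rfl

lemma form_eq_zero_iff (v : RVec (2 * n + 1)) : θ y v = 0 ↔ IsHorizontal F y (toC v) := by
  rw [form_apply hy hθ, mul_eq_zero, or_iff_right two_ne_zero]
  constructor
  · intro h
    obtain ⟨Z, hZ, -, e⟩ := hF.exists_mem_T10 hy (hF.reForm_fderiv hy v) h
    refine ⟨Z, hZ, ?_⟩
    rw [e, chart_fderiv hF.isOpen hF.smooth hF.left_inv hy]
  · rintro ⟨Z, hZ, e⟩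
    have h₁ : dC F y Z = fderiv ℝ F y v := by
      rw [← dC_toC, e, dC_add_dir, mem_T10_iff.1 hZ, add_zero]
    have h₂ := mem_T10_iff.1 hZ
    -- `F_* (Im Z)` is `-i / 2` times `F_* v`, and it is tangent to the quadric
    have h₃ : Complex.I • fderiv ℝ F y v = (-2 : ℝ) • fderiv ℝ F y (imPart Z) := by
      have h₄ : dC F y Z - dC F y (star Z) = (2 * Complex.I) • fderiv ℝ F y (imPart Z) := by
        simp only [dC, rePart_star, imPart_star, map_neg]
        module
      rw [h₂, sub_zero, h₁] at h₄
      rw [h₄, smul_smul, mul_left_comm, Complex.I_mul_I, ← Complex.coe_smul]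
      simp
    have h₅ := congrArg (reForm n (F y)) h₃
    rw [reForm_I_smul, map_smul, hF.reForm_fderiv hy, smul_zero] at h₅
    exact neg_eq_zero.1 h₅

lemma form_eventuallyEq :
    θ =ᶠ[𝓝 y] fun x => (2 : ℝ) • (imForm n (F x)).comp (fderiv ℝ F x) := by
  filter_upwards [hF.isOpen.mem_nhds hy] with x hx using hθ x hx

lemma contDiffAt_form : ContDiffAt ℝ ∞ θ y :=
  ContDiffAt.congr_of_eventuallyEq ((((imForm n).contDiff.contDiffAt.comp y
    (hF.contDiffAt hy)).clm_comp ((hF.contDiffAt hy).fderiv_right (m := ∞) (by simp))).const_smul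
    (2 : ℝ)) (hF.form_eventuallyEq hy hθ)

lemma dForm_form (u v : RVec (2 * n + 1)) :
    dForm θ y u v = 2 * (imForm n (fderiv ℝ F y u) (fderiv ℝ F y v) -
      imForm n (fderiv ℝ F y v) (fderiv ℝ F y u)) := by
  have hd := (hF.contDiffAt hy).differentiableAt (by simp)
  have hd₂ : DifferentiableAt ℝ (fderiv ℝ F) y :=
    ((hF.contDiffAt hy).fderiv_right (m := ∞) (by simp)).differentiableAt (by simp)
  have h := ((((imForm n).hasFDerivAt.comp y hd.hasFDerivAt).clm_comp
    hd₂.hasFDerivAt).const_smul (2 : ℝ)).congr_of_eventuallyEq (hF.form_eventuallyEq hy hθ)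
  have hsymm : fderiv ℝ (fderiv ℝ F) y u v = fderiv ℝ (fderiv ℝ F) y v u :=
    ((hF.contDiffAt hy).isSymmSndFDerivAt (by simp; exact WithTop.coe_le_coe.2 le_top)).eq u v
  rw [dForm, h.fderiv]
  simp [hsymm]
  ring

lemma dForm_eq (u v : RVec (2 * n + 1)) : (dForm θ y u v : ℂ) =
    kahlerForm (1 : Matrix (Fin (n + 1)) (Fin (n + 1)) ℂ)
      (fderiv ℝ F y u) (fderiv ℝ F y v) := by
  rw [hF.dForm_form hy hθ, kahlerForm]
  simp only [Matrix.one_apply, ite_mul, one_mul, zero_mul, Finset.sum_ite_eq, Finset.mem_univ,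
    if_true, imForm_apply]
  rw [← Finset.sum_sub_distrib, Finset.mul_sum, Finset.mul_sum, Complex.ofReal_sum]
  refine Finset.sum_congr rfl fun j _ => ?_
  apply Complex.ext <;> simp <;> ring

end

section

variable {g : CVec (n + 1) → Matrix (Fin (n + 1)) (Fin (n + 1)) ℂ} {V : Set (CVec (n + 1))}
  (hF : IsQuadricParam F B U)
  (hθ : ∀ y ∈ U, θ y = (2 : ℝ) • (imForm n (F y)).comp (fderiv ℝ F y))
  (hM : IsLocalHypersurface g F θ U V) {y : RVec (2 * n + 1)} (hy : y ∈ U)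
include hF hθ hM hy

/-- On the quadric, the `(1,0)`-part of the Reeb field is `i Re z`. -/
lemma normalVec_eq : normalVec F θ y = Complex.I • toC (rePart (F y)) := by
  have ht : reForm n (F y) (Complex.I • toC (rePart (F y))) = 0 := by
    rw [reForm_I_smul, imForm_realPart, neg_zero]
  have hT := hF.fderiv_chart y hy _ ht
  have h : reeb θ y = B (Complex.I • toC (rePart (F y))) := by
    refine hM.reeb_eq_of hy ?_ fun v => ?_
    · rw [form_apply hy hθ, hT, imForm_I_smul, reForm_realPart,
        mem_quadric_iff.1 (hF.mem y hy)]
      norm_num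
    · have h₁ : imForm n (Complex.I • toC (rePart (F y))) (fderiv ℝ F y v) = 0 := by
        simp [imForm_apply, toC]
      have h₂ : imForm n (fderiv ℝ F y v) (Complex.I • toC (rePart (F y))) = 0 := by
        rw [imForm_I_smul, reForm_realPart, reForm_comm, hF.reForm_fderiv hy]
      rw [hF.dForm_form hy hθ, hT, h₁, h₂]
      simp
  rw [normalVec, reebC, h, dC_toC, hT]

omit hF hθ hM hy in
lemma herm_one (a b : CVec (n + 1)) :
    herm (1 : Matrix (Fin (n + 1)) (Fin (n + 1)) ℂ) a b = ∑ j, a j * star (b j) := by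
  simp only [herm, Matrix.one_apply, ite_mul, one_mul, zero_mul, Finset.sum_ite_eq,
    Finset.mem_univ, if_true]

variable (hg : g (F y) = 1)
include hg

lemma normalSq_eq : normalSq g F θ y = 1 / 2 := by
  have h := mem_quadric_iff.1 (hF.mem y hy)
  rw [reForm_apply] at h
  have h' := congrArg (fun r : ℝ => (r : ℂ)) h
  rw [normalSq, hF.normalVec_eq hθ hM hy, herm_smul_left, herm_smul_right, hg, herm_one,
    ← mul_assoc, Complex.star_def, Complex.conj_I, mul_neg, Complex.I_mul_I, neg_neg, one_mul]
  simp only [toC, rePart, Complex.conj_ofReal]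
  push_cast at h'
  exact h'

omit hg in
lemma dC_normalVec_star {Z : CVec (2 * n + 1)} (hZ : Z ∈ T10 F y) :
    dC (normalVec F θ) y (star Z) = (Complex.I / 2) • star (dC F y Z) := by
  have hd : DifferentiableAt ℝ F y := (hF.contDiffAt hy).differentiableAt (by simp)
  have e : normalVec F θ =ᶠ[𝓝 y] fun x => (Complex.I / 2) • (F x + star (F x)) := by
    filter_upwards [hF.isOpen.mem_nhds hy] with x hx
    rw [hF.normalVec_eq hθ hM hx]
    ext k
    simp only [Pi.smul_apply, toC, rePart, Pi.add_apply, Pi.star_apply, Complex.star_def,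
      Complex.add_conj, smul_eq_mul]
    push_cast
    ring
  rw [dC_congr e, dC_smul (differentiableAt_const _) (hd.fun_add (differentiableAt_star hd)),
    dC_const, zero_smul, zero_add, dC_add hd (differentiableAt_star hd), dC_star, star_star,
    mem_T10_iff.1 hZ, zero_add]

/-- The holomorphic sectional torsion of the quadric is `½ ∑ a_j² / ∑ |a_j|²` for `a = F_* Z`. -/
lemma secTorsion_eq {Z : CVec (2 * n + 1)} (hZ : Z ∈ T10 F y) :
    secTorsion F θ y Z = 1 / 2 * (∑ j, dC F y Z j ^ 2) / ∑ j, dC F y Z j * star (dC F y Z j) := by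
  rw [hM.secTorsion_eq hy hZ, torsionForm, hF.dC_normalVec_star hθ hM hy hZ, herm_smul_right,
    hM.levi_eq_herm_of_left hy _ hZ, hg, herm_one, herm_one]
  simp only [Pi.star_apply, star_star, pow_two]
  congr 1
  rw [← mul_assoc]
  congr 1
  rw [Complex.star_def, map_div₀, Complex.conj_I, Complex.conj_ofNat, mul_div_assoc', mul_neg,
    Complex.I_mul_I, neg_neg]

lemma norm_secTorsion_le {Z : CVec (2 * n + 1)} (hZ : Z ∈ T10 F y) :
    ‖secTorsion F θ y Z‖ ≤ 1 / 2 := by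
  rw [hF.secTorsion_eq hθ hM hy hg hZ]
  set a := dC F y Z
  have h₁ : ∑ j, a j * star (a j) = ((∑ j, ‖a j‖ ^ 2 : ℝ) : ℂ) := by
    push_cast
    exact Finset.sum_congr rfl fun j _ => by rw [Complex.star_def, Complex.mul_conj']
  have h₂ : ‖∑ j, a j ^ 2‖ ≤ ∑ j, ‖a j‖ ^ 2 :=
    (norm_sum_le _ _).trans_eq (Finset.sum_congr rfl fun j _ => norm_pow _ _)
  have h₃ : 0 ≤ ∑ j, ‖a j‖ ^ 2 := Finset.sum_nonneg fun j _ => by positivity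
  rw [h₁, norm_div, norm_mul, Complex.norm_real, Real.norm_of_nonneg h₃]
  refine div_le_of_le_mul₀ h₃ (by norm_num) ?_
  norm_num
  linarith

/-- Equality holds on the `(1,0)`-vectors with real components in `ℂ^{n+1}`. -/
lemma exists_norm_secTorsion_eq (hn : 1 ≤ n) :
    ∃ Z ∈ T10 F y, Z ≠ 0 ∧ ‖secTorsion F θ y Z‖ = 1 / 2 := by
  obtain ⟨b, hb, hb0⟩ : ∃ b : RVec (n + 1), reForm n (F y) (toC b) = 0 ∧ b ≠ 0 := by
    let φ : RVec (n + 1) →ₗ[ℝ] ℝ :=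
      { toFun := fun b => ∑ j, (F y j).re * b j
        map_add' := fun b c => by
          simp only [Pi.add_apply, mul_add, Finset.sum_add_distrib]
        map_smul' := fun c b => by
          simp only [Pi.smul_apply, smul_eq_mul, Finset.mul_sum, RingHom.id_apply]
          exact Finset.sum_congr rfl fun j _ => by ring }
    have hlt : Module.finrank ℝ ℝ < Module.finrank ℝ (RVec (n + 1)) := by
      rw [Module.finrank_self, Module.finrank_fintype_fun_eq_card, Fintype.card_fin]
      omega
    obtain ⟨b, hb, hb0⟩ := (Submodule.ne_bot_iff _).1
      (LinearMap.ker_ne_bot_of_finrank_lt (f := φ) hlt)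
    refine ⟨b, ?_, hb0⟩
    rw [reForm_apply]
    exact LinearMap.mem_ker.1 hb
  have hb' : imForm n (F y) (toC b) = 0 := by simp [imForm_apply, toC]
  obtain ⟨Z, hZ, e, -⟩ := hF.exists_mem_T10 hy hb hb'
  have hs : (∑ j, b j ^ 2) ≠ 0 := by
    intro h
    refine hb0 (funext fun j => ?_)
    exact pow_eq_zero_iff two_ne_zero |>.1
      ((Finset.sum_eq_zero_iff_of_nonneg fun j _ => sq_nonneg (b j)).1 h j (Finset.mem_univ j))
  refine ⟨Z, hZ, ?_, ?_⟩
  · rintro rfl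
    refine hb0 (funext fun j => ?_)
    rw [← dCL_apply, map_zero] at e
    have := congrFun e j
    simpa [toC] using this.symm
  · rw [hF.secTorsion_eq hθ hM hy hg hZ, e]
    have h₁ : ∑ j, (toC b) j ^ 2 = ((∑ j, b j ^ 2 : ℝ) : ℂ) := by simp [toC]
    have h₂ : ∑ j, (toC b) j * star ((toC b) j) = ((∑ j, b j ^ 2 : ℝ) : ℂ) := by
      simp [toC, pow_two]
    rw [h₁, h₂, mul_div_assoc, div_self (Complex.ofReal_ne_zero.2 hs)]
    norm_num

end

end IsQuadricParam

/-! ### The quadric as a manifold -/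

section Manifold

variable {n : ℕ}

/-- A choice of linear coordinates on the tangent space at a point of the quadric. -/
noncomputable def splitting (p : quadric n) : TangentSplitting (p : CVec (n + 1)) :=
  Classical.choice (nonempty_tangentSplitting p.2)

open Classical in
/-- The inverse of the chart at `p`, extended by the value `p`. -/
noncomputable def quadricChartInv (p : quadric n) (v : RVec (2 * n + 1)) : quadric n :=
  if hv : v ∈ (splitting p).target then ⟨(splitting p).param v, (splitting p).param_mem p.2 hv⟩
  else p

lemma coe_quadricChartInv (p : quadric n) {v : RVec (2 * n + 1)}
    (hv : v ∈ (splitting p).target) :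
    (quadricChartInv p v : CVec (n + 1)) = (splitting p).param v := by
  rw [quadricChartInv, dif_pos hv]

/-- The chart of the quadric at `p`, given by projecting to the tangent space at `p`. -/
noncomputable def quadricChart (p : quadric n) :
    OpenPartialHomeomorph (quadric n) (RVec (2 * n + 1)) where
  toFun z := (splitting p).proj z
  invFun := quadricChartInv p
  source := {z | 0 < reForm n p z}
  target := (splitting p).target
  map_source' z hz := ((splitting p).param_proj p.2 z.2 hz).1
  map_target' v hv := by
    rw [Set.mem_ofPred_eq, coe_quadricChartInv p hv, (splitting p).reForm_param p.2]
    exact half_pos (Real.sqrt_pos.2 (sub_pos.2 hv))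
  left_inv' z hz := by
    obtain ⟨h₁, h₂⟩ := (splitting p).param_proj p.2 z.2 hz
    exact Subtype.ext ((coe_quadricChartInv p h₁).trans h₂)
  right_inv' v hv := by rw [coe_quadricChartInv p hv, (splitting p).proj_param p.2]
  open_source := isOpen_lt continuous_const ((reForm n p).continuous.comp continuous_subtype_val)
  open_target := (splitting p).isOpen_target
  continuousOn_toFun := ((splitting p).proj.continuous.comp continuous_subtype_val).continuousOn
  continuousOn_invFun := by
    rw [Topology.IsInducing.subtypeVal.continuousOn_iff]
    exact (splitting p).contDiffOn_param.continuousOn.congr fun v hv => coe_quadricChartInv p hv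

noncomputable instance : ChartedSpace (RVec (2 * n + 1)) (quadric n) where
  atlas := Set.range quadricChart
  chartAt := quadricChart
  mem_chart_source p := by
    change 0 < reForm n p p
    rw [mem_quadric_iff.1 p.2]
    norm_num
  chart_mem_atlas p := ⟨p, rfl⟩

instance : IsManifold 𝓘(ℝ, RVec (2 * n + 1)) ∞ (quadric n) := by
  refine isManifold_of_contDiffOn _ _ _ ?_
  rintro _ _ ⟨p, rfl⟩ ⟨q, rfl⟩
  have h : ContDiffOn ℝ ∞ (fun v => (splitting q).proj ((splitting p).param v))
      (splitting p).target :=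
    (splitting q).proj.contDiff.comp_contDiffOn (splitting p).contDiffOn_param
  have hsub : 𝓘(ℝ, RVec (2 * n + 1)).symm ⁻¹' ((quadricChart p).symm ≫ₕ quadricChart q).source ∩
      Set.range 𝓘(ℝ, RVec (2 * n + 1)) ⊆ (splitting p).target := by
    rintro v ⟨hv, -⟩
    exact hv.1
  refine (h.mono hsub).congr fun v hv => ?_
  exact congrArg (splitting q).proj (coe_quadricChartInv p (hsub hv))

lemma chartMap_quadric_eq (p : quadric n) {y : RVec (2 * n + 1)}
    (hy : y ∈ (splitting p).target) :
    chartMap (Subtype.val : quadric n → CVec (n + 1)) p y = (splitting p).param y := by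
  rw [chartMap, extChartAt_model_space_eq_id]
  exact coe_quadricChartInv p hy

lemma chartDom_quadric (p : quadric n) :
    chartDom (Subtype.val : quadric n → CVec (n + 1)) p = (splitting p).target := by
  ext y
  rw [chartDom, extChartAt_model_space_eq_id]
  simp only [PartialEquiv.refl_source, Set.mem_univ, Set.ofPred_true, Set.inter_univ]
  rw [extChartAt_target]
  simp only [modelWithCornersSelf_coe_symm, Set.preimage_id, modelWithCornersSelf_coe,
    Set.range_id, Set.inter_univ]
  rfl

lemma isQuadricParam_chartMap (p : quadric n) :
    IsQuadricParam (chartMap (Subtype.val : quadric n → CVec (n + 1)) p) (splitting p).proj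
      (chartDom (Subtype.val : quadric n → CVec (n + 1)) p) := by
  rw [chartDom_quadric]
  exact (splitting p).isQuadricParam p.2 (splitting p).isOpen_target subset_rfl
    fun y hy => chartMap_quadric_eq p hy

lemma contMDiff_quadric_val : ContMDiff 𝓘(ℝ, RVec (2 * n + 1)) 𝓘(ℝ, CVec (n + 1)) ∞
    (Subtype.val : quadric n → CVec (n + 1)) := by
  refine contMDiff_iff.2 ⟨continuous_subtype_val, fun p z => ?_⟩
  have h := (isQuadricParam_chartMap p).smooth
  rw [chartDom_quadric] at h
  rw [extChartAt_model_space_eq_id]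
  refine (h.mono ?_).congr ?_
  · rintro y ⟨hy, -⟩
    rw [extChartAt_target] at hy
    exact hy.1
  · intro y hy
    rw [chartMap, extChartAt_model_space_eq_id]
    rfl

/-- The differential at `z` of the inclusion of the quadric. -/
noncomputable abbrev dVal (z : quadric n) :
    TangentSpace 𝓘(ℝ, RVec (2 * n + 1)) z →L[ℝ] CVec (n + 1) :=
  mfderiv 𝓘(ℝ, RVec (2 * n + 1)) 𝓘(ℝ, CVec (n + 1)) (Subtype.val : quadric n → CVec (n + 1)) z

lemma reForm_dVal (z : quadric n) (v : TangentSpace 𝓘(ℝ, RVec (2 * n + 1)) z) :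
    reForm n z (dVal z v) = 0 := by
  have hd : HasMFDerivAt 𝓘(ℝ, RVec (2 * n + 1)) 𝓘(ℝ, CVec (n + 1))
      (Subtype.val : quadric n → CVec (n + 1)) z (dVal z) :=
    (contMDiff_quadric_val z).mdifferentiableAt (by simp) |>.hasMFDerivAt
  have hq : HasFDerivAt (fun w => reForm n w w) _ (z : CVec (n + 1)) :=
    (reForm n).hasFDerivAt.clm_apply (hasFDerivAt_id (z : CVec (n + 1)))
  have h := (hq.hasMFDerivAt.comp z hd).mfderiv
  have e : (fun w => reForm n w w) ∘ (Subtype.val : quadric n → CVec (n + 1)) = fun _ => 1 / 2 :=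
    funext fun w => mem_quadric_iff.1 w.2
  rw [e, mfderiv_const] at h
  have h' : 0 = reForm n z (dVal z v) + reForm n (dVal z v) z :=
    congrArg (fun L : RVec (2 * n + 1) →L[ℝ] ℝ => L v) h
  rw [reForm_comm (dVal z v)] at h'
  linarith

lemma injective_dVal (z : quadric n) : Function.Injective (dVal z) := by
  have hd : HasMFDerivAt 𝓘(ℝ, RVec (2 * n + 1)) 𝓘(ℝ, CVec (n + 1))
      (Subtype.val : quadric n → CVec (n + 1)) z (dVal z) :=
    (contMDiff_quadric_val z).mdifferentiableAt (by simp) |>.hasMFDerivAt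
  have h := ((splitting z).proj.hasMFDerivAt.comp z hd).mfderiv
  have e : (splitting z).proj ∘ (Subtype.val : quadric n → CVec (n + 1)) =
    extChartAt 𝓘(ℝ, RVec (2 * n + 1)) z := rfl
  have : IsManifold 𝓘(ℝ, RVec (2 * n + 1)) 1 (quadric n) := IsManifold.of_le (n := ∞) (by simp)
  have hinv := isInvertible_mfderiv_extChartAt (I := 𝓘(ℝ, RVec (2 * n + 1)))
    (mem_extChartAt_source z)
  rw [e] at h
  have hi := hinv.injective
  rw [h] at hi
  exact Function.Injective.of_comp hi

/-- The pullback of `i ∂̄ϱ` to the quadric. -/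
noncomputable def quadricForm (z : quadric n) : TangentSpace 𝓘(ℝ, RVec (2 * n + 1)) z →L[ℝ] ℝ :=
  (2 : ℝ) • (imForm n z).comp (dVal z)

lemma chartForm_quadricForm (p : quadric n) {y : RVec (2 * n + 1)}
    (hy : y ∈ chartDom (Subtype.val : quadric n → CVec (n + 1)) p) :
    chartForm quadricForm p y =
      (2 : ℝ) • (imForm n (chartMap (Subtype.val : quadric n → CVec (n + 1)) p y)).comp
        (fderiv ℝ (chartMap (Subtype.val : quadric n → CVec (n + 1)) p) y) := by
  have : IsManifold 𝓘(ℝ, RVec (2 * n + 1)) 1 (quadric n) := IsManifold.of_le (n := ∞) (by simp)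
  have h₁ := isInvertible_mfderivWithin_extChartAt_symm (I := 𝓘(ℝ, RVec (2 * n + 1))) hy.1
  rw [modelWithCornersSelf_coe, Set.range_id, mfderivWithin_univ] at h₁
  have d₁ := mdifferentiableAt_of_isInvertible_mfderiv h₁
  have d₂ := (contMDiff_quadric_val ((extChartAt 𝓘(ℝ, RVec (2 * n + 1)) p).symm y)
    ).mdifferentiableAt (by simp)
  have e : chartMap (Subtype.val : quadric n → CVec (n + 1)) p =
      Subtype.val ∘ (extChartAt 𝓘(ℝ, RVec (2 * n + 1)) p).symm := by
    funext x
    rw [chartMap, extChartAt_model_space_eq_id]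
    rfl
  have h := (d₂.hasMFDerivAt.comp y d₁.hasMFDerivAt).mfderiv
  rw [← mfderiv_eq_fderiv, e]
  erw [h]
  rfl

lemma isSemiIsometric_quadric : IsSemiIsometric (flatMetric n)
    (Subtype.val : quadric n → CVec (n + 1)) quadricForm where
  smooth_map := contMDiff_quadric_val
  immersion := injective_dVal
  smooth_form p y hy := by
    have h : y ∈ chartDom (Subtype.val : quadric n → CVec (n + 1)) p := by
      refine ⟨hy, ?_⟩
      rw [extChartAt_model_space_eq_id]
      trivial
    exact ((isQuadricParam_chartMap p).contDiffAt_form h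
      fun y hy => chartForm_quadricForm p hy).contDiffWithinAt
  ker_eq p y hy v := (isQuadricParam_chartMap p).form_eq_zero_iff hy
    (fun y hy => chartForm_quadricForm p hy) v
  dForm_eq p y hy u v := by
    have h : coordMatrix (flatMetric n).form (p : CVec (n + 1)) = fun _ => 1 :=
      funext fun z => coordMatrix_flatForm _ z
    rw [h]
    exact (isQuadricParam_chartMap p).dForm_eq hy (fun y hy => chartForm_quadricForm p hy) u v

lemma meanCurvSq_quadric (hn : 1 ≤ n) (p : quadric n) :
    meanCurvSq (flatMetric n) (Subtype.val : quadric n → CVec (n + 1)) quadricForm p = 1 / 2 := by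
  rw [isSemiIsometric_quadric.meanCurvSq_eq hn, (isQuadricParam_chartMap p).normalSq_eq
    (fun y hy => chartForm_quadricForm p hy) (isSemiIsometric_quadric.isLocalHypersurface p)
    (chartPt_mem_chartDom _ p) (coordMatrix_flatForm _ _)]
  norm_num

lemma isCConvex_quadric (hn : 1 ≤ n) : IsCConvex (flatMetric n)
    (Subtype.val : quadric n → CVec (n + 1)) quadricForm := by
  refine (isSemiIsometric_quadric.isCConvex_iff hn).2 fun p Z hZ _ => ?_
  rw [meanCurvSq_quadric hn]
  exact (isQuadricParam_chartMap p).norm_secTorsion_le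
    (fun y hy => chartForm_quadricForm p hy) (isSemiIsometric_quadric.isLocalHypersurface p)
    (chartPt_mem_chartDom _ p) (coordMatrix_flatForm _ _) hZ

lemma exists_norm_holTorsion_quadric (hn : 1 ≤ n) (p : quadric n) :
    ∃ Z ∈ holTangent (Subtype.val : quadric n → CVec (n + 1)) p, Z ≠ 0 ∧
      ‖holTorsion (Subtype.val : quadric n → CVec (n + 1)) quadricForm p Z‖ = 1 / 2 :=
  (isQuadricParam_chartMap p).exists_norm_secTorsion_eq
    (fun _ hy => chartForm_quadricForm p hy) (isSemiIsometric_quadric.isLocalHypersurface p)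
    (chartPt_mem_chartDom _ p) (coordMatrix_flatForm _ _) hn

lemma quadricForm_apply (p : quadric n) (v : TangentSpace 𝓘(ℝ, RVec (2 * n + 1)) p) :
    (quadricForm p v : ℂ) = Complex.I * ∑ j, ((p : CVec (n + 1)) j + star ((p : CVec (n + 1)) j)) *
      star (dVal p v j) := by
  have h₁ : quadricForm p v = 2 * imForm n p (dVal p v) := rfl
  have h₂ := reForm_dVal p v
  rw [reForm_apply] at h₂
  rw [h₁, imForm_apply]
  have h₃ : ∑ j, 2 * ((p : CVec (n + 1)) j).re * (dVal p v j).re = 0 := by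
    have : ∀ j, 2 * ((p : CVec (n + 1)) j).re * (dVal p v j).re =
        2 * (((p : CVec (n + 1)) j).re * (dVal p v j).re) := fun j => mul_assoc _ _ _
    rw [Finset.sum_congr rfl fun j _ => this j, ← Finset.mul_sum, h₂, mul_zero]
  apply Complex.ext
  · simp [Finset.mul_sum]
    exact Finset.sum_congr rfl fun j _ => by ring
  · rw [Complex.I_mul_im, Complex.ofReal_im, Complex.re_sum, ← h₃]
    refine Finset.sum_congr rfl fun j _ => ?_
    simp only [Complex.mul_re, Complex.add_re, Complex.add_im, Complex.star_def, Complex.conj_re,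
      Complex.conj_im]
    ring

end Manifold

end PseudoHermitian

theorem theorem1p1 (n : ℕ) (hn : 1 ≤ n) :
    (∀ (X : Type*) [TopologicalSpace X] [ChartedSpace (CVec (n + 1)) X]
        [IsManifold 𝓘(ℂ, CVec (n + 1)) ω X]
        (M : Type*) [TopologicalSpace M] [ChartedSpace (RVec (2 * n + 1)) M]
        [IsManifold 𝓘(ℝ, RVec (2 * n + 1)) ∞ M]
        (g : KahlerMetric n X) (ι : M → X)
        (θ : ∀ p : M, TangentSpace 𝓘(ℝ, RVec (2 * n + 1)) p →L[ℝ] ℝ),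
        IsSemiIsometric g ι θ →
          (IsCConvex g ι θ ↔
            ∀ p : M, ∀ Z ∈ holTangent ι p, Z ≠ 0 → ‖holTorsion ι θ p Z‖ ≤ meanCurvSq g ι θ p) ∧
          (IsStrictlyCConvex g ι θ ↔
            ∀ p : M, ∀ Z ∈ holTangent ι p, Z ≠ 0 → ‖holTorsion ι θ p Z‖ < meanCurvSq g ι θ p) ∧
          (IsCConvex g ι θ →
            ∀ p : M, ∀ Z ∈ holTangent ι p, Z ≠ 0 →
              holCurv ι θ p Z ≥ 1 / 2 * ambientCurv g ι p Z + 1 / 2 * meanCurvSq g ι θ p)) ∧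
    (∃ (_ : ChartedSpace (RVec (2 * n + 1)) (quadric n))
        (_ : IsManifold 𝓘(ℝ, RVec (2 * n + 1)) ∞ (quadric n))
        (θ : ∀ p : quadric n, TangentSpace 𝓘(ℝ, RVec (2 * n + 1)) p →L[ℝ] ℝ),
        (∀ (p : quadric n) (v : TangentSpace 𝓘(ℝ, RVec (2 * n + 1)) p),
          (θ p v : ℂ) = Complex.I * ∑ j, ((p : CVec (n + 1)) j + star ((p : CVec (n + 1)) j)) *
            star ((mfderiv 𝓘(ℝ, RVec (2 * n + 1)) 𝓘(ℝ, CVec (n + 1))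
              (Subtype.val : quadric n → CVec (n + 1)) p v : CVec (n + 1)) j)) ∧
        IsSemiIsometric (flatMetric n) (Subtype.val : quadric n → CVec (n + 1)) θ ∧
        IsCConvex (flatMetric n) (Subtype.val : quadric n → CVec (n + 1)) θ ∧
        ∀ p : quadric n, ∃ Z ∈ holTangent (Subtype.val : quadric n → CVec (n + 1)) p, Z ≠ 0 ∧
          ‖holTorsion (Subtype.val : quadric n → CVec (n + 1)) θ p Z‖ =
            meanCurvSq (flatMetric n) (Subtype.val : quadric n → CVec (n + 1)) θ p ∧
          holCurv (Subtype.val : quadric n → CVec (n + 1)) θ p Z =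
            1 / 2 * ambientCurv (flatMetric n) (Subtype.val : quadric n → CVec (n + 1)) p Z +
            1 / 2 * meanCurvSq (flatMetric n) (Subtype.val : quadric n → CVec (n + 1)) θ p) := by
  refine ⟨fun X _ _ _ M _ _ _ g ι θ h => ⟨h.isCConvex_iff hn, h.isStrictlyCConvex_iff hn,
    fun hc p Z hZ hne => h.le_holCurv hn hZ hne ((h.isCConvex_iff hn).1 hc p Z hZ hne)⟩,
    inferInstance, inferInstance, quadricForm, quadricForm_apply, isSemiIsometric_quadric,
    isCConvex_quadric hn, fun p => ?_⟩
  obtain ⟨Z, hZ, hne, hA⟩ := exists_norm_holTorsion_quadric hn p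
  rw [← meanCurvSq_quadric hn p] at hA
  exact ⟨Z, hZ, hne, hA, isSemiIsometric_quadric.holCurv_eq hn hZ hne hA⟩
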